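/- **Notation.** Let $q\ge 2$ be an integer and let $v$ be an integer, representing a residue class modulo $q$. Put $d=(v,q)$ and $m=q/d$. Here $p$ denotes a prime, $\phi$ is Euler's function, $\Lambda$ is von Mangoldt's function, and $L(s,\chi)$ is the (analytically continued) $L$-function of the Dirichlet character $\chi$, which may be principal or imprimitive. For a finite set $\mathcal H$ of integers let $$\mathfrak S_q(\mathcal H)=\prod_{p\nmid q}\Big(1-\frac{\#(\mathcal H \bmod p)}{p}\Big)\Big(1-\frac1p\Big)^{-|\mathcal H|},\qquad \mathfrak S_{q,0}(\mathcal H)=\sum_{\mathcal T\subseteq\mathcal H}(-1)^{|\mathcal H\setminus\mathcal T|}\,\mathfrak S_q(\mathcal T),$$ and for real $H>0$ let $$S_0(q,v;H)=\sum_{h>0,\ h\equiv v\,(\mathrm{mod}\ q)}\mathfrak S_{q,0}(\{0,h\})\,e^{-h/H}.$$ Let $B_q(v)=\frac12-\frac vq$ for $1\le v\le q$, extended periodically modulo $q$. For a character $\chi$ modulo $m$ let $$A_{q,\chi}=\prod_{p\mid q}\Big(1-\frac{\chi(p)}p\Big)\prod_{p\nmid q}\Big(1-\frac{(1-\chi(p))^2}{(p-1)^2}\Big),$$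 and for $\mathrm{Re}(s)>-1$ let $$F_{q,\chi}(s)=\frac{L(s,\chi)L(s+1,\chi)}{L(2s+2,\chi^2)}\prod_{p\mid q}\Big(1+\frac{\chi(p)}{p^{s+1}}\Big)^{-1}\prod_{p\nmid q}\Big(1-\frac1{(p-1)^2}+\frac{2p\,\chi(p)}{(p-1)^2(p^{s+1}+\chi(p))}\Big).$$ Let $$Z_{q,\chi}(H)=\sum_{\substack{\rho:\ L(\rho,\chi^2)=0\\ \mathrm{Re}(\rho)>0}}\ \mathop{\mathrm{Res}}_{s=\rho/2-1}\big(F_{q,\chi}(s)H^s\Gamma(s)\big),\qquad Z_{q,v}(H)=\frac1{\phi(m)}\sum_{\chi\,(\mathrm{mod}\ m)}\bar\chi(v/d)\,Z_{q,\chi}(H/d),$$ where the first sum runs over the distinct zeros and is understood as the limit of its partial sums over $|\mathrm{Im}\,\rho|<T$, as $T\to\infty$ through the heights $T$ with $\big||\mathrm{Im}\,\rho|-T\big|\ge 1/T$ for all these zeros $\rho$. **Proposition.** Let $q\ge 2$ and let $v$ be any residue class modulo $q$. The series $S_0(q,v;H)$ converges for every $H>0$. For every character $\chi$ modulo $m$,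 the function $F_{q,\chi}$ is meromorphic in $\mathrm{Re}(s)>-1$ and equals $\sum_{h\ge1}\chi(h)\,\mathfrak S_q(\{0,h\})\,h^{-s}$ for $\mathrm{Re}(s)>1$. There are arbitrarily large admissible heights $T$, and the limit defining $Z_{q,\chi}(H)$ exists for every $H>0$. As $H\to\infty$, for every $\epsilon>0$ and with implied constants depending only on $q$, $v$ and $\epsilon$, the following hold. 1. $Z_{q,v}(H)=O(H^{-1/2+\epsilon})$. 2. If $v\equiv0\pmod q$, then $$S_0(q,v;H)=S_0(q,0;H)=-\frac{\phi(q)}{2q}\log H+S_0^c(q,0)+Z_{q,0}(H)+O(H^{-1+\epsilon}),$$ where $$S_0^c(q,0)=\frac{\phi(q)}{2q}\log\frac q{2\pi}-\frac{\phi(q)}{2q}\sum_{p\mid q}\frac{\log p}{p-1}+\frac12 .$$ 3. If $d=(v,q)<q$, then $$S_0(q,v;H)=S_0^c(q,v)+Z_{q,v}(H)+O(H^{-1+\epsilon}),$$ where $$S_0^c(q,v)=-\frac{\phi(q)}{2q}\cdot\frac{\Lambda(q/d)}{\phi(q/d)}-B_q(v)+\frac1{\phi(q/d)}\sum_{\chi\ne\chi_0\,(\mathrm{mod}\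 q/d)}\bar\chi(v/d)\,L(0,\chi)\,L(1,\chi)\,A_{q,\chi}.$$ -/

import Mathlib

open Filter Topology Asymptotics

namespace SingularSeries

/-- The singular series at the primes away from `q`:
`∏_{p ∤ q} (1 - #(𝓗 mod p) / p) (1 - 1/p)^(-|𝓗|)`. -/
noncomputable def singularSeries (q : ℕ) (S : Finset ℤ) : ℝ :=
  ∏' p : Nat.Primes,
    if (p : ℕ) ∣ q then 1
    else (1 - ((S.image (fun h : ℤ => (h : ZMod (p : ℕ)))).card : ℝ) / (p : ℕ)) /
      (1 - 1 / ((p : ℕ) : ℝ)) ^ S.card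

/-- The modified singular series
`𝔖_{q,0}(𝓗) = ∑_{𝓣 ⊆ 𝓗} (-1)^{|𝓗 \ 𝓣|} 𝔖_q(𝓣)`. -/
noncomputable def modifiedSingularSeries (q : ℕ) (S : Finset ℤ) : ℝ :=
  ∑ T ∈ S.powerset, (-1) ^ (S \ T).card * singularSeries q T

/-- The `h`-th term of `S_0(q,v;H)`; it is `0` unless `h > 0` and `h ≡ v (mod q)`. -/
noncomputable def smoothedTerm (q : ℕ) (v : ℤ) (H : ℝ) (h : ℕ) : ℝ :=
  open Classical in
  if 0 < h ∧ (h : ℤ) ≡ v [ZMOD q] then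
    modifiedSingularSeries q {0, (h : ℤ)} * Real.exp (-(h : ℝ) / H)
  else 0

/-- `S_0(q,v;H) = ∑_{h > 0, h ≡ v (q)} 𝔖_{q,0}({0,h}) e^{-h/H}`. -/
noncomputable def smoothedSum (q : ℕ) (v : ℤ) (H : ℝ) : ℝ :=
  ∑' h : ℕ, smoothedTerm q v H h

/-- The modulus `q / d`, where `d = (v, q)`. -/
def cofactor (q : ℕ) (v : ℤ) : ℕ := q / Int.gcd v q

instance cofactor_neZero (q : ℕ) [NeZero q] (v : ℤ) : NeZero (cofactor q v) := by
  have hq : 0 < q := Nat.pos_of_ne_zero (NeZero.ne q)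
  have hd : Int.gcd v q ∣ q := by exact_mod_cast Int.gcd_dvd_right v (q : ℤ)
  exact ⟨(Nat.div_pos (Nat.le_of_dvd hq hd) (Nat.pos_of_dvd_of_pos hd hq)).ne'⟩

/-- The residue class of `v / d` modulo `q / d`, where `d = (v, q)`. -/
def reducedClass (q : ℕ) (v : ℤ) : ZMod (cofactor q v) := ((v / (Int.gcd v q : ℤ) : ℤ) : ZMod _)

/-- `B_q(v) = 1/2 - v/q` for `1 ≤ v ≤ q`, extended periodically modulo `q`. -/
noncomputable def sawtooth (q : ℕ) (v : ℤ) : ℝ :=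
  1 / 2 - (((v - 1) % (q : ℤ) + 1 : ℤ) : ℝ) / q

/-- `A_{q,χ} = ∏_{p ∣ q} (1 - χ(p)/p) ∏_{p ∤ q} (1 - (1 - χ(p))² / (p - 1)²)`. -/
noncomputable def eulerConstant (q : ℕ) {m : ℕ} (χ : DirichletCharacter ℂ m) : ℂ :=
  (∏ p ∈ q.primeFactors, (1 - χ (p : ZMod m) / (p : ℂ))) *
    ∏' p : Nat.Primes,
      if (p : ℕ) ∣ q then 1
      else 1 - (1 - χ ((p : ℕ) : ZMod m)) ^ 2 / (((p : ℕ) : ℂ) - 1) ^ 2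

/-- The constant `S_0^c(q,0)`. -/
noncomputable def constantZero (q : ℕ) : ℝ :=
  (q.totient : ℝ) / (2 * q) * Real.log (q / (2 * Real.pi))
    - (q.totient : ℝ) / (2 * q) * (∑ p ∈ q.primeFactors, Real.log p / ((p : ℝ) - 1))
    + 1 / 2

/-- The constant `S_0^c(q,v)` for `(v,q) < q`. -/
noncomputable def constantNonzero (q : ℕ) [NeZero q] (v : ℤ) : ℂ :=
  open Classical in
  -((q.totient : ℂ) / (2 * q)) *
      ((ArithmeticFunction.vonMangoldt (cofactor q v) : ℝ) / ((cofactor q v).totient : ℂ))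
    - (sawtooth q v : ℂ)
    + 1 / ((cofactor q v).totient : ℂ) *
      ∑ χ : DirichletCharacter ℂ (cofactor q v),
        if χ = 1 then 0
        else (starRingEnd ℂ) (χ (reducedClass q v)) * χ.LFunction 0 * χ.LFunction 1 *
          eulerConstant q χ

/-- `F_{q,χ}(s)` on `Re s > -1`, written as
`L(s,χ) L(s+1,χ) / L(2s+2,χ²)` times a product over primes that converges there. -/
noncomputable def F (q : ℕ) {m : ℕ} [NeZero m] (χ : DirichletCharacter ℂ m) (s : ℂ) : ℂ :=
  χ.LFunction s * χ.LFunction (s + 1) / (χ ^ 2).LFunction (2 * s + 2) *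
    (∏ p ∈ q.primeFactors, (1 + χ (p : ZMod m) / (p : ℂ) ^ (s + 1))⁻¹) *
    ∏' p : Nat.Primes,
      if (p : ℕ) ∣ q then 1
      else 1 - 1 / (((p : ℕ) : ℂ) - 1) ^ 2 +
        2 * ((p : ℕ) : ℂ) * χ ((p : ℕ) : ZMod m) /
          ((((p : ℕ) : ℂ) - 1) ^ 2 * (((p : ℕ) : ℂ) ^ (s + 1) + χ ((p : ℕ) : ZMod m)))

/-- The residue of `f` at an isolated singularity `z₀`:
the value of `(2πi)⁻¹ ∮ f` over all sufficiently small circles around `z₀`. -/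
noncomputable def residue (f : ℂ → ℂ) (z₀ : ℂ) : ℂ :=
  limUnder (𝓝[>] (0 : ℝ)) fun r : ℝ =>
    (2 * Real.pi * Complex.I)⁻¹ * ∮ z in C(z₀, r), f z

/-- The zeros `ρ` of `L(s,ψ)` with `Re ρ > 0`.  The point `1` is never a zero of `L(s,ψ)`; it is
left out because `L(s,ψ)` has a pole there when `ψ` is principal. -/
def zeros {m : ℕ} [NeZero m] (ψ : DirichletCharacter ℂ m) : Set ℂ :=
  {ρ | 0 < ρ.re ∧ ρ ≠ 1 ∧ ψ.LFunction ρ = 0}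

/-- `T → ∞` through heights `T` such that no zero of `L(s,ψ)` with positive real part has
`| |Im ρ| - T | < 1/T`: the usual convention for sums over zeros. -/
def heights {m : ℕ} [NeZero m] (ψ : DirichletCharacter ℂ m) : Filter ℝ :=
  atTop ⊓ 𝓟 {T : ℝ | ∀ ρ ∈ zeros ψ, 1 / T ≤ |(|ρ.im| - T)|}

/-- The sum over distinct zeros `ρ` of `L(s,χ²)` with `Re ρ > 0` and `|Im ρ| < T` of the residues
of `F_{q,χ}(s) H^s Γ(s)` at `s = ρ/2 - 1`. -/
noncomputable def partialZeroSum (q : ℕ) {m : ℕ} [NeZero m] (χ : DirichletCharacter ℂ m)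
    (H T : ℝ) : ℂ :=
  ∑ᶠ ρ ∈ {ρ : ℂ | ρ ∈ zeros (χ ^ 2) ∧ |ρ.im| < T},
    residue (fun s => F q χ s * (H : ℂ) ^ s * Complex.Gamma s) (ρ / 2 - 1)

/-- `Z_{q,χ}(H)`, the sum over all zeros `ρ` of `L(s,χ²)` with `Re ρ > 0`, by increasing height. -/
noncomputable def zeroSumChar (q : ℕ) {m : ℕ} [NeZero m] (χ : DirichletCharacter ℂ m)
    (H : ℝ) : ℂ :=
  limUnder (heights (χ ^ 2)) fun T => partialZeroSum q χ H T

/-- `Z_{q,v}(H) = φ(q/d)⁻¹ ∑_{χ mod q/d} conj χ(v/d) Z_{q,χ}(H/d)`, where `d = (v,q)`. -/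
noncomputable def zeroSum (q : ℕ) [NeZero q] (v : ℤ) (H : ℝ) : ℂ :=
  1 / ((cofactor q v).totient : ℂ) *
    ∑ χ : DirichletCharacter ℂ (cofactor q v),
      (starRingEnd ℂ) (χ (reducedClass q v)) * zeroSumChar q χ (H / (Int.gcd v q : ℝ))

end SingularSeries

/-!
Writing `d = (v,q)` and `m = q/d`, a positive `h ≡ v (mod q)` is `h = d k` with `k` in a reduced
class modulo `m`, and `𝔖_q({0, d k}) = 𝔖_q({0, k})` because only primes `p ∤ q` enter the singular
series. As `𝔖_{q,0}({0,h}) = 𝔖_q({0,h}) - 1`, orthogonality of the characters modulo `m` expresses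
`S_0(q,v;H)` through the sums `∑ χ(k) 𝔖_q({0,k}) e^{-k/X}` with `X = H/d`, minus
`∑ e^{-h/H} = H/q + B_q(v) + O(1/H)` (`hasSum_smoothedTerm`, `abs_tsum_exp_progression_sub_le`).

The Dirichlet series with coefficients `χ(k) 𝔖_q({0,k})` is `F_{q,χ}` (`LSeriesHasSum_F`): in
`Re s > -1/2` all Euler products can be compared prime by prime, and `F` is `L(s,χ) L(s+1,χ)`
times a product converging there (`F_eq_mul_regularPart`). By Mellin inversion the twisted sum is
the integral of `F(s) X^s Γ(s) / (2πi)` along `Re s = 3/2` (`hasSum_smoothed`).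

This contour is moved to the left edge of a rectangle of height `T/2`, at
`Re s = -1 + θ (2 + T)^(-1/4)` (`exists_tendsto_partialZeroSum`). The poles crossed are those at
`ρ/2 - 1`, which make up the sum over zeros, and those at `1` and `0`; the point `-1/2`, where
`L(2s+2,χ²)` may have its pole, is a removable singularity of `F`. The following facts make the
shift possible.

* `exists_le_re_zeros`: the zeros `ρ` satisfy `Re ρ ≥ c (1 + |Im ρ|)^(-1/4)`, so that for small
  `θ` the left edges stay to the left of all poles `ρ/2 - 1` up to their height. This is a weak
  zero-free region to the left of `Re s = 1`, obtained from the `3-4-1` inequality, reflected by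
  the functional equation of the primitive character.
* `exists_norm_LFunction_le`: `L(s,χ)` grows polynomially in `Re s > -1`, by Euler–Maclaurin
  summation over blocks of length the modulus.
* `exists_norm_LFunction_ge`: at distance `η` from the zeros, `1/L` is at most
  `exp (A log |t| (1 + log (1/η)))`. The zeros in a disc are removed by Blaschke factors, and the
  rest is bounded from below by Borel–Carathéodory (`norm_ge_of_dist_zeros`).
* `norm_Gamma_le`: `Γ` decays exponentially. Near `Re s = -1` the Euler product over `p ∤ q` in
  `F` may be as large as the exponential of a power of `1/(1 + Re s)`, but to the right of the
  left edges this is at most `exp (O(T^{1/2}))`, and `Γ` wins (`exists_norm_F_mul_Gamma_le`).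

Convergence of the sum over zeros is seen on the left edges: raising the height from one
admissible `T` to the next changes the integral along the left edge by `O(e^{-T/4})`, since two
such edges bound a region free of poles (`exists_norm_leftIntegral_sub_le`). Admissible heights
exist in every interval of length `1` far up, there being `O(log T)` zeros near height `T`
(`exists_admissible_height`). On the left edges `X^s` is at most `X^{-1+ε}`, which gives the error
term. Starting instead from the line `Re s = -1/2 + δ`, with only the poles `ρ/2 - 1` in between,
gives `O(H^{-1/2+ε})` for the sum over zeros.

The pole at `1` occurs for the principal character only and cancels the main term `H/q`. At `0` a
nonprincipal character contributes `L(0,χ) L(1,χ) A_{q,χ}`, from the pole of `Γ`. For the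
principal character, `ζ(s+1) Γ(s)` has a double pole: for `m > 1` the factor
`∏_{p ∣ m} (1 - p^{-s})` vanishes at `0` with derivative `Λ(m)`, and for `m = 1` the logarithmic
derivatives of the remaining factors yield the terms `log H` and `S_0^c(q,0)`.
-/

namespace SingularSeries

/-! ### The residue theorem for rectangles -/

/-- The integral of `f` over the boundary of the rectangle `[a, b] × [c, d]`, counterclockwise. -/
noncomputable def rectIntegral (f : ℂ → ℂ) (a b c d : ℝ) : ℂ :=
  (∫ x in a..b, f (x + c * Complex.I)) - (∫ x in a..b, f (x + d * Complex.I)) +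
    Complex.I * (∫ y in c..d, f (b + y * Complex.I)) -
    Complex.I * (∫ y in c..d, f (a + y * Complex.I))

/-- `f` has a Laurent expansion with finite principal part at `z`, with residue `a`. -/
def HasResidueAt (f : ℂ → ℂ) (z a : ℂ) : Prop :=
  ∃ (n : ℕ) (c : ℕ → ℂ) (g : ℂ → ℂ), AnalyticAt ℂ g z ∧ c 0 = a ∧
    f =ᶠ[𝓝[≠] z] fun s => g s + ∑ k ∈ Finset.range (n + 1), c k * ((s - z) ^ (k + 1))⁻¹

lemma hasResidueAt_congr {f g : ℂ → ℂ} {z a : ℂ} (h : f =ᶠ[𝓝[≠] z] g) (hg : HasResidueAt g z a) :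
    HasResidueAt f z a := by
  obtain ⟨n, c, k, hk, hc, hE⟩ := hg
  exact ⟨n, c, k, hk, hc, h.trans hE⟩

lemma HasResidueAt.add_analytic {f h : ℂ → ℂ} {z a : ℂ} (hf : HasResidueAt f z a)
    (hh : AnalyticAt ℂ h z) : HasResidueAt (fun s => f s + h s) z a := by
  obtain ⟨n, c, k, hk, hc, hE⟩ := hf
  refine ⟨n, c, fun s => k s + h s, hk.add hh, hc, ?_⟩
  filter_upwards [hE] with s hs
  rw [hs]; ring

lemma exists_principal_part {h : ℂ → ℂ} {z : ℂ} (hh : AnalyticAt ℂ h z) (n : ℕ) :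
    ∃ (c : ℕ → ℂ) (g : ℂ → ℂ), AnalyticAt ℂ g z ∧ (fun s => h s * ((s - z) ^ n)⁻¹) =ᶠ[𝓝[≠] z]
      fun s => g s + ∑ k ∈ Finset.range n, c k * ((s - z) ^ (k + 1))⁻¹ := by
  induction n generalizing h with
  | zero => exact ⟨0, h, hh, by simp⟩
  | succ n ih =>
    have hk : AnalyticAt ℂ (dslope h z) z := by
      obtain ⟨p, hp⟩ := hh
      exact hp.has_fpower_series_dslope_fslope.analyticAt
    obtain ⟨c, g, hg, hE⟩ := ih hk
    refine ⟨Function.update c n (h z), g, hg, ?_⟩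
    filter_upwards [hE, self_mem_nhdsWithin] with s hs hsz
    have hs' : s - z ≠ 0 := sub_ne_zero.mpr hsz
    have h1 : ∑ k ∈ Finset.range n, Function.update c n (h z) k * ((s - z) ^ (k + 1))⁻¹ =
        ∑ k ∈ Finset.range n, c k * ((s - z) ^ (k + 1))⁻¹ := by
      refine Finset.sum_congr rfl fun k hk => ?_
      rw [Function.update_of_ne (Finset.mem_range.mp hk).ne]
    rw [Finset.sum_range_succ, h1, Function.update_self, ← add_assoc, ← hs,
      dslope_of_ne _ hsz, slope_def_field]
    field_simp
    ring

lemma exists_hasResidueAt {f : ℂ → ℂ} {z : ℂ} (hf : MeromorphicAt f z) :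
    ∃ a, HasResidueAt f z a := by
  obtain ⟨n, hn⟩ := hf
  obtain ⟨c, g, hg, hE⟩ := exists_principal_part
    (h := fun s => (s - z) * ((s - z) ^ n • f s)) (z := z)
    ((analyticAt_id.sub analyticAt_const).mul hn) (n + 1)
  refine ⟨c 0, n, c, g, hg, rfl, ?_⟩
  filter_upwards [hE, self_mem_nhdsWithin] with s hs hsz
  have hs' : s - z ≠ 0 := sub_ne_zero.mpr hsz
  rw [← hs]
  simp only [smul_eq_mul]
  field_simp
  ring

lemma hasResidueAt_of_analyticAt {f g : ℂ → ℂ} {z : ℂ} (hg : AnalyticAt ℂ g z)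
    (h : f =ᶠ[𝓝[≠] z] g) : HasResidueAt f z 0 :=
  ⟨0, 0, g, hg, rfl, by simpa using h⟩

lemma hasResidueAt_simple_pole {f g : ℂ → ℂ} {z : ℂ} (hg : AnalyticAt ℂ g z)
    (h : f =ᶠ[𝓝[≠] z] fun s => g s / (s - z)) : HasResidueAt f z (g z) := by
  have hk : AnalyticAt ℂ (dslope g z) z := by
    obtain ⟨p, hp⟩ := hg
    exact hp.has_fpower_series_dslope_fslope.analyticAt
  refine ⟨0, fun _ => g z, dslope g z, hk, rfl, ?_⟩
  filter_upwards [h, self_mem_nhdsWithin] with s hs hsz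
  have hs' : s - z ≠ 0 := sub_ne_zero.mpr hsz
  rw [hs, dslope_of_ne _ hsz, slope_def_field]
  simp
  field_simp
  ring

lemma hasResidueAt_double_pole {f g : ℂ → ℂ} {z : ℂ} (hg : AnalyticAt ℂ g z)
    (h : f =ᶠ[𝓝[≠] z] fun s => g s / (s - z) ^ 2) : HasResidueAt f z (deriv g z) := by
  have hk : AnalyticAt ℂ (dslope g z) z := by
    obtain ⟨p, hp⟩ := hg
    exact hp.has_fpower_series_dslope_fslope.analyticAt
  have hk2 : AnalyticAt ℂ (dslope (dslope g z) z) z := by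
    obtain ⟨p, hp⟩ := hk
    exact hp.has_fpower_series_dslope_fslope.analyticAt
  refine ⟨1, fun k => if k = 0 then deriv g z else g z, _, hk2, by simp, ?_⟩
  filter_upwards [h, self_mem_nhdsWithin] with s hs hsz
  have hs' : s - z ≠ 0 := sub_ne_zero.mpr hsz
  rw [hs, dslope_of_ne _ hsz, slope_def_field, dslope_of_ne _ hsz, slope_def_field, dslope_same,
    Finset.sum_range_succ, Finset.sum_range_one]
  simp
  field_simp
  ring

/-- The residue defined by small circles is the coefficient of the Laurent expansion. -/
lemma HasResidueAt.residue_eq {f : ℂ → ℂ} {z a : ℂ} (hf : HasResidueAt f z a) :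
    residue f z = a := by
  obtain ⟨n, c, g, hg, hc, hE⟩ := hf
  refine Tendsto.limUnder_eq (tendsto_const_nhds.congr' ?_)
  obtain ⟨r₀, hr₀, hgd⟩ := Metric.eventually_nhds_iff_ball.mp hg.eventually_analyticAt
  obtain ⟨r₁, hr₁, hfE⟩ := Metric.eventually_nhds_iff_ball.mp (eventually_nhdsWithin_iff.mp hE)
  have hmin : 0 < min r₀ r₁ := lt_min hr₀ hr₁
  filter_upwards [Ioo_mem_nhdsGT hmin] with r hr
  have hr0 : 0 < r := hr.1
  -- on a small circle `f` is the analytic part plus the principal part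
  have hE' : Set.EqOn f (fun s => g s + ∑ k ∈ Finset.range (n + 1), c k * ((s - z) ^ (k + 1))⁻¹)
      (Metric.sphere z r) := by
    intro s hs
    refine hfE s ?_ ?_
    · rw [Metric.mem_ball, Metric.mem_sphere.mp hs]; exact hr.2.trans_le (min_le_right _ _)
    · intro h
      rw [Set.mem_singleton_iff] at h
      simp [h] at hs
      exact hr0.ne hs
  have hgc : ∀ s ∈ Metric.closedBall z r, AnalyticAt ℂ g s := fun s hs => hgd s
    (Metric.closedBall_subset_ball (hr.2.trans_le (min_le_left _ _)) hs)
  have hgi : CircleIntegrable g z r :=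
    ContinuousOn.circleIntegrable hr0.le fun s hs =>
      (hgc s (Metric.sphere_subset_closedBall hs)).continuousAt.continuousWithinAt
  have hki : ∀ k, CircleIntegrable (fun s => c k * ((s - z) ^ (k + 1))⁻¹) z r := by
    intro k
    refine ContinuousOn.circleIntegrable hr0.le ?_
    refine ContinuousOn.mul continuousOn_const (ContinuousOn.inv₀ (by fun_prop) fun s hs => ?_)
    refine pow_ne_zero _ (sub_ne_zero.mpr fun h => ?_)
    simp [h] at hs
    exact hr0.ne hs
  have hg0 : (∮ s in C(z, r), g s) = 0 :=
    Complex.circleIntegral_eq_zero_of_differentiable_on_off_countable hr0.le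
      Set.countable_empty
      (fun s hs => (hgc s hs).continuousAt.continuousWithinAt)
      (fun s hs => (hgc s (Metric.ball_subset_closedBall hs.1)).differentiableAt)
  rw [circleIntegral.integral_congr hr0.le hE', circleIntegral.integral_add hgi
    (CircleIntegrable.fun_sum _ fun k _ => hki k), hg0, zero_add,
    circleIntegral.integral_fun_sum (fun k _ => hki k), Finset.sum_range_succ', Finset.sum_eq_zero]
  · simp only [zero_add, pow_one]
    rw [circleIntegral.integral_const_mul, circleIntegral.integral_sub_center_inv _ hr0.ne', hc]
    have : (Real.pi : ℂ) ≠ 0 := by exact_mod_cast Real.pi_ne_zero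
    field_simp [Complex.I_ne_zero]
  · intro k _
    rw [circleIntegral.integral_const_mul]
    have := circleIntegral.integral_sub_zpow_of_ne (n := -((k : ℤ) + 1 + 1)) (by omega) z z r
    have h2 : ∀ s : ℂ, ((s - z) ^ (k + 1 + 1))⁻¹ = (s - z) ^ (-((k : ℤ) + 1 + 1)) := by
      intro s
      rw [zpow_neg]
      norm_cast
    simp_rw [h2, this, mul_zero]

lemma hasResidueAt_residue {f : ℂ → ℂ} {z : ℂ} (hf : MeromorphicAt f z) :
    HasResidueAt f z (residue f z) := by
  obtain ⟨a, ha⟩ := exists_hasResidueAt hf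
  rwa [ha.residue_eq]

lemma integral_horizontal_eq_sub {f F : ℂ → ℂ} {a b c : ℝ}
    (hF : ∀ x ∈ Set.uIcc a b, HasDerivAt F (f (x + c * Complex.I)) (x + c * Complex.I))
    (hf : ContinuousOn (fun x : ℝ => f (x + c * Complex.I)) (Set.uIcc a b)) :
    ∫ x in a..b, f (x + c * Complex.I) = F (b + c * Complex.I) - F (a + c * Complex.I) := by
  refine intervalIntegral.integral_eq_sub_of_hasDerivAt (f := fun x : ℝ => F (x + c * Complex.I))
    (fun x hx => ?_) hf.intervalIntegrable
  have h1 : HasDerivAt (fun x : ℝ => (x : ℂ) + c * Complex.I) 1 x :=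
    (Complex.ofRealCLM.hasDerivAt).add_const _
  simpa [Function.comp_def] using! (hF x hx).comp_of_eq x h1 rfl

lemma integral_vertical_eq_sub {f F : ℂ → ℂ} {a c d : ℝ}
    (hF : ∀ y ∈ Set.uIcc c d, HasDerivAt F (f (a + y * Complex.I)) (a + y * Complex.I))
    (hf : ContinuousOn (fun y : ℝ => f (a + y * Complex.I)) (Set.uIcc c d)) :
    Complex.I * ∫ y in c..d, f (a + y * Complex.I) =
      F (a + d * Complex.I) - F (a + c * Complex.I) := by
  rw [← intervalIntegral.integral_const_mul]
  refine intervalIntegral.integral_eq_sub_of_hasDerivAt (f := fun y : ℝ => F (a + y * Complex.I))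
    (fun y hy => ?_) (ContinuousOn.intervalIntegrable (continuousOn_const.mul hf))
  have h1 : HasDerivAt (fun y : ℝ => (a : ℂ) + y * Complex.I) Complex.I y := by
    simpa using ((Complex.ofRealCLM.hasDerivAt (x := y)).mul_const Complex.I).const_add (a : ℂ)
  have h2 := (hF y hy).comp_of_eq y h1 rfl
  rw [mul_comm] at h2
  exact h2

/-- The boundary of the rectangle `[a, b] × [c, d]`. -/
def rectBoundary (a b c d : ℝ) : Set ℂ :=
  {s | s.re ∈ Set.Icc a b ∧ s.im ∈ Set.Icc c d ∧ (s.re = a ∨ s.re = b ∨ s.im = c ∨ s.im = d)}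

section Edges

variable {f : ℂ → ℂ} {a b c d : ℝ}

lemma continuousOn_bottom (hab : a ≤ b) (hcd : c ≤ d) (hf : ContinuousOn f (rectBoundary a b c d)) :
    ContinuousOn (fun x : ℝ => f (x + c * Complex.I)) (Set.uIcc a b) := by
  refine hf.comp (by fun_prop) fun x hx => ?_
  rw [Set.uIcc_of_le hab] at hx
  simpa [rectBoundary, hcd] using hx

lemma continuousOn_top (hab : a ≤ b) (hcd : c ≤ d) (hf : ContinuousOn f (rectBoundary a b c d)) :
    ContinuousOn (fun x : ℝ => f (x + d * Complex.I)) (Set.uIcc a b) := by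
  refine hf.comp (by fun_prop) fun x hx => ?_
  rw [Set.uIcc_of_le hab] at hx
  simpa [rectBoundary, hcd] using hx

lemma continuousOn_right (hab : a ≤ b) (hcd : c ≤ d) (hf : ContinuousOn f (rectBoundary a b c d)) :
    ContinuousOn (fun y : ℝ => f (b + y * Complex.I)) (Set.uIcc c d) := by
  refine hf.comp (by fun_prop) fun x hx => ?_
  rw [Set.uIcc_of_le hcd] at hx
  simpa [rectBoundary, hab] using hx

lemma continuousOn_left (hab : a ≤ b) (hcd : c ≤ d) (hf : ContinuousOn f (rectBoundary a b c d)) :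
    ContinuousOn (fun y : ℝ => f (a + y * Complex.I)) (Set.uIcc c d) := by
  refine hf.comp (by fun_prop) fun x hx => ?_
  rw [Set.uIcc_of_le hcd] at hx
  simpa [rectBoundary, hab] using hx

lemma rectIntegral_add {g : ℂ → ℂ} (hab : a ≤ b) (hcd : c ≤ d)
    (hf : ContinuousOn f (rectBoundary a b c d)) (hg : ContinuousOn g (rectBoundary a b c d)) :
    rectIntegral (fun s => f s + g s) a b c d =
      rectIntegral f a b c d + rectIntegral g a b c d := by
  unfold rectIntegral
  rw [intervalIntegral.integral_add (continuousOn_bottom hab hcd hf).intervalIntegrable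
      (continuousOn_bottom hab hcd hg).intervalIntegrable,
    intervalIntegral.integral_add (continuousOn_top hab hcd hf).intervalIntegrable
      (continuousOn_top hab hcd hg).intervalIntegrable,
    intervalIntegral.integral_add (continuousOn_right hab hcd hf).intervalIntegrable
      (continuousOn_right hab hcd hg).intervalIntegrable,
    intervalIntegral.integral_add (continuousOn_left hab hcd hf).intervalIntegrable
      (continuousOn_left hab hcd hg).intervalIntegrable]
  ring

lemma rectIntegral_const_mul (k : ℂ) :
    rectIntegral (fun s => k * f s) a b c d = k * rectIntegral f a b c d := by
  unfold rectIntegral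
  simp only [intervalIntegral.integral_const_mul]
  ring

lemma rectIntegral_congr {g : ℂ → ℂ} (hab : a ≤ b) (hcd : c ≤ d)
    (h : Set.EqOn f g (rectBoundary a b c d)) :
    rectIntegral f a b c d = rectIntegral g a b c d := by
  unfold rectIntegral
  congr 1
  · congr 1
    · congr 1 <;> refine intervalIntegral.integral_congr fun x hx => h ?_ <;>
        rw [Set.uIcc_of_le hab] at hx <;> simpa [rectBoundary, hcd] using hx
    · congr 1
      refine intervalIntegral.integral_congr fun x hx => h ?_
      rw [Set.uIcc_of_le hcd] at hx
      simpa [rectBoundary, hab] using hx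
  · congr 1
    refine intervalIntegral.integral_congr fun x hx => h ?_
    rw [Set.uIcc_of_le hcd] at hx
    simpa [rectBoundary, hab] using hx

lemma rectIntegral_eq_zero_of_primitive {F : ℂ → ℂ} (hab : a ≤ b) (hcd : c ≤ d)
    (hf : ContinuousOn f (rectBoundary a b c d))
    (hF : ∀ s ∈ rectBoundary a b c d, HasDerivAt F (f s) s) : rectIntegral f a b c d = 0 := by
  unfold rectIntegral
  rw [integral_horizontal_eq_sub (F := F) (fun x hx => hF _ ?_) (continuousOn_bottom hab hcd hf),
    integral_horizontal_eq_sub (F := F) (fun x hx => hF _ ?_) (continuousOn_top hab hcd hf),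
    integral_vertical_eq_sub (F := F) (fun x hx => hF _ ?_) (continuousOn_right hab hcd hf),
    integral_vertical_eq_sub (F := F) (fun x hx => hF _ ?_) (continuousOn_left hab hcd hf)]
  · ring
  · rw [Set.uIcc_of_le hcd] at hx; simpa [rectBoundary, hab] using hx
  · rw [Set.uIcc_of_le hcd] at hx; simpa [rectBoundary, hab] using hx
  · rw [Set.uIcc_of_le hab] at hx; simpa [rectBoundary, hcd] using hx
  · rw [Set.uIcc_of_le hab] at hx; simpa [rectBoundary, hcd] using hx

lemma sub_ne_zero_of_mem_rectBoundary {z s : ℂ} (hz : a < z.re ∧ z.re < b ∧ c < z.im ∧ z.im < d)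
    (hs : s ∈ rectBoundary a b c d) : s - z ≠ 0 := by
  intro h
  obtain rfl := sub_eq_zero.mp h
  obtain ⟨-, -, h | h | h | h⟩ := hs <;> linarith [hz.1, hz.2.1, hz.2.2.1, hz.2.2.2]

lemma continuousOn_pole {z : ℂ} (hz : a < z.re ∧ z.re < b ∧ c < z.im ∧ z.im < d) (k : ℕ) :
    ContinuousOn (fun s : ℂ => ((s - z) ^ k)⁻¹) (rectBoundary a b c d) :=
  ContinuousOn.inv₀ (by fun_prop) fun _ hs => pow_ne_zero _ (sub_ne_zero_of_mem_rectBoundary hz hs)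

lemma rectIntegral_higher_pole {z : ℂ} (hz : a < z.re ∧ z.re < b ∧ c < z.im ∧ z.im < d) (k : ℕ) :
    rectIntegral (fun s => ((s - z) ^ (k + 2))⁻¹) a b c d = 0 := by
  refine rectIntegral_eq_zero_of_primitive
    (F := fun s => -((k : ℂ) + 1)⁻¹ * (s - z) ^ (-((k : ℤ) + 1))) (by linarith) (by linarith)
    (continuousOn_pole hz _) fun s hs => ?_
  have hne := sub_ne_zero_of_mem_rectBoundary hz hs
  have h1 := ((hasDerivAt_zpow (-((k : ℤ) + 1)) (s - z) (Or.inl hne)).comp s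
    ((hasDerivAt_id s).sub_const z)).const_mul (-((k : ℂ) + 1)⁻¹)
  have h3 : (-((k : ℤ) + 1) - 1) = -((k + 2 : ℕ) : ℤ) := by push_cast; ring
  have h4 : (k : ℂ) + 1 ≠ 0 := by exact_mod_cast Nat.succ_ne_zero k
  rw [h3, zpow_neg, zpow_natCast] at h1
  refine h1.congr_deriv ?_
  push_cast
  have h5 : -((k : ℂ) + 1)⁻¹ * -((k : ℂ) + 1) = 1 := by rw [neg_mul_neg, inv_mul_cancel₀ h4]
  rw [← mul_assoc, mul_one, ← mul_assoc, h5, one_mul]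

lemma rectIntegral_simple_pole {z : ℂ} (hz : a < z.re ∧ z.re < b ∧ c < z.im ∧ z.im < d) :
    rectIntegral (fun s => (s - z)⁻¹) a b c d = 2 * Real.pi * Complex.I := by
  obtain ⟨h1, h2, h3, h4⟩ := hz
  have hab : a ≤ b := by linarith
  have hcd : c ≤ d := by linarith
  have hc : ContinuousOn (fun s : ℂ => (s - z)⁻¹) (rectBoundary a b c d) := by
    simpa using continuousOn_pole ⟨h1, h2, h3, h4⟩ 1
  -- `log (s - z)` is a primitive on three edges; on the left edge, which meets the branch cut,
  -- `log (-(s - z))` is used, and the jumps at the two left corners add up to `2πi`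
  have hlog : ∀ s : ℂ, s - z ∈ Complex.slitPlane →
      HasDerivAt (fun s => Complex.log (s - z)) (s - z)⁻¹ s := by
    intro s hs
    simpa using ((hasDerivAt_id s).sub_const z).clog hs
  have hlog' : ∀ s : ℂ, -(s - z) ∈ Complex.slitPlane →
      HasDerivAt (fun s => Complex.log (-(s - z))) (s - z)⁻¹ s := by
    intro s hs
    have h := (((hasDerivAt_id s).sub_const z).neg).clog hs
    refine h.congr_deriv ?_
    simp only [Pi.neg_apply, id, neg_div_neg_eq, one_div]
  unfold rectIntegral
  rw [integral_horizontal_eq_sub (F := fun s => Complex.log (s - z)) (fun x hx => hlog _ ?_)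
      (continuousOn_bottom hab hcd hc),
    integral_horizontal_eq_sub (F := fun s => Complex.log (s - z)) (fun x hx => hlog _ ?_)
      (continuousOn_top hab hcd hc),
    integral_vertical_eq_sub (F := fun s => Complex.log (s - z)) (fun x hx => hlog _ ?_)
      (continuousOn_right hab hcd hc),
    integral_vertical_eq_sub (F := fun s => Complex.log (-(s - z))) (fun x hx => hlog' _ ?_)
      (continuousOn_left hab hcd hc)]
  · have e1 : ∀ u : ℂ, 0 < u.im → Complex.log u - Complex.log (-u) = Real.pi * Complex.I := by
      intro u hu
      rw [Complex.log, Complex.log, norm_neg, Complex.arg_neg_eq_arg_sub_pi_of_im_pos hu]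
      push_cast; ring
    have e2 : ∀ u : ℂ, u.im < 0 → Complex.log u - Complex.log (-u) = -(Real.pi * Complex.I) := by
      intro u hu
      rw [Complex.log, Complex.log, norm_neg, Complex.arg_neg_eq_arg_add_pi_of_im_neg hu]
      push_cast; ring
    have e3 := e1 (a + d * Complex.I - z) (by simp; linarith)
    have e4 := e2 (a + c * Complex.I - z) (by simp; linarith)
    linear_combination e3 - e4
  · left; simp; linarith
  · left; simp; linarith
  · right; simp; intro h; linarith
  · right; simp; intro h; linarith

/-- The residue theorem for a rectangle, with prescribed residues. -/
lemma rectIntegral_eq_sum (hab : a ≤ b) (hcd : c ≤ d) (S : Finset ℂ) (r : ℂ → ℂ)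
    (hS : ∀ z ∈ S, a < z.re ∧ z.re < b ∧ c < z.im ∧ z.im < d)
    (hf : ∀ s : ℂ, s.re ∈ Set.Icc a b → s.im ∈ Set.Icc c d → s ∉ S → DifferentiableAt ℂ f s)
    (hr : ∀ z ∈ S, HasResidueAt f z (r z)) :
    rectIntegral f a b c d = 2 * Real.pi * Complex.I * ∑ z ∈ S, r z := by
  classical
  induction S using Finset.induction_on generalizing f with
  | empty =>
    have := Complex.integral_boundary_rect_eq_zero_of_differentiableOn f (a + c * Complex.I)
      (b + d * Complex.I) (fun s hs => by
        simp only [Complex.add_re, Complex.ofReal_re, Complex.mul_re, Complex.I_re, mul_zero,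
          Complex.ofReal_im, Complex.I_im, mul_one, sub_self, add_zero, Complex.add_im,
          Complex.mul_im, zero_add, Set.uIcc_of_le hab, Set.uIcc_of_le hcd] at hs
        exact (hf s hs.1 hs.2 (by simp)).differentiableWithinAt)
    simpa [rectIntegral] using this
  | insert z S hzS ih =>
    obtain ⟨n, k, g, hg, hk0, hE⟩ := hr z (Finset.mem_insert_self _ _)
    have hz := hS z (Finset.mem_insert_self _ _)
    -- subtract the principal part at `z` and use the induction hypothesis for the rest
    set P : ℂ → ℂ := fun s => ∑ j ∈ Finset.range (n + 1), k j * ((s - z) ^ (j + 1))⁻¹ with hP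
    have hPan : ∀ w, w ≠ z → AnalyticAt ℂ P w := by
      intro w hw
      have hne : w - z ≠ 0 := sub_ne_zero.mpr hw
      refine Finset.analyticAt_fun_sum _ fun j _ => analyticAt_const.mul ?_
      exact ((analyticAt_id.sub analyticAt_const).pow _).inv (pow_ne_zero _ hne)
    set f₁ : ℂ → ℂ := Function.update (fun s => f s - P s) z (g z) with hf₁
    have hz1 : f₁ =ᶠ[𝓝 z] g := by
      refine eventuallyEq_nhds_of_eventuallyEq_nhdsNE ?_ (by simp [hf₁])
      filter_upwards [hE, self_mem_nhdsWithin] with s hs hsz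
      rw [hf₁, Function.update_of_ne hsz, hs]
      ring
    have hne1 : ∀ w, w ≠ z → f₁ =ᶠ[𝓝 w] fun s => f s + (-P s) := by
      intro w hw
      filter_upwards [isOpen_ne.mem_nhds hw] with s hs
      rw [hf₁, Function.update_of_ne hs, sub_eq_add_neg]
    have hi := ih (f := f₁) (fun w hw => hS w (Finset.mem_insert_of_mem hw)) (fun s hs1 hs2 hs => by
        by_cases h : s = z
        · subst h
          exact hz1.differentiableAt_iff.mpr hg.differentiableAt
        · refine (hne1 s h).differentiableAt_iff.mpr ((hf s hs1 hs2 ?_).add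
            (hPan s h).differentiableAt.neg)
          simp [h, hs])
      (fun w hw => by
        have hwz : w ≠ z := fun h => hzS (h ▸ hw)
        exact hasResidueAt_congr ((hne1 w hwz).filter_mono nhdsWithin_le_nhds)
          ((hr w (Finset.mem_insert_of_mem hw)).add_analytic (hPan w hwz).neg))
    have hbz : ∀ s ∈ rectBoundary a b c d, s ≠ z := fun s hs =>
      sub_ne_zero.mp (sub_ne_zero_of_mem_rectBoundary hz hs)
    have hPc : ContinuousOn P (rectBoundary a b c d) := fun s hs =>
      (hPan s (hbz s hs)).continuousAt.continuousWithinAt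
    have hf1c : ContinuousOn f₁ (rectBoundary a b c d) := by
      intro s hs
      refine (ContinuousAt.congr (ContinuousAt.add ?_ (hPan s (hbz s hs)).continuousAt.neg)
        (hne1 s (hbz s hs)).symm).continuousWithinAt
      refine (hf s hs.1 hs.2.1 fun h => ?_).continuousAt
      exact sub_ne_zero_of_mem_rectBoundary (hS s h) hs (sub_self s)
    rw [rectIntegral_congr (g := fun s => f₁ s + P s) hab hcd, rectIntegral_add hab hcd hf1c hPc,
      hi, Finset.sum_insert hzS]
    -- only the term `(s - z)⁻¹` of the principal part contributes
    · have : rectIntegral P a b c d = 2 * Real.pi * Complex.I * r z := by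
        have key : ∀ N : ℕ, rectIntegral (fun s => ∑ j ∈ Finset.range (N + 1),
            k j * ((s - z) ^ (j + 1))⁻¹) a b c d = 2 * Real.pi * Complex.I * r z := by
          intro N
          induction N with
          | zero =>
            simp only [zero_add, Finset.range_one, Finset.sum_singleton, pow_one]
            rw [rectIntegral_const_mul, rectIntegral_simple_pole hz, hk0]
            ring
          | succ N ihN =>
            simp_rw [Finset.sum_range_succ _ (N + 1)]
            have h1 : ContinuousOn (fun s => ∑ j ∈ Finset.range (N + 1),
                k j * ((s - z) ^ (j + 1))⁻¹) (rectBoundary a b c d) :=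
              continuousOn_finsetSum _ fun j _ => continuousOn_const.mul (continuousOn_pole hz _)
            have h2 : ContinuousOn (fun s => k (N + 1) * ((s - z) ^ (N + 1 + 1))⁻¹)
                (rectBoundary a b c d) := continuousOn_const.mul (continuousOn_pole hz _)
            rw [rectIntegral_add hab hcd h1 h2, ihN, rectIntegral_const_mul,
              rectIntegral_higher_pole hz]
            ring
        exact key n
      rw [this]; ring
    · intro s hs
      simp only [hf₁, Function.update_of_ne (hbz s hs)]
      ring

end Edges

end SingularSeries

namespace SingularSeries

/-! ### Lower bounds for bounded analytic functions away from their zeros -/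

lemma analyticAt_dslope {f : ℂ → ℂ} {a z : ℂ} (ha : AnalyticAt ℂ f a) (hz : AnalyticAt ℂ f z) :
    AnalyticAt ℂ (dslope f a) z := by
  rcases eq_or_ne z a with rfl | h
  · obtain ⟨p, hp⟩ := ha
    exact hp.has_fpower_series_dslope_fslope.analyticAt
  · have h1 : dslope f a =ᶠ[𝓝 z] fun s => (f s - f a) / (s - a) := by
      filter_upwards [isOpen_ne.mem_nhds h] with s hs
      rw [dslope_of_ne _ hs, slope_def_field]
    refine (AnalyticAt.div (hz.sub analyticAt_const) (analyticAt_id.sub analyticAt_const)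
      (sub_ne_zero.mpr h)).congr h1.symm

/-- A zero in the disc can be divided out by its Blaschke factor
`R (z - a) / (R² - conj a * z)` without increasing the maximum. -/
lemma exists_blaschke_quotient {f : ℂ → ℂ} {R : ℝ} {a : ℂ} (hR : 0 < R)
    (hf : ∀ z ∈ Metric.closedBall (0 : ℂ) R, AnalyticAt ℂ f z)
    (hb : ∀ z ∈ Metric.closedBall (0 : ℂ) R, ‖f z‖ ≤ 1) (ha : ‖a‖ < R) (hfa : f a = 0) :
    ∃ g : ℂ → ℂ, (∀ z ∈ Metric.closedBall (0 : ℂ) R, AnalyticAt ℂ g z) ∧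
      (∀ z ∈ Metric.closedBall (0 : ℂ) R, ‖g z‖ ≤ 1) ∧
      ∀ z ∈ Metric.closedBall (0 : ℂ) R,
        f z = g z * (R * (z - a) / (R ^ 2 - starRingEnd ℂ a * z)) := by
  have haR : a ∈ Metric.closedBall (0 : ℂ) R := by simpa using ha.le
  have hRC : (R : ℂ) ≠ 0 := by exact_mod_cast hR.ne'
  have hden : ∀ z ∈ Metric.closedBall (0 : ℂ) R, (R : ℂ) ^ 2 - starRingEnd ℂ a * z ≠ 0 := by
    intro z hz h
    have h1 : ‖(R : ℂ) ^ 2‖ = ‖starRingEnd ℂ a * z‖ := by rw [sub_eq_zero.mp h]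
    rw [norm_mul, RCLike.norm_conj, norm_pow, Complex.norm_real, Real.norm_of_nonneg hR.le] at h1
    have hz' : ‖z‖ ≤ R := by simpa using hz
    nlinarith [norm_nonneg a, norm_nonneg z]
  set g : ℂ → ℂ := fun z => dslope f a z * ((R ^ 2 - starRingEnd ℂ a * z) / R) with hg
  have hgan : ∀ z ∈ Metric.closedBall (0 : ℂ) R, AnalyticAt ℂ g z := fun z hz =>
    (analyticAt_dslope (hf a haR) (hf z hz)).mul (by fun_prop)
  have hfg : ∀ z ∈ Metric.closedBall (0 : ℂ) R,
      f z = g z * (R * (z - a) / (R ^ 2 - starRingEnd ℂ a * z)) := by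
    intro z hz
    rcases eq_or_ne z a with rfl | h
    · simp [hfa]
    · have h1 := hden z hz
      have h2 : z - a ≠ 0 := sub_ne_zero.mpr h
      simp only [hg, dslope_of_ne _ h, slope_def_field, hfa]
      generalize (R : ℂ) ^ 2 - starRingEnd ℂ a * z = D at h1
      field_simp
      simp
  refine ⟨g, hgan, ?_, hfg⟩
  have hd : DiffContOnCl ℂ g (Metric.ball 0 R) := by
    refine DifferentiableOn.diffContOnCl ?_
    rw [closure_ball _ hR.ne']
    exact fun z hz => (hgan z hz).differentiableAt.differentiableWithinAt
  intro z hz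
  -- the Blaschke factor has modulus `1` on the circle, so the maximum principle gives the bound
  refine Complex.norm_le_of_forall_mem_frontier_norm_le Metric.isBounded_ball hd (fun s hs => ?_)
    (by rwa [closure_ball _ hR.ne'])
  rw [frontier_ball _ hR.ne'] at hs
  have hsR : ‖s‖ = R := by simpa using hs
  have hs' := Metric.sphere_subset_closedBall hs
  have hne : s - a ≠ 0 := by
    intro h
    rw [sub_eq_zero.mp h] at hsR
    exact ha.ne hsR
  have h1 : ‖(R : ℂ) ^ 2 - starRingEnd ℂ a * s‖ = R * ‖s - a‖ := by
    have : (R : ℂ) ^ 2 - starRingEnd ℂ a * s = s * starRingEnd ℂ (s - a) := by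
      have h3 : s * starRingEnd ℂ s = (R : ℂ) ^ 2 := by
        rw [Complex.mul_conj, Complex.normSq_eq_norm_sq, hsR]; push_cast; rfl
      rw [map_sub, mul_sub, h3]; ring
    rw [this, norm_mul, RCLike.norm_conj, hsR]
  have h2 := hfg s hs'
  have h3 : ‖(R * (s - a) / (R ^ 2 - starRingEnd ℂ a * s) : ℂ)‖ = 1 := by
    rw [norm_div, h1, norm_mul, Complex.norm_real, Real.norm_of_nonneg hR.le, div_self]
    exact mul_ne_zero hR.ne' (norm_ne_zero_iff.mpr hne)
  have h4 := hb s hs'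
  rwa [h2, norm_mul, h3, mul_one] at h4

/-- Dividing by a Blaschke factor at a zero in the smaller disc gains a factor `10/9` at `0`. -/
lemma exists_blaschke_quotient_norm {f : ℂ → ℂ} {a : ℂ}
    (hf : ∀ z ∈ Metric.closedBall (0 : ℂ) (5 / 2), AnalyticAt ℂ f z)
    (hb : ∀ z ∈ Metric.closedBall (0 : ℂ) (5 / 2), ‖f z‖ ≤ 1) (ha : ‖a‖ < 9 / 4) (hfa : f a = 0) :
    ∃ g : ℂ → ℂ, (∀ z ∈ Metric.closedBall (0 : ℂ) (5 / 2), AnalyticAt ℂ g z) ∧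
      (∀ z ∈ Metric.closedBall (0 : ℂ) (5 / 2), ‖g z‖ ≤ 1) ∧
      (∀ z ∈ Metric.closedBall (0 : ℂ) (5 / 2), z ≠ a → f z = 0 → g z = 0) ∧
      (∀ z ∈ Metric.closedBall (0 : ℂ) (5 / 2), g z = 0 → f z = 0) ∧
      (∀ z ∈ Metric.closedBall (0 : ℂ) (5 / 2), ‖g z‖ * (‖z - a‖ / 5) ≤ ‖f z‖) ∧
      ‖f 0‖ * (10 / 9) ≤ ‖g 0‖ := by
  obtain ⟨g, hg, hgb, hfg⟩ := exists_blaschke_quotient (by norm_num) hf hb (by linarith) hfa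
  have hden : ∀ z ∈ Metric.closedBall (0 : ℂ) (5 / 2),
      ((5 / 2 : ℝ) : ℂ) ^ 2 - starRingEnd ℂ a * z ≠ 0 := by
    intro z hz h
    have h1 : ‖((5 / 2 : ℝ) : ℂ) ^ 2‖ = ‖starRingEnd ℂ a * z‖ := by rw [sub_eq_zero.mp h]
    rw [norm_mul, RCLike.norm_conj, norm_pow, Complex.norm_real, Real.norm_of_nonneg (by norm_num)]
      at h1
    have hz' : ‖z‖ ≤ 5 / 2 := by simpa using hz
    nlinarith [norm_nonneg a, norm_nonneg z]
  refine ⟨g, hg, hgb, fun z hz hza h0 => ?_, fun z hz h0 => ?_, fun z hz => ?_, ?_⟩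
  · rw [hfg z hz] at h0
    refine (mul_eq_zero.mp h0).resolve_right (div_ne_zero (mul_ne_zero ?_ ?_) (hden z hz))
    · norm_num
    · exact sub_ne_zero.mpr hza
  · rw [hfg z hz, h0, zero_mul]
  · rw [hfg z hz, norm_mul]
    refine mul_le_mul_of_nonneg_left ?_ (norm_nonneg _)
    rw [norm_div, norm_mul, Complex.norm_real, Real.norm_of_nonneg (by norm_num),
      le_div_iff₀ (norm_pos_iff.mpr (hden z hz))]
    have h1 : ‖((5 / 2 : ℝ) : ℂ) ^ 2 - starRingEnd ℂ a * z‖ ≤ 25 / 2 := by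
      refine (norm_sub_le _ _).trans ?_
      rw [norm_mul, RCLike.norm_conj, norm_pow, Complex.norm_real,
        Real.norm_of_nonneg (by norm_num)]
      have hz' : ‖z‖ ≤ 5 / 2 := by simpa using hz
      nlinarith [norm_nonneg a, norm_nonneg z]
    nlinarith [norm_nonneg (z - a)]
  · rw [hfg 0 (by simp; norm_num), norm_mul, norm_div, norm_mul, Complex.norm_real,
      Real.norm_of_nonneg (by norm_num)]
    simp only [zero_sub, norm_neg, mul_zero, sub_zero, norm_pow, Complex.norm_real]
    rw [Real.norm_of_nonneg (by norm_num)]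
    have h1 : 5 / 2 * ‖a‖ / (5 / 2 : ℝ) ^ 2 * (10 / 9) ≤ 1 := by
      rw [div_mul_eq_mul_div, div_le_one (by norm_num)]
      linarith
    calc _ = ‖g 0‖ * (5 / 2 * ‖a‖ / (5 / 2 : ℝ) ^ 2 * (10 / 9)) := by ring
      _ ≤ ‖g 0‖ * 1 := mul_le_mul_of_nonneg_left h1 (norm_nonneg _)
      _ = _ := mul_one _

/-- A Jensen-type bound: every zero costs a factor `10/9` in `‖f 0‖ ≤ 1`. -/
lemma card_zeros_le (n : ℕ) {f : ℂ → ℂ}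
    (hf : ∀ z ∈ Metric.closedBall (0 : ℂ) (5 / 2), AnalyticAt ℂ f z)
    (hb : ∀ z ∈ Metric.closedBall (0 : ℂ) (5 / 2), ‖f z‖ ≤ 1) (h0 : (9 / 10 : ℝ) ^ n ≤ ‖f 0‖)
    (Z : Finset ℂ) (hZ : ∀ a ∈ Z, ‖a‖ < 9 / 4 ∧ f a = 0) : Z.card ≤ n := by
  classical
  induction n generalizing f Z with
  | zero =>
    rw [Nat.le_zero, Finset.card_eq_zero, Finset.eq_empty_iff_forall_notMem]
    intro a ha
    obtain ⟨g, -, hgb, -, -, -, hg0⟩ := exists_blaschke_quotient_norm hf hb (hZ a ha).1 (hZ a ha).2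
    have := hgb 0 (by simp; norm_num)
    rw [pow_zero] at h0
    linarith
  | succ n ih =>
    rcases Z.eq_empty_or_nonempty with rfl | ⟨a, ha⟩
    · simp
    obtain ⟨g, hg, hgb, hgz, -, -, hg0⟩ :=
      exists_blaschke_quotient_norm hf hb (hZ a ha).1 (hZ a ha).2
    have h1 := ih hg hgb (by rw [pow_succ] at h0; linarith) (Z.erase a) (fun z hz => by
      have hz2 := Finset.mem_erase.mp hz
      exact ⟨(hZ z hz2.2).1, hgz z (by simpa using (hZ z hz2.2).1.le.trans (by norm_num)) hz2.1
        (hZ z hz2.2).2⟩)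
    rw [Finset.card_erase_of_mem ha] at h1
    omega

/-- Harnack's inequality in the form given by the Borel–Carathéodory theorem. -/
lemma norm_ge_of_no_zeros {f : ℂ → ℂ} {M : ℝ} (hM : 0 < M)
    (hf : ∀ z ∈ Metric.ball (0 : ℂ) (9 / 4), AnalyticAt ℂ f z)
    (hb : ∀ z ∈ Metric.ball (0 : ℂ) (9 / 4), ‖f z‖ ≤ 1) (h0 : Real.exp (-M) ≤ ‖f 0‖)
    (hz : ∀ z ∈ Metric.ball (0 : ℂ) (9 / 4), f z ≠ 0) {w : ℂ} (hw : ‖w‖ ≤ 2) :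
    Real.exp (-(17 * M)) ≤ ‖f w‖ := by
  have hd : DifferentiableOn ℂ (fun z => deriv f z / f z) (Metric.ball 0 (9 / 4)) := fun z hz' =>
    ((hf z hz').deriv.differentiableAt.div (hf z hz').differentiableAt
      (hz z hz')).differentiableWithinAt
  -- a logarithm of `f / f 0` is a primitive of the logarithmic derivative
  obtain ⟨F, hF⟩ := hd.isExactOn_ball
  have h0m : (0 : ℂ) ∈ Metric.ball (0 : ℂ) (9 / 4) := by simp
  have hwm : w ∈ Metric.ball (0 : ℂ) (9 / 4) := by simpa using lt_of_le_of_lt hw (by norm_num)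
  have key : ∀ z ∈ Metric.ball (0 : ℂ) (9 / 4), f z = f 0 * Complex.exp (F z - F 0) := by
    have hder : ∀ z ∈ Metric.ball (0 : ℂ) (9 / 4),
        HasDerivAt (fun z => f z * Complex.exp (-(F z - F 0))) 0 z := by
      intro z hz'
      have h1 := (hf z hz').differentiableAt.hasDerivAt.mul
        (((hF z hz').sub_const (F 0)).neg.cexp)
      refine h1.congr_deriv ?_
      have := hz z hz'
      field_simp
      simp
    intro z hz'
    have h1 := Metric.isOpen_ball.is_const_of_deriv_eq_zero
      (convex_ball (0 : ℂ) (9 / 4)).isPreconnected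
      (fun z hz' => (hder z hz').differentiableAt.differentiableWithinAt)
      (fun z hz' => (hder z hz').deriv) hz' h0m
    simp only [sub_self, neg_zero, Complex.exp_zero, mul_one] at h1
    rw [← h1, mul_assoc, ← Complex.exp_add]
    simp
  have hf0 : 0 < ‖f 0‖ := (Real.exp_pos _).trans_le h0
  have hbc := Complex.borelCaratheodory_zero (f := fun z => F z - F 0) (R := 9 / 4) (z := w) hM
    (fun z hz' => ((hF z hz').sub_const (F 0)).differentiableAt.differentiableWithinAt)
    (fun z hz' => by
      have h1 := hb z hz'
      rw [key z hz', norm_mul, Complex.norm_exp] at h1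
      have h2 : Real.exp (F z - F 0).re ≤ Real.exp M := by
        have h3 : Real.exp (-M) * Real.exp (F z - F 0).re ≤ 1 :=
          (mul_le_mul_of_nonneg_right h0 (Real.exp_pos _).le).trans h1
        rw [Real.exp_neg] at h3
        rwa [inv_mul_le_iff₀ (Real.exp_pos _), mul_one] at h3
      exact Real.exp_le_exp.mp h2)
    (by norm_num) hwm (by simp)
  -- `2 M ‖w‖ / (R - ‖w‖)` with `R = 9/4` and `‖w‖ ≤ 2` is at most `16 M`
  have h5 : ‖F w - F 0‖ ≤ 16 * M := by
    refine hbc.trans ?_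
    rw [div_le_iff₀ (by linarith)]
    nlinarith [norm_nonneg w]
  rw [key w hwm, norm_mul, Complex.norm_exp]
  have h6 : -(16 * M) ≤ (F w - F 0).re := by
    have := (abs_le.mp ((Complex.abs_re_le_norm (F w - F 0)).trans h5)).1
    exact this
  calc Real.exp (-(17 * M)) = Real.exp (-M) * Real.exp (-(16 * M)) := by
        rw [← Real.exp_add]; ring_nf
    _ ≤ _ := mul_le_mul h0 (Real.exp_le_exp.mpr h6) (Real.exp_pos _).le (norm_nonneg _)

/-- A lower bound for a bounded analytic function in terms of the distance to its zeros. -/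
lemma norm_ge_of_dist_zeros (n : ℕ) {f : ℂ → ℂ}
    (hf : ∀ z ∈ Metric.closedBall (0 : ℂ) (5 / 2), AnalyticAt ℂ f z)
    (hb : ∀ z ∈ Metric.closedBall (0 : ℂ) (5 / 2), ‖f z‖ ≤ 1) (h0 : (9 / 10 : ℝ) ^ n ≤ ‖f 0‖)
    {w : ℂ} (hw : ‖w‖ ≤ 2) {η : ℝ} (hη : 0 < η) (hη1 : η ≤ 1)
    (hdist : ∀ a : ℂ, ‖a‖ < 9 / 4 → f a = 0 → η ≤ ‖w - a‖) :
    (η / 5) ^ n * (9 / 10 : ℝ) ^ (17 * (n + 1)) ≤ ‖f w‖ := by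
  -- the case without zeros; `n + 1` keeps the exponent `M` positive
  have hno : ∀ (n : ℕ) {f : ℂ → ℂ}, (∀ z ∈ Metric.closedBall (0 : ℂ) (5 / 2), AnalyticAt ℂ f z) →
      (∀ z ∈ Metric.closedBall (0 : ℂ) (5 / 2), ‖f z‖ ≤ 1) → (9 / 10 : ℝ) ^ n ≤ ‖f 0‖ →
      (¬ ∃ a : ℂ, ‖a‖ < 9 / 4 ∧ f a = 0) →
      (η / 5) ^ n * (9 / 10 : ℝ) ^ (17 * (n + 1)) ≤ ‖f w‖ := by
    intro n f hf hb h0 hz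
    push Not at hz
    have hsub : Metric.ball (0 : ℂ) (9 / 4) ⊆ Metric.closedBall 0 (5 / 2) :=
      (Metric.ball_subset_ball (by norm_num)).trans Metric.ball_subset_closedBall
    have hl : 0 < Real.log (10 / 9) := Real.log_pos (by norm_num)
    have hexp : ∀ k : ℕ, Real.exp (-(k * Real.log (10 / 9))) = (9 / 10 : ℝ) ^ k := by
      intro k
      rw [Real.exp_neg, Real.exp_nat_mul, Real.exp_log (by norm_num), ← inv_pow]
      norm_num
    have h1 := norm_ge_of_no_zeros (M := (n + 1 : ℕ) * Real.log (10 / 9)) (by positivity)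
      (fun z hz' => hf z (hsub hz')) (fun z hz' => hb z (hsub hz'))
      (by
        rw [hexp]
        exact (pow_le_pow_of_le_one (by norm_num) (by norm_num) n.le_succ).trans h0)
      (fun z hz' => hz z (by simpa using hz')) hw
    have h2 : (17 : ℝ) * ((n + 1 : ℕ) * Real.log (10 / 9)) =
        (17 * (n + 1) : ℕ) * Real.log (10 / 9) := by push_cast; ring
    rw [h2, hexp] at h1
    refine le_trans (mul_le_of_le_one_left (by positivity) ?_) h1
    exact pow_le_one₀ (by positivity) (by linarith)
  induction n generalizing f with
  | zero =>
    refine hno 0 hf hb h0 ?_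
    rintro ⟨a, ha, hfa⟩
    obtain ⟨g, -, hgb, -, -, -, hg0⟩ := exists_blaschke_quotient_norm hf hb ha hfa
    have := hgb 0 (by simp; norm_num)
    rw [pow_zero] at h0
    linarith
  | succ n ih =>
    by_cases hz : ∃ a : ℂ, ‖a‖ < 9 / 4 ∧ f a = 0
    · obtain ⟨a, ha, hfa⟩ := hz
      -- divide out a zero; the quotient is larger at `0` by `10/9`, so the induction descends
      obtain ⟨g, hg, hgb, -, hgz, hgw, hg0⟩ := exists_blaschke_quotient_norm hf hb ha hfa
      have h1 := ih hg hgb (by rw [pow_succ] at h0; linarith) (fun b hb' hgb' =>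
        hdist b hb' (hgz b (by simpa using hb'.le.trans (by norm_num)) hgb'))
      have h2 := hgw w (by simpa using hw.trans (by norm_num))
      have h3 := hdist a ha hfa
      calc (η / 5) ^ (n + 1) * (9 / 10 : ℝ) ^ (17 * (n + 1 + 1))
          ≤ (η / 5) ^ (n + 1) * (9 / 10 : ℝ) ^ (17 * (n + 1)) := by
            refine mul_le_mul_of_nonneg_left ?_ (by positivity)
            exact pow_le_pow_of_le_one (by norm_num) (by norm_num) (by omega)
        _ = (η / 5) ^ n * (9 / 10 : ℝ) ^ (17 * (n + 1)) * (η / 5) := by ring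
        _ ≤ ‖g w‖ * (‖w - a‖ / 5) :=
            mul_le_mul h1 (by linarith) (by positivity) (norm_nonneg _)
        _ ≤ ‖f w‖ := h2
    · exact hno (n + 1) hf hb h0 hz

end SingularSeries

namespace SingularSeries

/-! ### Exponential decay of the Gamma function -/

/-- Euler's integral along a rotated ray, by analytic continuation in the parameter. -/
lemma integral_cpow_mul_exp_neg_mul {a r : ℂ} (ha : 0 < a.re) (hr : 0 < r.re) :
    ∫ t : ℝ in Set.Ioi 0, (t : ℂ) ^ (a - 1) * Complex.exp (-(r * t)) =
      (1 / r) ^ a * Complex.Gamma a := by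
  set U : Set ℂ := {r | 0 < r.re} with hU
  have hUo : IsOpen U := isOpen_lt continuous_const Complex.continuous_re
  have hUc : IsPreconnected U := (convex_halfSpace_re_gt 0).isPreconnected
  have hbase : ∀ b : ℝ, 0 < b → ∀ c : ℝ, -1 < c → MeasureTheory.IntegrableOn
      (fun t : ℝ => t ^ c * Real.exp (-b * t)) (Set.Ioi 0) := fun b hb c hc => by
    simpa using integrableOn_rpow_mul_exp_neg_mul_rpow hc one_pos hb
  have hnorm : ∀ (u : ℂ) (t : ℝ), 0 < t →
      ‖(t : ℂ) ^ (a - 1) * Complex.exp (-(u * t))‖ = t ^ (a.re - 1) * Real.exp (-u.re * t) := by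
    intro u t ht
    rw [norm_mul, Complex.norm_cpow_eq_rpow_re_of_pos ht, Complex.norm_exp]
    simp
  have hcont : ∀ u : ℂ, ContinuousOn
      (fun t : ℝ => (t : ℂ) ^ (a - 1) * Complex.exp (-(u * t))) (Set.Ioi 0) := by
    intro u t ht
    have : (t : ℂ) ∈ Complex.slitPlane := Or.inl (by simpa using ht)
    exact (ContinuousAt.mul (ContinuousAt.cpow (by fun_prop) (by fun_prop) this)
      (by fun_prop)).continuousWithinAt
  -- both sides are analytic in the parameter `r` on `Re r > 0`
  have hdiff : DifferentiableOn ℂ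
      (fun u : ℂ => ∫ t : ℝ in Set.Ioi 0, (t : ℂ) ^ (a - 1) * Complex.exp (-(u * t))) U := by
    intro u hu
    have hu0 : 0 < u.re := hu
    have hb : ∀ t : ℝ, 0 < t → ∀ w ∈ Metric.ball u (u.re / 2), u.re / 2 ≤ w.re := by
      intro t ht w hw
      have h1 := (Complex.abs_re_le_norm (w - u)).trans_lt (mem_ball_iff_norm.mp hw)
      have h2 := (abs_lt.mp h1).1
      simp at h2
      linarith
    have h := hasDerivAt_integral_of_dominated_loc_of_deriv_le
      (μ := MeasureTheory.volume.restrict (Set.Ioi (0 : ℝ)))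
      (F := fun (u : ℂ) (t : ℝ) => (t : ℂ) ^ (a - 1) * Complex.exp (-(u * t)))
      (F' := fun (u : ℂ) (t : ℝ) => (t : ℂ) ^ (a - 1) * (Complex.exp (-(u * t)) * (-t)))
      (bound := fun t : ℝ => t ^ a.re * Real.exp (-(u.re / 2) * t))
      (Metric.ball_mem_nhds u (by linarith : 0 < u.re / 2))
      (Eventually.of_forall fun w => (hcont w).aestronglyMeasurable measurableSet_Ioi)
      (by
        refine MeasureTheory.Integrable.mono' (hbase u.re hu0 (a.re - 1) (by linarith))
          ((hcont u).aestronglyMeasurable measurableSet_Ioi) ?_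
        filter_upwards [MeasureTheory.ae_restrict_mem measurableSet_Ioi] with t ht
        exact (hnorm u t ht).le)
      (by
        have : ContinuousOn (fun t : ℝ =>
            ((t : ℂ) ^ (a - 1) * Complex.exp (-(u * t))) * (-(t : ℂ))) (Set.Ioi 0) :=
          (hcont u).mul (by fun_prop)
        simpa only [mul_assoc] using this.aestronglyMeasurable measurableSet_Ioi)
      (by
        filter_upwards [MeasureTheory.ae_restrict_mem measurableSet_Ioi] with t ht w hw
        have ht0 : (0 : ℝ) < t := ht
        rw [← mul_assoc, norm_mul, hnorm w t ht0, norm_neg, Complex.norm_real,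
          Real.norm_of_nonneg ht0.le, mul_right_comm]
        have e1 : t ^ (a.re - 1) * t = t ^ a.re := by
          rw [← Real.rpow_add_one ht0.ne', sub_add_cancel]
        rw [e1]
        refine mul_le_mul_of_nonneg_left (Real.exp_le_exp.mpr ?_) (by positivity)
        nlinarith [hb t ht0 w hw])
      (hbase (u.re / 2) (by linarith) a.re (by linarith))
      (by
        refine Eventually.of_forall fun t w hw => HasDerivAt.const_mul _ ?_
        have := ((hasDerivAt_id w).mul_const (t : ℂ)).neg.cexp
        simpa using! this)
    exact h.2.differentiableAt.differentiableWithinAt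
  have hdiff2 : DifferentiableOn ℂ (fun u : ℂ => (1 / u) ^ a * Complex.Gamma a) U := by
    intro u hu
    have hu0 : u ≠ 0 := by rintro rfl; simp [hU] at hu
    have hsl : 1 / u ∈ Complex.slitPlane := by
      left
      rw [one_div, Complex.inv_re]
      exact div_pos hu (Complex.normSq_pos.mpr hu0)
    exact (((differentiableAt_const _).div differentiableAt_id hu0).cpow
      (differentiableAt_const _) hsl).mul_const _ |>.differentiableWithinAt
  -- they agree for real `r`, and reals accumulate at `1`
  refine (hdiff.analyticOnNhd hUo).eqOn_of_preconnected_of_frequently_eq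
    (hdiff2.analyticOnNhd hUo) hUc (z₀ := 1) (by simp [hU]) ?_ hr
  have ht : Tendsto (fun n : ℕ => ((1 + 1 / ((n : ℝ) + 1) : ℝ) : ℂ)) atTop (𝓝[≠] 1) := by
    rw [tendsto_nhdsWithin_iff]
    constructor
    · have := (tendsto_one_div_add_atTop_nhds_zero_nat (𝕜 := ℝ)).const_add 1
      simpa [Function.comp_def] using (Complex.continuous_ofReal.tendsto _).comp this
    · refine Eventually.of_forall fun n => ?_
      have : (0 : ℝ) < 1 / ((n : ℝ) + 1) := by positivity
      intro h
      have h2 : (1 + 1 / ((n : ℝ) + 1) : ℝ) = 1 := Complex.ofReal_injective (by simpa using h)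
      linarith
  refine ht.frequently (Eventually.frequently (Eventually.of_forall fun n => ?_))
  exact Complex.integral_cpow_mul_exp_neg_mul_Ioi ha (by positivity)

/-- Rotating the ray of integration in Euler's integral by `π / 4` gives exponential decay. -/
lemma norm_Gamma_le {s : ℂ} (hs : 0 < s.re) :
    ‖Complex.Gamma s‖ ≤
      √2 ^ s.re * Real.Gamma s.re * Real.exp (-(Real.pi / 4 * |s.im|)) := by
  -- by conjugation symmetry the ray can be rotated in one direction only
  wlog h : 0 ≤ s.im generalizing s
  · have := this (s := starRingEnd ℂ s) (by simpa using hs) (by simp; linarith)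
    rw [Complex.Gamma_conj, RCLike.norm_conj] at this
    simpa using this
  set r : ℂ := Complex.exp ((Real.pi / 4 : ℝ) * Complex.I) with hr
  have hre : r.re = 1 / √2 := by
    rw [hr, Complex.exp_ofReal_mul_I_re, Real.cos_pi_div_four]
    have : (√2 : ℝ) * √2 = 2 := Real.mul_self_sqrt (by norm_num)
    field_simp
    nlinarith
  have hs2 : (0 : ℝ) < √2 := by positivity
  have hre0 : 0 < r.re := by rw [hre]; positivity
  have h1 := integral_cpow_mul_exp_neg_mul hs hre0
  have h2 := Real.integral_rpow_mul_exp_neg_mul_Ioi hs (show (0 : ℝ) < 1 / √2 by positivity)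
  have h3 : ‖(1 / r) ^ s‖ = Real.exp (Real.pi / 4 * s.im) := by
    have h4 : 1 / r = Complex.exp (-((Real.pi / 4 : ℝ) * Complex.I)) := by
      rw [hr, Complex.exp_neg, one_div]
    have h5 : Complex.log (1 / r) = -((Real.pi / 4 : ℝ) * Complex.I) := by
      rw [h4, Complex.log_exp]
      · simp; linarith [Real.pi_pos]
      · simp; linarith [Real.pi_pos]
    rw [Complex.cpow_def_of_ne_zero (by rw [h4]; exact Complex.exp_ne_zero _), h5,
      Complex.norm_exp]
    simp
  have h6 : ‖(1 / r) ^ s * Complex.Gamma s‖ ≤ √2 ^ s.re * Real.Gamma s.re := by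
    rw [← h1]
    refine (MeasureTheory.norm_integral_le_integral_norm _).trans (le_of_eq ?_)
    rw [one_div, one_div, inv_inv] at h2
    rw [← h2]
    refine MeasureTheory.setIntegral_congr_fun measurableSet_Ioi fun t ht => ?_
    have ht' : (0 : ℝ) < t := ht
    simp only [norm_mul, Complex.norm_cpow_eq_rpow_re_of_pos ht', Complex.norm_exp]
    simp [hre]
  rw [norm_mul, h3] at h6
  rw [abs_of_nonneg h, Real.exp_neg, ← div_eq_mul_inv, le_div_iff₀ (Real.exp_pos _)]
  linarith

/-- The bound to the left of `Re s = 0` follows from `Γ(s + 2) = (s + 1) s Γ(s)`. -/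
lemma exists_norm_Gamma_le :
    ∃ C : ℝ, 0 < C ∧ ∀ s : ℂ, -1 ≤ s.re → s.re ≤ 2 → 1 / 2 ≤ |s.im| →
      ‖Complex.Gamma s‖ ≤ C * Real.exp (-(Real.pi / 4 * |s.im|)) := by
  have hc : ContinuousOn (fun x : ℝ => √2 ^ x * Real.Gamma x) (Set.Icc 1 4) := by
    intro x hx
    have hx0 : 0 < x := by linarith [hx.1]
    refine (ContinuousAt.mul (by fun_prop (disch := norm_num)) ?_).continuousWithinAt
    exact (Real.differentiableAt_Gamma fun m => by
      have : (0 : ℝ) ≤ m := m.cast_nonneg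
      linarith).continuousAt
  obtain ⟨C, hC⟩ := isCompact_Icc.exists_bound_of_continuousOn hc
  refine ⟨4 * |C| + 1, by positivity, fun s h1 h2 h3 => ?_⟩
  have hs0 : s ≠ 0 := by rintro rfl; norm_num at h3
  have hs1 : s + 1 ≠ 0 := by
    intro h
    have := congrArg Complex.im h
    simp at this
    rw [this] at h3; norm_num at h3
  have e1 : Complex.Gamma (s + 2) = (s + 1) * (s * Complex.Gamma s) := by
    rw [← Complex.Gamma_add_one s hs0, ← Complex.Gamma_add_one (s + 1) hs1]
    ring_nf
  have n0 : 1 / 2 ≤ ‖s‖ := h3.trans (Complex.abs_im_le_norm s)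
  have n1 : 1 / 2 ≤ ‖s + 1‖ := by
    refine h3.trans ?_
    simpa using Complex.abs_im_le_norm (s + 1)
  have h4 := norm_Gamma_le (s := s + 2) (by simp; linarith)
  have h5 := hC (s.re + 2) ⟨by linarith, by linarith⟩
  rw [e1, norm_mul, norm_mul] at h4
  simp only [Complex.add_re, Complex.re_ofNat, Complex.add_im, Complex.im_ofNat, add_zero] at h4
  have h6 : √2 ^ (s.re + 2) * Real.Gamma (s.re + 2) ≤ |C| :=
    (le_abs_self _).trans (h5.trans (le_abs_self C))
  have h7 : ‖s + 1‖ * (‖s‖ * ‖Complex.Gamma s‖) ≤ |C| * Real.exp (-(Real.pi / 4 * |s.im|)) :=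
    h4.trans (mul_le_mul_of_nonneg_right h6 (Real.exp_pos _).le)
  have h8 : 1 / 2 * (1 / 2 * ‖Complex.Gamma s‖) ≤ ‖s + 1‖ * (‖s‖ * ‖Complex.Gamma s‖) := by
    gcongr
  nlinarith [Real.exp_pos (-(Real.pi / 4 * |s.im|))]

/-! ### Growth of Dirichlet `L`-functions -/

lemma summable_rpow_succ {δ : ℝ} (hδ : 0 < δ) :
    Summable fun n : ℕ => ((n : ℝ) + 1) ^ (-(1 + δ)) := by
  have := (summable_nat_add_iff 1).mpr (Real.summable_nat_rpow.mpr (show -(1 + δ) < -1 by linarith))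
  simpa using this

/-- The sum is compared with a telescoping one. -/
lemma tsum_rpow_succ_le {δ : ℝ} (hδ : 0 < δ) :
    ∑' n : ℕ, ((n : ℝ) + 1) ^ (-(1 + δ)) ≤ 1 + 1 / δ := by
  have hstep : ∀ x : ℝ, 1 ≤ x → (x + 1) ^ (-(1 + δ)) ≤ 1 / δ * (x ^ (-δ) - (x + 1) ^ (-δ)) := by
    intro x hx
    have hx0 : 0 < x := by linarith
    have h1 : (x : ℝ) ^ (-δ) = (x + 1) ^ (-δ) * (x / (x + 1)) ^ (-δ) := by
      rw [← Real.mul_rpow (by positivity) (by positivity)]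
      congr 1
      field_simp
    have h2 : 1 + δ / (x + 1) ≤ (x / (x + 1)) ^ (-δ) := by
      rw [Real.rpow_def_of_pos (by positivity)]
      have h3 := Real.log_le_sub_one_of_pos (show 0 < x / (x + 1) by positivity)
      have h4 : x / (x + 1) - 1 = -(1 / (x + 1)) := by field_simp; ring
      have h5 := Real.add_one_le_exp (Real.log (x / (x + 1)) * -δ)
      have h6 : δ / (x + 1) = δ * (1 / (x + 1)) := by ring
      nlinarith
    have h7 : (x + 1) ^ (-(1 + δ)) = (x + 1) ^ (-δ) * (1 / (x + 1)) := by
      rw [show -(1 + δ) = -δ + -1 by ring, Real.rpow_add (by positivity), Real.rpow_neg_one,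
        one_div]
    rw [h1, h7]
    have h8 : 0 < (x + 1) ^ (-δ) := by positivity
    rw [one_div_mul_eq_div, le_div_iff₀ hδ]
    have : δ / (x + 1) = 1 / (x + 1) * δ := by ring
    nlinarith
  have hpart : ∀ N : ℕ, ∑ n ∈ Finset.range (N + 1), ((n : ℝ) + 1) ^ (-(1 + δ)) ≤
      1 + 1 / δ - 1 / δ * ((N : ℝ) + 1) ^ (-δ) := by
    intro N
    induction N with
    | zero => simp
    | succ N ih =>
      rw [Finset.sum_range_succ]
      have := hstep ((N : ℝ) + 1) (by linarith [N.cast_nonneg (α := ℝ)])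
      push_cast
      linarith
  refine Real.tsum_le_of_sum_range_le (fun n => by positivity) fun N => ?_
  have h0 : (0 : ℝ) ≤ 1 / δ * ((N : ℝ) + 1) ^ (-δ) := by positivity
  have h1 := hpart N
  rw [Finset.sum_range_succ] at h1
  have h2 : (0 : ℝ) ≤ ((N : ℝ) + 1) ^ (-(1 + δ)) := by positivity
  linarith

/-- Second order Taylor estimate for `x ^ (-s)`. -/
lemma norm_cpow_taylor_le {s : ℂ} (hs : -2 ≤ s.re) {A x : ℝ} (hA : 0 < A) (hx : A ≤ x) :
    ‖(x : ℂ) ^ (-s) - (A : ℂ) ^ (-s) + s * (A : ℂ) ^ (-s - 1) * (x - A)‖ ≤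
      ‖s‖ * ‖s + 1‖ * A ^ (-s.re - 2) * (x - A) ^ 2 := by
  have hder : ∀ (u : ℂ) (y : ℝ), 0 < y →
      HasDerivAt (fun y : ℝ => (y : ℂ) ^ u) (u * (y : ℂ) ^ (u - 1)) y := by
    intro u y hy
    rcases eq_or_ne u 0 with rfl | hu
    · simpa using hasDerivAt_const y (1 : ℂ)
    · exact hasDerivAt_ofReal_cpow_const hy.ne' hu
  -- the mean value inequality, applied to the derivative and then to the function
  have h1 : ∀ y ∈ Set.Icc A x, ‖(-s) * (y : ℂ) ^ (-s - 1) + s * (A : ℂ) ^ (-s - 1)‖ ≤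
      ‖s‖ * ‖s + 1‖ * A ^ (-s.re - 2) * (x - A) := by
    intro y hy
    have h2 := (convex_Icc A x).norm_image_sub_le_of_norm_hasDerivWithin_le
      (f := fun y : ℝ => (-s) * (y : ℂ) ^ (-s - 1))
      (f' := fun y : ℝ => (-s) * ((-s - 1) * (y : ℂ) ^ (-s - 1 - 1)))
      (C := ‖s‖ * ‖s + 1‖ * A ^ (-s.re - 2))
      (fun z hz => ((hder _ z (hA.trans_le hz.1)).const_mul (-s)).hasDerivWithinAt)
      (fun z hz => by
        have hz0 : 0 < z := hA.trans_le hz.1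
        rw [norm_mul, norm_mul, norm_neg, Complex.norm_cpow_eq_rpow_re_of_pos hz0,
          show -s - 1 = -(s + 1) by ring, norm_neg, ← mul_assoc]
        refine mul_le_mul_of_nonneg_left ?_ (by positivity)
        have : (-(s + 1) - 1).re = -s.re - 2 := by simp; ring
        rw [this]
        exact Real.rpow_le_rpow_of_nonpos hA hz.1 (by linarith))
      (Set.left_mem_Icc.mpr hx) hy
    have h3 : (-s) * (y : ℂ) ^ (-s - 1) + s * (A : ℂ) ^ (-s - 1) =
        (-s) * (y : ℂ) ^ (-s - 1) - (-s) * (A : ℂ) ^ (-s - 1) := by ring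
    rw [h3]
    refine h2.trans (mul_le_mul_of_nonneg_left ?_ (by positivity))
    rw [Real.norm_of_nonneg (by linarith [hy.1])]
    linarith [hy.2]
  have h2 := (convex_Icc A x).norm_image_sub_le_of_norm_hasDerivWithin_le
      (f := fun y : ℝ => (y : ℂ) ^ (-s) + s * (A : ℂ) ^ (-s - 1) * y)
      (f' := fun y : ℝ => (-s) * (y : ℂ) ^ (-s - 1) + s * (A : ℂ) ^ (-s - 1))
      (C := ‖s‖ * ‖s + 1‖ * A ^ (-s.re - 2) * (x - A))
      (fun z hz => ((hder _ z (hA.trans_le hz.1)).add (by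
        simpa using (Complex.ofRealCLM.hasDerivAt (x := z)).const_mul
          (s * (A : ℂ) ^ (-s - 1)))).hasDerivWithinAt)
      h1 (Set.left_mem_Icc.mpr hx) (Set.right_mem_Icc.mpr hx)
  rw [Real.norm_of_nonneg (by linarith)] at h2
  calc _ = ‖(x : ℂ) ^ (-s) + s * (A : ℂ) ^ (-s - 1) * x -
        ((A : ℂ) ^ (-s) + s * (A : ℂ) ^ (-s - 1) * A)‖ := by congr 1; ring
    _ ≤ _ := h2
    _ = _ := by ring

/-- The mean value of an `m`-periodic sequence. -/
noncomputable def periodMean (f : ℕ → ℂ) (m : ℕ) : ℂ := (∑ r ∈ Finset.range m, f r) / m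

/-- The coefficient of the boundary term in the Euler–Maclaurin formula over blocks of length `m`,
chosen so that the error functional annihilates affine functions. -/
noncomputable def periodMoment (f : ℕ → ℂ) (m : ℕ) : ℂ :=
  (∑ r ∈ Finset.range m, r * f r - periodMean f m * m ^ 2 / 2) / m

/-- `s - 1` times the Euler–Maclaurin error for `∑ f(n) n^(-s)` over the block
`[k m, (k + 1) m)`. -/
noncomputable def blockError (f : ℕ → ℂ) (m k : ℕ) (s : ℂ) : ℂ :=
  (s - 1) * ∑ r ∈ Finset.range m, f r * ((k * m + r : ℕ) : ℂ) ^ (-s) -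
    periodMean f m * (((k * m : ℕ) : ℂ) ^ (1 - s) - (((k + 1) * m : ℕ) : ℂ) ^ (1 - s)) -
    periodMoment f m * (s - 1) *
      ((((k + 1) * m : ℕ) : ℂ) ^ (-s) - ((k * m : ℕ) : ℂ) ^ (-s))

/-- On a block starting at `A` the error functional annihilates affine functions, so it only sees
the remainder `R` of second order in the Taylor expansion of `x ^ (-s)` at `A`. -/
lemma exists_norm_blockError_le (f : ℕ → ℂ) {m : ℕ} (hm : 0 < m) :
    ∃ C : ℝ, 0 < C ∧ ∀ (k : ℕ) (s : ℂ), 0 < k → -2 ≤ s.re →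
      ‖blockError f m k s‖ ≤
        C * (‖s - 1‖ * ‖s‖ * ‖s + 1‖) * ((k * m : ℕ) : ℝ) ^ (-s.re - 2) := by
  refine ⟨(∑ r ∈ Finset.range m, ‖f r‖ + ‖periodMean f m‖ * m + ‖periodMoment f m‖) * m ^ 2 + 1,
    by positivity, fun k s hk hs => ?_⟩
  set A : ℝ := ((k * m : ℕ) : ℝ) with hAdef
  have hA : 0 < A := by rw [hAdef]; exact_mod_cast Nat.mul_pos hk hm
  set B : ℝ := ‖s‖ * ‖s + 1‖ * A ^ (-s.re - 2) with hB
  have hB0 : 0 ≤ B := by positivity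
  set R : ℝ → ℂ := fun x =>
    (x : ℂ) ^ (-s) - (A : ℂ) ^ (-s) + s * (A : ℂ) ^ (-s - 1) * (x - A) with hR
  have hRb : ∀ x ∈ Set.Icc A (A + m), ‖R x‖ ≤ B * m ^ 2 := by
    intro x hx
    refine (norm_cpow_taylor_le hs hA hx.1).trans (mul_le_mul_of_nonneg_left ?_ hB0)
    exact pow_le_pow_left₀ (by linarith [hx.1]) (by linarith [hx.2]) 2
  have hm0 : (0 : ℝ) ≤ m := m.cast_nonneg
  have hmC : (m : ℂ) ≠ 0 := by exact_mod_cast hm.ne'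
  rcases eq_or_ne s 1 with rfl | hs1
  · simp [blockError]
  have hs1' : s - 1 ≠ 0 := sub_ne_zero.mpr hs1
  have h0 : (0 : ℝ) ∉ Set.uIcc A (A + m) := by
    rw [Set.uIcc_of_le (by linarith)]
    exact fun h => by linarith [h.1]
  have hint : ∫ x in A..(A + m), (x : ℂ) ^ (-s) =
      ((A : ℂ) ^ (1 - s) - ((A + m : ℝ) : ℂ) ^ (1 - s)) / (s - 1) := by
    rw [integral_cpow (Or.inr ⟨fun h => hs1 (neg_injective h), h0⟩)]
    rw [show -s + 1 = -(s - 1) by ring, show 1 - s = -(s - 1) by ring]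
    field_simp
    ring
  have hcont : ContinuousOn (fun x : ℝ => (x : ℂ) ^ (-s)) (Set.uIcc A (A + m)) := by
    intro x hx
    rw [Set.uIcc_of_le (by linarith)] at hx
    have : (x : ℂ) ∈ Complex.slitPlane := Or.inl (by simpa using hA.trans_le hx.1)
    exact (ContinuousAt.cpow (by fun_prop) (by fun_prop) this).continuousWithinAt
  have hintR : ∫ x in A..(A + m), R x =
      ((A : ℂ) ^ (1 - s) - ((A + m : ℝ) : ℂ) ^ (1 - s)) / (s - 1) - (A : ℂ) ^ (-s) * m +
        s * (A : ℂ) ^ (-s - 1) * (m ^ 2 / 2) := by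
    rw [hR, intervalIntegral.integral_add, intervalIntegral.integral_sub, hint]
    · rw [intervalIntegral.integral_const_mul]
      have : ∫ x in A..(A + m), ((x : ℂ) - A) = m ^ 2 / 2 := by
        have h9 : ∀ x : ℝ, (x : ℂ) - A = ((x - A : ℝ) : ℂ) := fun x => by push_cast; rfl
        simp_rw [h9]
        rw [intervalIntegral.integral_ofReal]
        have : ∫ x in A..(A + m), (x - A) = (m : ℝ) ^ 2 / 2 := by
          rw [intervalIntegral.integral_comp_sub_right (fun x => x) A]
          simp [integral_id]
        rw [this]; push_cast; rfl
      rw [this]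
      simp
      ring
    · exact hcont.intervalIntegrable
    · exact intervalIntegrable_const
    · exact ContinuousOn.intervalIntegrable (hcont.sub continuousOn_const)
    · exact Continuous.intervalIntegrable (by fun_prop) _ _
  have hkey : blockError f m k s = (s - 1) * (∑ r ∈ Finset.range m, f r * R (A + r) -
      periodMean f m * (∫ x in A..(A + m), R x) - periodMoment f m * (R (A + m) - R A)) := by
    have e1 : ∀ r : ℕ, ((k * m + r : ℕ) : ℂ) = ((A + r : ℝ) : ℂ) := fun r => by
      rw [hAdef]; push_cast; rfl
    have e2 : (((k + 1) * m : ℕ) : ℂ) = ((A + m : ℝ) : ℂ) := by rw [hAdef]; push_cast; ring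
    have e3 : ((k * m : ℕ) : ℂ) = (A : ℂ) := by rw [hAdef]; push_cast; rfl
    have e4 : ∑ r ∈ Finset.range m, f r * R (A + r) =
        ∑ r ∈ Finset.range m, f r * ((A + r : ℝ) : ℂ) ^ (-s) -
          (A : ℂ) ^ (-s) * ∑ r ∈ Finset.range m, f r +
          s * (A : ℂ) ^ (-s - 1) * ∑ r ∈ Finset.range m, r * f r := by
      rw [Finset.mul_sum, Finset.mul_sum, ← Finset.sum_sub_distrib, ← Finset.sum_add_distrib]
      refine Finset.sum_congr rfl fun r _ => ?_
      simp only [hR]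
      push_cast
      ring
    have e5 : ∑ r ∈ Finset.range m, f r = periodMean f m * m := by
      rw [periodMean]; field_simp
    have e6 : ∑ r ∈ Finset.range m, r * f r =
        periodMoment f m * m + periodMean f m * m ^ 2 / 2 := by
      rw [periodMoment]; field_simp; ring
    rw [hintR, e4, e5, e6, blockError, e2, e3]
    simp_rw [e1]
    simp only [hR]
    push_cast
    field_simp
    ring
  have hI : ‖∫ x in A..(A + m), R x‖ ≤ B * m ^ 2 * m := by
    refine (intervalIntegral.norm_integral_le_of_norm_le_const (C := B * m ^ 2)
      fun x hx => hRb x ?_).trans (le_of_eq ?_)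
    · rw [Set.uIoc_of_le (by linarith)] at hx
      exact ⟨hx.1.le, hx.2⟩
    · rw [add_sub_cancel_left, abs_of_nonneg hm0]
  have hRA : R A = 0 := by simp [hR]
  have hS : ‖∑ r ∈ Finset.range m, f r * R (A + r)‖ ≤
      (∑ r ∈ Finset.range m, ‖f r‖) * (B * m ^ 2) := by
    rw [Finset.sum_mul]
    refine norm_sum_le_of_le _ fun r hr => ?_
    rw [norm_mul]
    refine mul_le_mul_of_nonneg_left (hRb _ ⟨by linarith [r.cast_nonneg (α := ℝ)], ?_⟩)
      (norm_nonneg _)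
    have : (r : ℝ) ≤ m := by exact_mod_cast (Finset.mem_range.mp hr).le
    linarith
  rw [hkey, norm_mul, hRA, sub_zero]
  have h1 : ‖∑ r ∈ Finset.range m, f r * R (A + r) -
      periodMean f m * (∫ x in A..(A + m), R x) - periodMoment f m * R (A + m)‖ ≤
      (∑ r ∈ Finset.range m, ‖f r‖) * (B * m ^ 2) + ‖periodMean f m‖ * (B * m ^ 2 * m) +
        ‖periodMoment f m‖ * (B * m ^ 2) := by
    refine (norm_sub_le _ _).trans (add_le_add ((norm_sub_le _ _).trans (add_le_add hS ?_)) ?_)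
    · rw [norm_mul]
      exact mul_le_mul_of_nonneg_left hI (norm_nonneg _)
    · rw [norm_mul]
      exact mul_le_mul_of_nonneg_left (hRb _ ⟨by linarith, le_rfl⟩) (norm_nonneg _)
  calc _ ≤ ‖s - 1‖ * ((∑ r ∈ Finset.range m, ‖f r‖) * (B * m ^ 2) +
        ‖periodMean f m‖ * (B * m ^ 2 * m) + ‖periodMoment f m‖ * (B * m ^ 2)) :=
        mul_le_mul_of_nonneg_left h1 (norm_nonneg _)
    _ = (∑ r ∈ Finset.range m, ‖f r‖ + ‖periodMean f m‖ * m + ‖periodMoment f m‖) * m ^ 2 *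
          (‖s - 1‖ * B) := by ring
    _ ≤ ((∑ r ∈ Finset.range m, ‖f r‖ + ‖periodMean f m‖ * m + ‖periodMoment f m‖) * m ^ 2 + 1) *
          (‖s - 1‖ * B) := mul_le_mul_of_nonneg_right (by linarith) (by positivity)
    _ = _ := by rw [hB]; ring

end SingularSeries

namespace SingularSeries

lemma differentiable_natCast_cpow {n : ℕ} (hn : n ≠ 0) {u : ℂ → ℂ} (hu : Differentiable ℂ u) :
    Differentiable ℂ fun s => (n : ℂ) ^ u s := fun s =>
  (hu s).const_cpow (Or.inl (by exact_mod_cast hn))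

lemma differentiable_blockError (f : ℕ → ℂ) {m k : ℕ} (hm : 0 < m) (hk : 0 < k) :
    Differentiable ℂ (blockError f m k) := by
  have h1 : k * m ≠ 0 := (Nat.mul_pos hk hm).ne'
  have h2 : (k + 1) * m ≠ 0 := (Nat.mul_pos k.succ_pos hm).ne'
  unfold blockError
  refine ((Differentiable.mul (by fun_prop)
    (Differentiable.fun_sum fun r _ => Differentiable.const_mul
    (differentiable_natCast_cpow (by omega) (by fun_prop)) _)).sub
    (Differentiable.const_mul ((differentiable_natCast_cpow h1 (by fun_prop)).sub
      (differentiable_natCast_cpow h2 (by fun_prop))) _)).sub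
    (Differentiable.mul (by fun_prop) ((differentiable_natCast_cpow h2 (by fun_prop)).sub
      (differentiable_natCast_cpow h1 (by fun_prop))))

/-- The boundary terms of consecutive blocks telescope. -/
lemma sum_blockError {f : ℕ → ℂ} {m : ℕ} (hm : 0 < m) (hf : ∀ k r, f (k * m + r) = f r)
    {K : ℕ} (hK : 0 < K) (s : ℂ) (N : ℕ) :
    ∑ k ∈ Finset.range N, blockError f m (K + k) s =
      (s - 1) * (∑ n ∈ Finset.range ((K + N) * m), LSeries.term f s n -
        ∑ n ∈ Finset.range (K * m), LSeries.term f s n) -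
      periodMean f m * (((K * m : ℕ) : ℂ) ^ (1 - s) - (((K + N) * m : ℕ) : ℂ) ^ (1 - s)) -
      periodMoment f m * (s - 1) *
        ((((K + N) * m : ℕ) : ℂ) ^ (-s) - ((K * m : ℕ) : ℂ) ^ (-s)) := by
  induction N with
  | zero => simp
  | succ N ih =>
    have h1 : (K + (N + 1)) * m = (K + N) * m + m := by ring
    have h2 : (K + N + 1) * m = (K + N) * m + m := by ring
    rw [Finset.sum_range_succ, ih, blockError, h1, h2, Finset.sum_range_add]
    have h3 : ∑ r ∈ Finset.range m, LSeries.term f s ((K + N) * m + r) =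
        ∑ r ∈ Finset.range m, f r * (((K + N) * m + r : ℕ) : ℂ) ^ (-s) := by
      refine Finset.sum_congr rfl fun r _ => ?_
      have h4 : (K + N) * m + r ≠ 0 := by
        have := Nat.mul_pos (show 0 < K + N by omega) hm
        omega
      rw [LSeries.term_of_ne_zero h4, hf, Complex.cpow_neg, div_eq_mul_inv]
    rw [h3]
    ring

lemma rpow_block_le {m K k : ℕ} (hm : 0 < m) (hK : 0 < K) {σ : ℝ} (hσ : -1 < σ) :
    (((K + k) * m : ℕ) : ℝ) ^ (-σ - 2) ≤ ((k : ℝ) + 1) ^ (-(1 + (σ + 1))) := by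
  rw [show -σ - 2 = -(1 + (σ + 1)) by ring]
  refine Real.rpow_le_rpow_of_nonpos (by positivity) ?_ (by linarith)
  have : k + 1 ≤ (K + k) * m := by nlinarith
  exact_mod_cast this

lemma rpow_block_le' {m K k : ℕ} (hm : 0 < m) (hK : 0 < K) {σ : ℝ} (hσ : 0 < σ) :
    (((K + k) * m : ℕ) : ℝ) ^ (-σ - 2) ≤ (K : ℝ)⁻¹ * ((k : ℝ) + 1) ^ (-(1 + σ)) := by
  have h1 : k + 1 ≤ (K + k) * m := by nlinarith
  have h2 : K ≤ (K + k) * m := by nlinarith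
  have h1' : (k : ℝ) + 1 ≤ (((K + k) * m : ℕ) : ℝ) := by exact_mod_cast h1
  have h2' : (K : ℝ) ≤ (((K + k) * m : ℕ) : ℝ) := by exact_mod_cast h2
  have hK' : (0 : ℝ) < K := by exact_mod_cast hK
  rw [show -σ - 2 = -1 + -(1 + σ) by ring, Real.rpow_add (by linarith), Real.rpow_neg_one]
  exact mul_le_mul (inv_anti₀ hK' h2')
    (Real.rpow_le_rpow_of_nonpos (by positivity) h1' (by linarith)) (by positivity) (by positivity)

section Tail

variable {f : ℕ → ℂ} {m K : ℕ}

/-- Summability and bounds for the sum of the Euler–Maclaurin errors. -/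
lemma exists_tail_bound (f : ℕ → ℂ) {m : ℕ} (hm : 0 < m) :
    ∃ C : ℝ, 0 < C ∧ ∀ (K : ℕ) (s : ℂ), 0 < K → -1 < s.re →
      (Summable fun k => ‖blockError f m (K + k) s‖) ∧
      ‖∑' k, blockError f m (K + k) s‖ ≤
        C * (‖s - 1‖ * ‖s‖ * ‖s + 1‖) * (1 + 1 / (s.re + 1)) ∧
      (1 / 2 ≤ s.re → ‖∑' k, blockError f m (K + k) s‖ ≤
        C * (‖s - 1‖ * ‖s‖ * ‖s + 1‖) * (3 / K)) := by
  obtain ⟨C, hC, hb⟩ := exists_norm_blockError_le f hm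
  refine ⟨C, hC, fun K s hK hs => ?_⟩
  set P := ‖s - 1‖ * ‖s‖ * ‖s + 1‖ with hP
  have hP0 : 0 ≤ P := by positivity
  have h1 : ∀ k, ‖blockError f m (K + k) s‖ ≤ C * P * ((k : ℝ) + 1) ^ (-(1 + (s.re + 1))) :=
    fun k => (hb (K + k) s (by omega) (by linarith)).trans
      (mul_le_mul_of_nonneg_left (rpow_block_le hm hK hs) (by positivity))
  have hsum := summable_rpow_succ (show 0 < s.re + 1 by linarith)
  have hS : Summable fun k => ‖blockError f m (K + k) s‖ :=
    Summable.of_nonneg_of_le (fun _ => norm_nonneg _) h1 (hsum.mul_left _)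
  refine ⟨hS, ?_, fun hs2 => ?_⟩
  · refine (tsum_of_norm_bounded (hsum.mul_left (C * P)).hasSum h1).trans ?_
    rw [tsum_mul_left]
    exact mul_le_mul_of_nonneg_left (tsum_rpow_succ_le (by linarith)) (by positivity)
  · have hs0 : 0 < s.re := by linarith
    have hsum2 := summable_rpow_succ hs0
    have h2 : ∀ k, ‖blockError f m (K + k) s‖ ≤
        C * P * ((K : ℝ)⁻¹ * ((k : ℝ) + 1) ^ (-(1 + s.re))) :=
      fun k => (hb (K + k) s (by omega) (by linarith)).trans
        (mul_le_mul_of_nonneg_left (rpow_block_le' hm hK hs0) (by positivity))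
    refine (tsum_of_norm_bounded ((hsum2.mul_left (K : ℝ)⁻¹).mul_left (C * P)).hasSum h2).trans ?_
    rw [tsum_mul_left, tsum_mul_left]
    refine mul_le_mul_of_nonneg_left ?_ (by positivity)
    rw [div_eq_inv_mul]
    refine mul_le_mul_of_nonneg_left ((tsum_rpow_succ_le hs0).trans ?_) (by positivity)
    have : 1 / s.re ≤ 2 := by rw [div_le_iff₀ hs0]; linarith
    linarith

lemma differentiableOn_tail (f : ℕ → ℂ) (hm : 0 < m) (hK : 0 < K) :
    DifferentiableOn ℂ (fun s => ∑' k, blockError f m (K + k) s) {s | -1 < s.re} := by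
  obtain ⟨C, hC, hb⟩ := exists_norm_blockError_le f hm
  intro s hs
  have hs' : -1 < s.re := hs
  set δ := (s.re + 1) / 2 with hδ
  have hδ0 : 0 < δ := by rw [hδ]; linarith
  set U : Set ℂ := {w | -1 + δ < w.re} ∩ Metric.ball 0 (‖s‖ + 1) with hU
  have hUo : IsOpen U := (isOpen_lt continuous_const Complex.continuous_re).inter Metric.isOpen_ball
  have hsU : s ∈ U := ⟨by simp only [hδ, Set.mem_ofPred_eq]; linarith, by simp⟩
  set B := (‖s‖ + 2) * (‖s‖ + 1) * (‖s‖ + 2) with hB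
  have h := Complex.differentiableOn_tsum_of_summable_norm (F := fun k => blockError f m (K + k))
    (u := fun k : ℕ => C * B * ((k : ℝ) + 1) ^ (-(1 + δ))) ((summable_rpow_succ hδ0).mul_left _)
    (fun k => (differentiable_blockError f hm (by omega)).differentiableOn) hUo (fun k w hw => by
      have hw1 : -1 + δ < w.re := hw.1
      have hw2 : ‖w‖ < ‖s‖ + 1 := by simpa using hw.2
      refine (hb (K + k) w (by omega) (by linarith)).trans ?_
      have e1 : ‖w - 1‖ ≤ ‖s‖ + 2 := (norm_sub_le _ _).trans (by simp; linarith)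
      have e2 : ‖w + 1‖ ≤ ‖s‖ + 2 := (norm_add_le _ _).trans (by simp; linarith)
      have e3 : (((K + k) * m : ℕ) : ℝ) ^ (-w.re - 2) ≤ ((k : ℝ) + 1) ^ (-(1 + δ)) :=
        (rpow_block_le hm hK (by linarith)).trans
          (Real.rpow_le_rpow_of_exponent_le (by linarith [k.cast_nonneg (α := ℝ)]) (by linarith))
      rw [hB]
      gcongr)
  exact ((h s hsU).differentiableAt (hUo.mem_nhds hsU)).differentiableWithinAt

/-- The Euler–Maclaurin formula in the half-plane of absolute convergence. -/
lemma hasSum_blockError (hm : 0 < m) (hf : ∀ k r, f (k * m + r) = f r) (hK : 0 < K) {s : ℂ}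
    (hs : 1 < s.re) (hS : LSeriesSummable f s) :
    (s - 1) * LSeries f s = (s - 1) * ∑ n ∈ Finset.range (K * m), LSeries.term f s n +
      periodMean f m * ((K * m : ℕ) : ℂ) ^ (1 - s) -
      periodMoment f m * (s - 1) * ((K * m : ℕ) : ℂ) ^ (-s) +
      ∑' k, blockError f m (K + k) s := by
  obtain ⟨C, -, hb⟩ := exists_tail_bound f hm
  have h1 := (hb K s hK (by linarith)).1.of_norm.hasSum.tendsto_sum_nat
  have hnat : Tendsto (fun N : ℕ => (K + N) * m) atTop atTop :=
    tendsto_atTop_mono (fun N => show N ≤ (K + N) * m by nlinarith) tendsto_id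
  have h2 : Tendsto (fun N => ∑ n ∈ Finset.range ((K + N) * m), LSeries.term f s n) atTop
      (𝓝 (LSeries f s)) := hS.hasSum.tendsto_sum_nat.comp hnat
  have h3 : ∀ u : ℂ, u.re < 0 →
      Tendsto (fun N : ℕ => (((K + N) * m : ℕ) : ℂ) ^ u) atTop (𝓝 0) := by
    intro u hu
    rw [tendsto_zero_iff_norm_tendsto_zero]
    have h4 : Tendsto (fun N : ℕ => (((K + N) * m : ℕ) : ℝ) ^ u.re) atTop (𝓝 0) := by
      have := (tendsto_rpow_neg_atTop (show 0 < -u.re by linarith)).comp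
        (tendsto_natCast_atTop_atTop (R := ℝ) |>.comp hnat)
      simpa [Function.comp_def] using this
    refine h4.congr fun N => ?_
    rw [Complex.norm_natCast_cpow_of_pos (Nat.mul_pos (by omega) hm)]
  have h5 := ((h2.sub_const (∑ n ∈ Finset.range (K * m), LSeries.term f s n)).const_mul
    (s - 1)).sub ((((h3 (1 - s) (by simp; linarith)).const_sub
      (((K * m : ℕ) : ℂ) ^ (1 - s))).const_mul (periodMean f m)))
  have h6 := h5.sub (((h3 (-s) (by simp; linarith)).sub_const
    (((K * m : ℕ) : ℂ) ^ (-s))).const_mul (periodMoment f m * (s - 1)))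
  have h7 := tendsto_nhds_unique h1 (h6.congr fun N => (sum_blockError hm hf hK s N).symm)
  rw [h7]
  ring

end Tail

section Dirichlet

variable {m : ℕ} [NeZero m] (χ : DirichletCharacter ℂ m)

/-- `(s - 1) L(s, χ)` extends to an entire function. -/
lemma exists_entire_LFunction : ∃ E : ℂ → ℂ, Differentiable ℂ E ∧
    ∀ s, s ≠ 1 → E s = (s - 1) * χ.LFunction s := by
  by_cases hχ : χ = 1
  · subst hχ
    exact ⟨_, DirichletCharacter.differentiable_LFunctionTrivChar₁ m, fun s hs => by
      simp [DirichletCharacter.LFunctionTrivChar₁, hs]⟩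
  · exact ⟨_, (differentiable_id.sub_const 1).mul
      (DirichletCharacter.differentiable_LFunction hχ), fun s _ => rfl⟩

/-- The Euler–Maclaurin formula with head of length `K m`, extended to `Re s > -1` by the identity
theorem. -/
lemma sub_one_mul_LFunction_eq {K : ℕ} (hK : 0 < K) {s : ℂ} (hs : -1 < s.re) (hs1 : s ≠ 1) :
    (s - 1) * χ.LFunction s =
      (s - 1) * ∑ n ∈ Finset.range (K * m), LSeries.term (fun n : ℕ => χ n) s n +
      periodMean (fun n : ℕ => χ n) m * ((K * m : ℕ) : ℂ) ^ (1 - s) -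
      periodMoment (fun n : ℕ => χ n) m * (s - 1) * ((K * m : ℕ) : ℂ) ^ (-s) +
      ∑' k, blockError (fun n : ℕ => χ n) m (K + k) s := by
  have hm : 0 < m := Nat.pos_of_ne_zero (NeZero.ne m)
  have hKm : K * m ≠ 0 := (Nat.mul_pos hK hm).ne'
  obtain ⟨E, hE, hEs⟩ := exists_entire_LFunction χ
  set U : Set ℂ := {s | -1 < s.re} with hU
  have hUo : IsOpen U := isOpen_lt continuous_const Complex.continuous_re
  have hUc : IsPreconnected U := (convex_halfSpace_re_gt (-1)).isPreconnected
  have hterm : ∀ n, Differentiable ℂ fun s => LSeries.term (fun n : ℕ => χ n) s n := by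
    intro n
    rcases eq_or_ne n 0 with rfl | hn
    · simp
    · simp only [LSeries.term_of_ne_zero hn]
      exact (differentiable_const _).div (differentiable_natCast_cpow hn differentiable_id)
        fun s => by simp [Complex.cpow_eq_zero_iff, hn]
  have hR : DifferentiableOn ℂ (fun s : ℂ =>
      (s - 1) * ∑ n ∈ Finset.range (K * m), LSeries.term (fun n : ℕ => χ n) s n +
      periodMean (fun n : ℕ => χ n) m * ((K * m : ℕ) : ℂ) ^ (1 - s) -
      periodMoment (fun n : ℕ => χ n) m * (s - 1) * ((K * m : ℕ) : ℂ) ^ (-s) +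
      ∑' k, blockError (fun n : ℕ => χ n) m (K + k) s) U := by
    refine DifferentiableOn.add (Differentiable.differentiableOn ?_) (differentiableOn_tail _ hm hK)
    refine Differentiable.sub (Differentiable.add (Differentiable.mul (by fun_prop)
      (Differentiable.fun_sum fun n _ => hterm n)) (Differentiable.const_mul
      (differentiable_natCast_cpow hKm (by fun_prop)) _)) (Differentiable.mul (by fun_prop)
      (differentiable_natCast_cpow hKm (by fun_prop)))
  have h2 : E =ᶠ[𝓝 2] fun s : ℂ =>
      (s - 1) * ∑ n ∈ Finset.range (K * m), LSeries.term (fun n : ℕ => χ n) s n +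
      periodMean (fun n : ℕ => χ n) m * ((K * m : ℕ) : ℂ) ^ (1 - s) -
      periodMoment (fun n : ℕ => χ n) m * (s - 1) * ((K * m : ℕ) : ℂ) ^ (-s) +
      ∑' k, blockError (fun n : ℕ => χ n) m (K + k) s := by
    filter_upwards [(isOpen_lt continuous_const Complex.continuous_re).mem_nhds
      (show (1 : ℝ) < (2 : ℂ).re by simp)] with s hs
    have hs' : 1 < s.re := hs
    rw [hEs s (by rintro rfl; simp at hs'), χ.LFunction_eq_LSeries hs',
      hasSum_blockError hm (fun k r => by simp) hK hs'
        (DirichletCharacter.LSeriesSummable_of_one_lt_re χ hs')]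
  have h3 := (hE.differentiableOn.analyticOnNhd hUo).eqOn_of_preconnected_of_eventuallyEq
    (hR.analyticOnNhd hUo) hUc (z₀ := 2) (by simp [hU]; norm_num) h2
  rw [← hEs s hs1]
  exact h3 hs

lemma norm_LSeries_term_le {M : ℕ} (χ : DirichletCharacter ℂ M) (s : ℂ) (n : ℕ) :
    ‖LSeries.term (fun n : ℕ => χ n) s n‖ ≤ if n = 0 then 0 else (n : ℝ) ^ (-s.re) := by
  rw [LSeries.norm_term_eq]
  split_ifs with h
  · exact le_rfl
  · rw [Real.rpow_neg (by positivity), ← one_div]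
    gcongr
    exact χ.norm_le_one _

/-- Polynomial growth of `L(s, χ)` in `Re s > -1`. -/
lemma exists_norm_LFunction_le : ∃ C : ℝ, 0 < C ∧ ∀ s : ℂ, -1 < s.re → 1 / 2 ≤ ‖s - 1‖ →
    ‖χ.LFunction s‖ ≤ C * (1 + ‖s‖) ^ 3 * (1 + 1 / (s.re + 1)) := by
  have hm : 0 < m := Nat.pos_of_ne_zero (NeZero.ne m)
  obtain ⟨C, hC, hb⟩ := exists_tail_bound (fun n : ℕ => χ n) hm
  set α := ‖periodMean (fun n : ℕ => χ n) m‖ with hα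
  set β := ‖periodMoment (fun n : ℕ => χ n) m‖ with hβ
  refine ⟨(m : ℝ) ^ 2 + 2 * α * m ^ 2 + β * m + C * 1, by positivity, fun s hs hs1 => ?_⟩
  have hne : s ≠ 1 := by rintro rfl; norm_num at hs1
  have hn0 : 0 < ‖s - 1‖ := by linarith
  have h1 := sub_one_mul_LFunction_eq χ one_pos hs hne
  simp only [one_mul] at h1
  have hm1 : (1 : ℝ) ≤ m := by exact_mod_cast hm
  have hσ : ∀ n : ℕ, 0 < n → n ≤ m → (n : ℝ) ^ (-s.re) ≤ m := by
    intro n hn hnm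
    have h2 : (1 : ℝ) ≤ n := by exact_mod_cast hn
    calc (n : ℝ) ^ (-s.re) ≤ (n : ℝ) ^ (1 : ℝ) :=
          Real.rpow_le_rpow_of_exponent_le h2 (by linarith)
      _ = n := Real.rpow_one _
      _ ≤ m := by exact_mod_cast hnm
  have hhead : ‖∑ n ∈ Finset.range m, LSeries.term (fun n : ℕ => χ n) s n‖ ≤ (m : ℝ) ^ 2 := by
    refine (norm_sum_le_of_le _ (f := fun n => LSeries.term (fun n : ℕ => χ n) s n)
      (n := fun _ => (m : ℝ)) fun n hn => ?_).trans
      (by simp [sq])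
    refine (norm_LSeries_term_le χ s n).trans ?_
    split_ifs with h
    · positivity
    · exact hσ n (Nat.pos_of_ne_zero h) (Finset.mem_range.mp hn).le
  have hp1 : ‖((m : ℕ) : ℂ) ^ (1 - s)‖ ≤ (m : ℝ) ^ 2 := by
    rw [Complex.norm_natCast_cpow_of_pos hm]
    rw [← Real.rpow_natCast]
    exact Real.rpow_le_rpow_of_exponent_le hm1 (by simp; linarith)
  have hp2 : ‖((m : ℕ) : ℂ) ^ (-s)‖ ≤ m := by
    rw [Complex.norm_natCast_cpow_of_pos hm]
    exact hσ m hm le_rfl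
  have h2 := (hb 1 s one_pos hs).2.1
  set Q := 1 + 1 / (s.re + 1) with hQ
  have hQ1 : 1 ≤ Q := by
    have : 0 < 1 / (s.re + 1) := by apply div_pos one_pos; linarith
    linarith
  have h3 : ‖s - 1‖ * ‖χ.LFunction s‖ ≤ ‖s - 1‖ * (m : ℝ) ^ 2 + α * m ^ 2 + β * ‖s - 1‖ * m +
      C * (‖s - 1‖ * ‖s‖ * ‖s + 1‖) * Q := by
    rw [← norm_mul, h1]
    refine (norm_add_le _ _).trans (add_le_add ((norm_sub_le _ _).trans (add_le_add
      ((norm_add_le _ _).trans (add_le_add ?_ ?_)) ?_)) h2)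
    · rw [norm_mul]; gcongr
    · rw [norm_mul]; gcongr
    · rw [norm_mul, norm_mul]; gcongr
  have h4 : α * (m : ℝ) ^ 2 ≤ ‖s - 1‖ * (2 * α * m ^ 2) := by
    have : 0 ≤ α * (m : ℝ) ^ 2 := by positivity
    nlinarith
  have h5 : ‖χ.LFunction s‖ ≤ (m : ℝ) ^ 2 + 2 * α * m ^ 2 + β * m + C * (‖s‖ * ‖s + 1‖) * Q := by
    refine le_of_mul_le_mul_left ?_ hn0
    linarith
  have h6 : 1 ≤ (1 + ‖s‖) ^ 3 := one_le_pow₀ (by linarith [norm_nonneg s])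
  have h7 : ‖s‖ * ‖s + 1‖ ≤ (1 + ‖s‖) ^ 3 := by
    have h8 : ‖s + 1‖ ≤ ‖s‖ + 1 := (norm_add_le _ _).trans (by simp)
    calc ‖s‖ * ‖s + 1‖ ≤ (1 + ‖s‖) * (1 + ‖s‖) := by
          apply mul_le_mul <;> linarith [norm_nonneg s, norm_nonneg (s + 1)]
      _ = (1 + ‖s‖) ^ 2 * 1 := by ring
      _ ≤ (1 + ‖s‖) ^ 2 * (1 + ‖s‖) := by
          apply mul_le_mul_of_nonneg_left _ (by positivity); linarith [norm_nonneg s]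
      _ = _ := by ring
  have h8 : 1 ≤ (1 + ‖s‖) ^ 3 * Q := one_le_mul_of_one_le_of_one_le h6 hQ1
  have h9 : 0 ≤ (m : ℝ) ^ 2 + 2 * α * m ^ 2 + β * m := by positivity
  calc ‖χ.LFunction s‖ ≤ _ := h5
    _ ≤ ((m : ℝ) ^ 2 + 2 * α * m ^ 2 + β * m) * ((1 + ‖s‖) ^ 3 * Q) +
          C * (1 + ‖s‖) ^ 3 * Q := by
        refine add_le_add (le_mul_of_one_le_right h9 h8) ?_
        gcongr
    _ = _ := by ring

/-- Just to the left of the line `Re s = 1` the `L`-function grows at most like a small power. -/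
lemma exists_norm_LFunction_near_one_le {κ : ℝ} (hκ : 0 < κ) (hκ2 : κ ≤ 1 / 2) :
    ∃ C : ℝ, 0 < C ∧ ∀ s : ℂ, 1 - κ ≤ s.re → s.re ≤ 2 → 1 ≤ |s.im| →
      ‖χ.LFunction s‖ ≤ C * |s.im| ^ (4 * κ) := by
  have hm : 0 < m := Nat.pos_of_ne_zero (NeZero.ne m)
  have hm1 : (1 : ℝ) ≤ m := by exact_mod_cast hm
  obtain ⟨C, hC, hb⟩ := exists_tail_bound (fun n : ℕ => χ n) hm
  set α := ‖periodMean (fun n : ℕ => χ n) m‖ with hα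
  set β := ‖periodMoment (fun n : ℕ => χ n) m‖ with hβ
  set D : ℝ := (2 * m) ^ (2 * κ) with hD
  refine ⟨D * (1 + 1 / κ) + α * D + β + C * 36, by positivity, fun s hs hs2 hT => ?_⟩
  set T := |s.im| with hTdef
  have hT0 : 0 < T := by linarith
  have hn : T ≤ ‖s - 1‖ := by simpa using Complex.abs_im_le_norm (s - 1)
  have hne : s ≠ 1 := by rintro rfl; simp at hTdef; linarith
  set K := ⌈T ^ 2⌉₊ with hK
  have hK0 : 0 < K := Nat.ceil_pos.mpr (by positivity)
  have hK1 : T ^ 2 ≤ K := Nat.le_ceil _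
  have hK2 : (K : ℝ) ≤ 2 * T ^ 2 := by
    have := (Nat.ceil_lt_add_one (show 0 ≤ T ^ 2 by positivity)).le
    have h1 : 1 ≤ T ^ 2 := one_le_pow₀ hT
    linarith
  have hKm : 0 < K * m := Nat.mul_pos hK0 hm
  have hKm1 : (1 : ℝ) ≤ (K * m : ℕ) := by exact_mod_cast hKm
  -- a head of length about `T²` makes the tail bounded and costs only a power `T ^ (4 κ)`
  have hKmT : ((K * m : ℕ) : ℝ) ^ (2 * κ) ≤ D * T ^ (4 * κ) := by
    calc ((K * m : ℕ) : ℝ) ^ (2 * κ) ≤ (2 * m * T ^ 2) ^ (2 * κ) := by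
          refine Real.rpow_le_rpow (by positivity) ?_ (by positivity)
          push_cast
          nlinarith
      _ = D * T ^ (4 * κ) := by
          rw [Real.mul_rpow (by positivity) (by positivity), ← Real.rpow_natCast T 2,
            ← Real.rpow_mul hT0.le]
          congr 2; push_cast; ring
  have hhead : ‖∑ n ∈ Finset.range (K * m), LSeries.term (fun n : ℕ => χ n) s n‖ ≤
      D * T ^ (4 * κ) * (1 + 1 / κ) := by
    have h1 : ∀ n ∈ Finset.range (K * m), ‖LSeries.term (fun n : ℕ => χ n) s n‖ ≤
        ((K * m : ℕ) : ℝ) ^ (2 * κ) * (if n = 0 then 0 else (n : ℝ) ^ (-(1 + κ))) := by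
      intro n hn
      refine (norm_LSeries_term_le χ s n).trans ?_
      split_ifs with h
      · simp
      · have hn1 : (1 : ℝ) ≤ n := by exact_mod_cast Nat.pos_of_ne_zero h
        have hnK : (n : ℝ) ≤ (K * m : ℕ) := by exact_mod_cast (Finset.mem_range.mp hn).le
        calc (n : ℝ) ^ (-s.re) ≤ (n : ℝ) ^ (2 * κ + -(1 + κ)) :=
              Real.rpow_le_rpow_of_exponent_le hn1 (by linarith)
          _ = (n : ℝ) ^ (2 * κ) * (n : ℝ) ^ (-(1 + κ)) := Real.rpow_add (by linarith) _ _
          _ ≤ _ := by gcongr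
    refine (norm_sum_le_of_le _ h1).trans ?_
    rw [← Finset.mul_sum]
    refine mul_le_mul hKmT ?_ (Finset.sum_nonneg fun n _ => by split_ifs <;> positivity)
      (by positivity)
    obtain ⟨N, hN⟩ : ∃ N, K * m = N + 1 := ⟨K * m - 1, by omega⟩
    rw [hN, Finset.sum_range_succ']
    simp only [Nat.add_eq_zero_iff, one_ne_zero, and_false, if_false, if_true, add_zero]
    refine le_trans ?_ (tsum_rpow_succ_le hκ)
    have := (summable_rpow_succ hκ).sum_le_tsum (Finset.range N) (fun n _ => by positivity)
    simpa using this
  have hp1 : ‖((K * m : ℕ) : ℂ) ^ (1 - s)‖ ≤ D * T ^ (4 * κ) := by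
    rw [Complex.norm_natCast_cpow_of_pos hKm]
    exact (Real.rpow_le_rpow_of_exponent_le hKm1 (by simp; linarith)).trans hKmT
  have hp2 : ‖((K * m : ℕ) : ℂ) ^ (-s)‖ ≤ 1 := by
    rw [Complex.norm_natCast_cpow_of_pos hKm]
    exact Real.rpow_le_one_of_one_le_of_nonpos hKm1 (by simp; linarith)
  have h2 := (hb K s hK0 (by linarith)).2.2 (by linarith)
  have hTp : 1 ≤ T ^ (4 * κ) := Real.one_le_rpow hT (by linarith)
  have hsn : ‖s‖ ≤ 3 * T := by
    refine (Complex.norm_le_abs_re_add_abs_im s).trans ?_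
    rw [abs_of_nonneg (by linarith)]; linarith
  have hsn1 : ‖s + 1‖ ≤ 4 * T := (norm_add_le _ _).trans (by simp; linarith)
  have h3 : C * (‖s - 1‖ * ‖s‖ * ‖s + 1‖) * (3 / K) ≤ ‖s - 1‖ * (C * 36) := by
    have hKr : (0 : ℝ) < K := by exact_mod_cast hK0
    have : ‖s‖ * ‖s + 1‖ ≤ 12 * K := by
      calc ‖s‖ * ‖s + 1‖ ≤ (3 * T) * (4 * T) := by gcongr
        _ = 12 * T ^ 2 := by ring
        _ ≤ _ := by linarith
    calc _ = ‖s - 1‖ * C * 3 * (‖s‖ * ‖s + 1‖) / K := by ring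
      _ ≤ ‖s - 1‖ * C * 3 * (12 * K) / K := by gcongr
      _ = _ := by field_simp; ring
  have h1 := sub_one_mul_LFunction_eq χ hK0 (by linarith) hne
  have h4 : ‖s - 1‖ * ‖χ.LFunction s‖ ≤ ‖s - 1‖ * (D * T ^ (4 * κ) * (1 + 1 / κ)) +
      α * (D * T ^ (4 * κ)) + β * ‖s - 1‖ * 1 + ‖s - 1‖ * (C * 36) := by
    rw [← norm_mul, h1]
    refine (norm_add_le _ _).trans (add_le_add ((norm_sub_le _ _).trans (add_le_add
      ((norm_add_le _ _).trans (add_le_add ?_ ?_)) ?_)) (h2.trans h3))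
    · rw [norm_mul]; gcongr
    · rw [norm_mul]; gcongr
    · rw [norm_mul, norm_mul]; gcongr
  have h5 : α * (D * T ^ (4 * κ)) ≤ ‖s - 1‖ * (α * (D * T ^ (4 * κ))) :=
    le_mul_of_one_le_left (by positivity) (by linarith)
  have h6 : ‖χ.LFunction s‖ ≤ D * T ^ (4 * κ) * (1 + 1 / κ) + α * (D * T ^ (4 * κ)) + β +
      C * 36 := by
    refine le_of_mul_le_mul_left ?_ (show 0 < ‖s - 1‖ by linarith)
    linarith
  calc _ ≤ _ := h6
    _ ≤ D * T ^ (4 * κ) * (1 + 1 / κ) + α * (D * T ^ (4 * κ)) + β * T ^ (4 * κ) +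
        C * 36 * T ^ (4 * κ) := by
        have e1 : β ≤ β * T ^ (4 * κ) := le_mul_of_one_le_right (norm_nonneg _) hTp
        have e2 : C * 36 ≤ C * 36 * T ^ (4 * κ) := le_mul_of_one_le_right (by positivity) hTp
        linarith
    _ = _ := by ring

end Dirichlet

end SingularSeries

namespace SingularSeries

/-! ### A zero-free region -/

section ZeroFree

variable {m : ℕ} [NeZero m] (ψ : DirichletCharacter ℂ m)

/-- Comparison with `ζ(2) - 1`. -/
lemma norm_LSeries_sub_one_le {M : ℕ} (χ : DirichletCharacter ℂ M) {s : ℂ} (hs : 2 ≤ s.re) :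
    ‖LSeries (fun n : ℕ => χ n) s - 1‖ ≤ 2 / 3 := by
  have hS := (DirichletCharacter.LSeriesSummable_of_one_lt_re χ (by linarith : 1 < s.re)).hasSum
  have h1 := (hasSum_nat_add_iff' 2).mpr hS
  have h2 := (hasSum_nat_add_iff' 2).mpr hasSum_zeta_two
  have e1 : (∑' n, LSeries.term (fun n : ℕ => χ n) s n) -
      ∑ i ∈ Finset.range 2, LSeries.term (fun n : ℕ => χ n) s i =
      LSeries (fun n : ℕ => χ n) s - 1 := by
    simp [Finset.sum_range_succ, LSeries, LSeries.term]
  rw [e1] at h1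
  rw [← h1.tsum_eq]
  refine (tsum_of_norm_bounded h2 fun n => ?_).trans ?_
  · refine (norm_LSeries_term_le _ _ _).trans ?_
    rw [if_neg (by lia), one_div, ← Real.rpow_natCast, ← Real.rpow_neg (by positivity)]
    exact Real.rpow_le_rpow_of_exponent_le (by push_cast; linarith [n.cast_nonneg (α := ℝ)])
      (by push_cast; linarith)
  · have := Real.pi_lt_d2
    simp [Finset.sum_range_succ]
    nlinarith [Real.pi_pos]

/-- Nontrivial zeros keep a distance from the line `Re s = 1`, by the `3-4-1` inequality and the
Schwarz lemma at the zero. -/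
lemma exists_re_zero_le : ∃ c : ℝ, 0 < c ∧ ∀ ρ : ℂ, ψ.LFunction ρ = 0 → 2 ≤ |ρ.im| →
    ρ.re ≤ 1 - c * |ρ.im| ^ (-(1 / 4) : ℝ) := by
  -- with `κ = 1/80` the five factors `T ^ (4 κ)` in the `3-4-1` inequality make up `T ^ (1/4)`
  obtain ⟨κ, hκ⟩ : ∃ κ : ℝ, κ = 1 / 80 := ⟨_, rfl⟩
  have hκ0 : 0 < κ := by rw [hκ]; norm_num
  obtain ⟨C₁, hC₁, hb₁⟩ := exists_norm_LFunction_near_one_le ψ (κ := κ) hκ0 (by linarith)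
  obtain ⟨C₂, hC₂, hb₂⟩ := exists_norm_LFunction_near_one_le (ψ ^ 2) (κ := κ) hκ0
    (by linarith)
  set D : ℝ := 8 * (4 / κ * C₁ * 2 ^ (1 / 20 : ℝ)) ^ 4 * (C₂ * 2 ^ (1 / 20 : ℝ)) with hD
  have hD0 : 0 < D := by positivity
  refine ⟨min (κ / 4) D⁻¹, by positivity, fun ρ hρ hT => ?_⟩
  set T := |ρ.im| with hTdef
  have hT0 : 0 < T := by linarith
  set η := 1 - ρ.re with hη
  have hTp1 : T ^ (-(1 / 4) : ℝ) ≤ 1 :=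
    Real.rpow_le_one_of_one_le_of_nonpos (by linarith) (by norm_num)
  have hTp0 : 0 < T ^ (-(1 / 4) : ℝ) := by positivity
  suffices min (κ / 4) D⁻¹ * T ^ (-(1 / 4) : ℝ) ≤ η by linarith
  by_cases hbig : κ / 4 ≤ η
  · calc _ ≤ κ / 4 * 1 := mul_le_mul (min_le_left _ _) hTp1 hTp0.le (by positivity)
      _ ≤ η := by linarith
  push Not at hbig
  have hρ1 : ρ ≠ 1 := by
    rintro rfl
    simp at hTdef
    linarith
  have hη0 : 0 < η := by
    by_contra h
    exact DirichletCharacter.LFunction_ne_zero_of_one_le_re ψ (Or.inr hρ1) (by linarith) hρ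
  set M : ℝ := C₁ * (2 * T) ^ (1 / 20 : ℝ) with hM
  have hball : ∀ z ∈ Metric.ball ρ (κ / 2), ‖ψ.LFunction z‖ ≤ M ∧ z ≠ 1 := by
    intro z hz
    have hz' := mem_ball_iff_norm.mp hz
    have hre := (Complex.abs_re_le_norm (z - ρ)).trans_lt hz'
    have him := (Complex.abs_im_le_norm (z - ρ)).trans_lt hz'
    rw [Complex.sub_re, abs_lt] at hre
    rw [Complex.sub_im] at him
    have h1 : |z.im| ≤ 2 * T := by
      have := abs_sub_abs_le_abs_sub z.im ρ.im
      linarith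
    have h2 : 1 ≤ |z.im| := by
      have := abs_sub_abs_le_abs_sub ρ.im z.im
      rw [abs_sub_comm] at this
      linarith
    refine ⟨(hb₁ z (by linarith [hre.1]) (by linarith [hre.2]) h2).trans ?_, ?_⟩
    · rw [hM, show 4 * κ = 1 / 20 by linarith]
      gcongr
    · rintro rfl; norm_num at h2
  -- the point at which the `3-4-1` inequality is used; `ρ` has distance `2 η` from it
  set z : ℂ := 1 + η + Complex.I * ρ.im with hz
  have hzρ : ‖z - ρ‖ = 2 * η := by
    have : z - ρ = ((2 * η : ℝ) : ℂ) := by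
      apply Complex.ext <;> simp [hz, hη]
      ring
    rw [this, Complex.norm_real, Real.norm_of_nonneg (by linarith)]
  have hzb : z ∈ Metric.ball ρ (κ / 2) := by
    rw [mem_ball_iff_norm, hzρ]; linarith
  have hschw := Complex.dist_le_div_mul_dist_of_mapsTo_ball (f := ψ.LFunction) (c := ρ) (z := z)
    (R₁ := κ / 2) (R₂ := M)
    (fun w hw => (ψ.differentiableAt_LFunction w (Or.inl (hball w hw).2)).differentiableWithinAt)
    (fun w hw => by
      rw [hρ, mem_closedBall_zero_iff]
      exact (hball w hw).1) hzb
  rw [hρ, dist_zero_right, dist_eq_norm, hzρ] at hschw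
  have h341 := DirichletCharacter.norm_LFunction_product_ge_one ψ hη0 ρ.im
  have hL0 : ‖DirichletCharacter.LFunctionTrivChar m (1 + η)‖ ≤ 2 / η := by
    have hre : 1 < (1 + η : ℂ).re := by simp [hη0]
    rw [DirichletCharacter.LFunctionTrivChar, DirichletCharacter.LFunction_eq_LSeries _ hre]
    have h1 : HasSum (fun n => LSeries.term (fun n : ℕ => (1 : DirichletCharacter ℂ m) n)
        (1 + η) (n + 1)) (LSeries (fun n : ℕ => (1 : DirichletCharacter ℂ m) n) (1 + η)) := by
      have := (hasSum_nat_add_iff' 1).mpr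
        (DirichletCharacter.LSeriesSummable_of_one_lt_re (1 : DirichletCharacter ℂ m) hre).hasSum
      simpa [LSeries] using this
    rw [← h1.tsum_eq]
    refine (tsum_of_norm_bounded (summable_rpow_succ hη0).hasSum fun n => ?_).trans
      ((tsum_rpow_succ_le hη0).trans ?_)
    · refine (norm_LSeries_term_le _ _ _).trans ?_
      simp
    · have : 1 ≤ 1 / η := by rw [le_div_iff₀ hη0]; linarith
      have h2 : 2 / η = 1 / η + 1 / η := by ring
      linarith
  have hL2 : ‖(ψ ^ 2).LFunction (1 + η + 2 * Complex.I * ρ.im)‖ ≤ C₂ * (2 * T) ^ (1 / 20 : ℝ) := by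
    have him : |(1 + η + 2 * Complex.I * ρ.im : ℂ).im| = 2 * T := by
      simp [hTdef, abs_mul]
    have := hb₂ (1 + η + 2 * Complex.I * ρ.im) (by simp; linarith) (by simp; linarith)
      (by rw [him]; linarith)
    rwa [him, show 4 * κ = 1 / 20 by linarith] at this
  rw [norm_mul, norm_mul, norm_pow, norm_pow] at h341
  -- the zero contributes `η ^ 4`, the pole only `η ^ (-3)`
  have hchain : (1 : ℝ) ≤ (2 / η) ^ 3 * (M / (κ / 2) * (2 * η)) ^ 4 *
      (C₂ * (2 * T) ^ (1 / 20 : ℝ)) := by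
    refine h341.le.trans ?_
    gcongr
  have hTT : (2 * T) ^ (1 / 20 : ℝ) = 2 ^ (1 / 20 : ℝ) * T ^ (1 / 20 : ℝ) :=
    Real.mul_rpow (by norm_num) hT0.le
  have hT5 : (T ^ (1 / 20 : ℝ)) ^ 5 = T ^ (1 / 4 : ℝ) := by
    rw [← Real.rpow_natCast, ← Real.rpow_mul hT0.le]; norm_num
  have hfin : (2 / η) ^ 3 * (M / (κ / 2) * (2 * η)) ^ 4 * (C₂ * (2 * T) ^ (1 / 20 : ℝ)) =
      D * T ^ (1 / 4 : ℝ) * η := by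
    rw [hM, hTT, hD, ← hT5]
    field_simp
    ring
  rw [hfin] at hchain
  have hTi : T ^ (-(1 / 4) : ℝ) = (T ^ (1 / 4 : ℝ))⁻¹ := Real.rpow_neg hT0.le _
  calc min (κ / 4) D⁻¹ * T ^ (-(1 / 4) : ℝ) ≤ D⁻¹ * T ^ (-(1 / 4) : ℝ) := by
        gcongr; exact min_le_right _ _
    _ = (D * T ^ (1 / 4 : ℝ))⁻¹ * 1 := by rw [hTi, mul_one, mul_inv D]
    _ ≤ (D * T ^ (1 / 4 : ℝ))⁻¹ * (D * T ^ (1 / 4 : ℝ) * η) := by gcongr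
    _ = η := by
        have : 0 < T ^ (1 / 4 : ℝ) := by positivity
        field_simp

lemma re_lt_one_of_mem_zeros {ρ : ℂ} (hρ : ρ ∈ zeros ψ) : ρ.re < 1 := by
  by_contra h
  exact DirichletCharacter.LFunction_ne_zero_of_one_le_re ψ (Or.inr hρ.2.1) (by linarith) hρ.2.2

/-- Zeros of the entire function `(s - 1) L(s,ψ)` are isolated. -/
lemma finite_zeros_inter_compact {S : Set ℂ} (hS : IsCompact S) : (zeros ψ ∩ S).Finite := by
  obtain ⟨E, hE, hEs⟩ := exists_entire_LFunction ψ
  have h2 : E 2 ≠ 0 := by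
    rw [hEs 2 (by norm_num)]
    exact mul_ne_zero (by norm_num) (DirichletCharacter.LFunction_ne_zero_of_one_le_re ψ
      (Or.inr (by norm_num)) (by norm_num))
  have h := AnalyticOnNhd.preimage_zero_mem_codiscrete (f := E)
    (fun z _ => hE.analyticAt z) h2
  rw [mem_codiscrete'] at h
  have hfin : (S ∩ E ⁻¹' {0}).Finite := by
    have hc : IsClosed (E ⁻¹' {0}) := isClosed_singleton.preimage hE.continuous
    refine (hS.inter_right hc).finite ?_
    have := h.2
    rw [Set.preimage_compl, compl_compl] at this
    exact this.mono Set.inter_subset_right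
  refine hfin.subset fun ρ hρ => ⟨hρ.2, ?_⟩
  rw [Set.mem_preimage, hEs ρ hρ.1.2.1, hρ.1.2.2, mul_zero]
  rfl

lemma finite_zeros_im_le (T : ℝ) : {ρ : ℂ | ρ ∈ zeros ψ ∧ |ρ.im| ≤ T}.Finite := by
  have hc : IsCompact (Set.Icc (0 : ℝ) 1 ×ℂ Set.Icc (-T) T) := isCompact_Icc.reProdIm isCompact_Icc
  refine (finite_zeros_inter_compact ψ hc).subset fun ρ hρ => ⟨hρ.1, ?_⟩
  exact ⟨⟨hρ.1.1.le, (re_lt_one_of_mem_zeros ψ hρ.1).le⟩, abs_le.mp hρ.2⟩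

/-- A zero in `Re s > 0` is reflected by the functional equation of the primitive character. -/
lemma LFunction_primitive_inv_one_sub_eq_zero {ρ : ℂ} (hρ : ρ ∈ zeros ψ) :
    haveI : NeZero ψ.conductor := ⟨ψ.conductor_ne_zero⟩
    (ψ.primitiveCharacter⁻¹).LFunction (1 - ρ) = 0 := by
  have : NeZero ψ.conductor := ⟨ψ.conductor_ne_zero⟩
  obtain ⟨h0, h1, hL⟩ := hρ
  set χ := ψ.primitiveCharacter with hχ
  have e1 : ψ.LFunction ρ = χ.LFunction ρ * ∏ p ∈ m.primeFactors, (1 - χ p * (p : ℂ) ^ (-ρ)) := by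
    rw [← DirichletCharacter.LFunction_changeLevel ψ.conductor_dvd_level χ (Or.inr h1), hχ,
      DirichletCharacter.changeLevel_primitiveCharacter]
  -- the finitely many Euler factors vanish only on `Re s = 0`
  have e2 : χ.LFunction ρ = 0 := by
    rw [e1] at hL
    refine (mul_eq_zero.mp hL).resolve_right (Finset.prod_ne_zero_iff.mpr fun p hp h => ?_)
    have hp' := Nat.prime_of_mem_primeFactors hp
    have h2 : ‖χ p * (p : ℂ) ^ (-ρ)‖ = 1 := by rw [← sub_eq_zero.mp h, norm_one]
    rw [norm_mul, Complex.norm_natCast_cpow_of_pos hp'.pos] at h2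
    have h3 : (p : ℝ) ^ (-ρ).re < 1 :=
      Real.rpow_lt_one_of_one_lt_of_neg (by exact_mod_cast hp'.one_lt) (by simpa using h0)
    have h4 := χ.norm_le_one p
    have h5 : 0 ≤ (p : ℝ) ^ (-ρ).re := by positivity
    nlinarith [norm_nonneg (χ p)]
  have h0' : ρ ≠ 0 := by rintro rfl; simp at h0
  have e3 : χ.completedLFunction ρ = 0 := by
    rw [DirichletCharacter.LFunction_eq_completed_div_gammaFactor χ ρ (Or.inl h0')] at e2
    refine (div_eq_zero_iff.mp e2).resolve_right ?_
    rcases χ.even_or_odd with h | h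
    · rw [h.gammaFactor_def]
      exact Complex.Gammaℝ_ne_zero_of_re_pos h0
    · rw [h.gammaFactor_def]
      exact Complex.Gammaℝ_ne_zero_of_re_pos (by simp; linarith)
  have hprim : (χ⁻¹).IsPrimitive := by
    rw [DirichletCharacter.isPrimitive_def, DirichletCharacter.conductor_inv]
    exact ψ.primitiveCharacter_isPrimitive
  have e4 := DirichletCharacter.IsPrimitive.completedLFunction_one_sub hprim ρ
  rw [inv_inv, e3, mul_zero] at e4
  rw [DirichletCharacter.LFunction_eq_completed_div_gammaFactor _ _
    (Or.inl (sub_ne_zero.mpr h1.symm)), e4, zero_div]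

/-- The zero-free region, reflected to a neighbourhood of the line `Re s = 0`. -/
lemma exists_le_re_zeros : ∃ c : ℝ, 0 < c ∧ ∀ ρ ∈ zeros ψ,
    c * (1 + |ρ.im|) ^ (-(1 / 4) : ℝ) ≤ ρ.re := by
  have : NeZero ψ.conductor := ⟨ψ.conductor_ne_zero⟩
  obtain ⟨c, hc, hz⟩ := exists_re_zero_le (ψ.primitiveCharacter⁻¹)
  obtain ⟨b, hb, hbz⟩ : ∃ b : ℝ, 0 < b ∧ ∀ ρ ∈ zeros ψ, |ρ.im| ≤ 2 → b ≤ ρ.re := by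
    have hfin := finite_zeros_im_le ψ 2
    rcases Set.eq_empty_or_nonempty {ρ : ℂ | ρ ∈ zeros ψ ∧ |ρ.im| ≤ 2} with h | h
    · exact ⟨1, one_pos, fun ρ h1 h2 =>
        absurd (show ρ ∈ {ρ : ℂ | ρ ∈ zeros ψ ∧ |ρ.im| ≤ 2} from ⟨h1, h2⟩) (by simp [h])⟩
    · obtain ⟨ρ₀, h0, hmin⟩ := Set.exists_min_image _ Complex.re hfin h
      exact ⟨ρ₀.re, h0.1.1, fun ρ h1 h2 => hmin ρ ⟨h1, h2⟩⟩
  refine ⟨min b c, lt_min hb hc, fun ρ hρ => ?_⟩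
  have hp1 : (1 + |ρ.im|) ^ (-(1 / 4) : ℝ) ≤ 1 :=
    Real.rpow_le_one_of_one_le_of_nonpos (by linarith [abs_nonneg ρ.im]) (by norm_num)
  have hp0 : 0 < (1 + |ρ.im|) ^ (-(1 / 4) : ℝ) := by positivity
  rcases le_or_gt |ρ.im| 2 with h | h
  · have := hbz ρ hρ h
    have h2 : min b c ≤ b := min_le_left _ _
    nlinarith
  · have h1 := hz (1 - ρ) (LFunction_primitive_inv_one_sub_eq_zero ψ hρ) (by simpa using h.le)
    simp only [Complex.sub_re, Complex.one_re, Complex.sub_im, Complex.one_im, zero_sub,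
      abs_neg] at h1
    have h2 : (1 + |ρ.im|) ^ (-(1 / 4) : ℝ) ≤ |ρ.im| ^ (-(1 / 4) : ℝ) :=
      Real.rpow_le_rpow_of_nonpos (by linarith) (by linarith) (by norm_num)
    have h3 : min b c ≤ c := min_le_right _ _
    nlinarith

end ZeroFree

end SingularSeries

namespace SingularSeries

/-! ### Lower bounds for `L` and the number of zeros -/

section LowerBound

variable {m : ℕ} [NeZero m] (ψ : DirichletCharacter ℂ m)

lemma norm_LFunction_ge {s : ℂ} (hs : 2 ≤ s.re) : 1 / 3 ≤ ‖ψ.LFunction s‖ := by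
  rw [DirichletCharacter.LFunction_eq_LSeries _ (by linarith)]
  have h := norm_LSeries_sub_one_le ψ hs
  have h2 := norm_sub_norm_le (1 : ℂ) (LSeries (fun n : ℕ => ψ n) s)
  rw [norm_sub_rev, norm_one] at h2
  linarith

/-- Scaled by a power of `|t|`, the function `L` satisfies on a disc around `2 + it` the
hypotheses of `norm_ge_of_dist_zeros` with `n` of order `log |t|`. -/
lemma exists_scaled_LFunction : ∃ A : ℝ, 0 < A ∧ ∀ t : ℝ, 4 ≤ |t| → ∃ (n : ℕ) (M : ℝ),
    (n : ℝ) ≤ A * Real.log |t| ∧ 1 ≤ M ∧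
    (∀ z ∈ Metric.closedBall (0 : ℂ) (5 / 2),
      AnalyticAt ℂ (fun z => ψ.LFunction (2 + t * Complex.I + z) / M) z) ∧
    (∀ z ∈ Metric.closedBall (0 : ℂ) (5 / 2), ‖ψ.LFunction (2 + t * Complex.I + z) / M‖ ≤ 1) ∧
    (9 / 10 : ℝ) ^ n ≤ ‖ψ.LFunction (2 + t * Complex.I + 0) / M‖ := by
  obtain ⟨C, hC, hb⟩ := exists_norm_LFunction_le ψ
  set l : ℝ := Real.log (10 / 9) with hl
  have hl0 : 0 < l := Real.log_pos (by norm_num)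
  set B : ℝ := 375 * (C + 1) with hB
  have hB1 : 1 ≤ B := by linarith
  have hlB : 0 ≤ Real.log (3 * B) := Real.log_nonneg (by linarith)
  refine ⟨(Real.log (3 * B) + 3) / l + 1, by positivity, fun t ht => ?_⟩
  have hlog1 : 1 ≤ Real.log |t| := by
    rw [Real.le_log_iff_exp_le (by linarith)]
    linarith [Real.exp_one_lt_d9]
  set M : ℝ := B * |t| ^ 3 with hM
  have ht3 : 1 ≤ |t| ^ 3 := one_le_pow₀ (by linarith)
  have hM1 : 1 ≤ M := one_le_mul_of_one_le_of_one_le hB1 ht3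
  have hgeom : ∀ z ∈ Metric.closedBall (0 : ℂ) (5 / 2),
      -(1 / 2) ≤ (2 + t * Complex.I + z).re ∧ (2 + t * Complex.I + z).re ≤ 9 / 2 ∧
      |t| - 5 / 2 ≤ |(2 + t * Complex.I + z).im| ∧
      |(2 + t * Complex.I + z).im| ≤ |t| + 5 / 2 := by
    intro z hz
    have hz' := mem_closedBall_zero_iff.mp hz
    have hre := abs_le.mp ((Complex.abs_re_le_norm z).trans hz')
    have him := (Complex.abs_im_le_norm z).trans hz'
    have e1 : (2 + t * Complex.I + z).re = 2 + z.re := by simp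
    have e2 : (2 + t * Complex.I + z).im = t + z.im := by simp
    rw [e1, e2]
    refine ⟨by linarith [hre.1], by linarith [hre.2], ?_, ?_⟩
    · have := abs_sub_abs_le_abs_sub t (-z.im)
      rw [abs_neg, sub_neg_eq_add] at this
      linarith
    · exact (abs_add_le _ _).trans (by linarith)
  -- `n` is chosen with `(10/9) ^ n ≥ 3 M`, as `‖ψ.LFunction‖ ≥ 1/3` at the centre
  refine ⟨⌈Real.log (3 * M) / l⌉₊, M, ?_, hM1, fun z hz => ?_, fun z hz => ?_, ?_⟩
  · have h0 : 0 ≤ Real.log (3 * M) / l :=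
      div_nonneg (Real.log_nonneg (by linarith)) hl0.le
    refine (Nat.ceil_lt_add_one h0).le.trans ?_
    have e : Real.log (3 * M) = Real.log (3 * B) + 3 * Real.log |t| := by
      rw [hM, ← mul_assoc, Real.log_mul (by positivity) (by positivity), Real.log_pow]
      norm_num
    rw [e, add_mul, one_mul, div_mul_eq_mul_div]
    gcongr
    nlinarith
  · obtain ⟨-, -, h3, -⟩ := hgeom z hz
    have h1 : 2 + t * Complex.I + z ≠ 1 := by
      intro h; rw [h] at h3; simp at h3; linarith
    have hd : DifferentiableOn ℂ ψ.LFunction {1}ᶜ := fun s hs =>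
      (ψ.differentiableAt_LFunction s (Or.inl hs)).differentiableWithinAt
    have ha : AnalyticAt ℂ ψ.LFunction (2 + t * Complex.I + z) :=
      hd.analyticAt (isOpen_compl_singleton.mem_nhds h1)
    have ha2 : AnalyticAt ℂ (fun z => ψ.LFunction (2 + t * Complex.I + z)) z :=
      AnalyticAt.fun_comp (g := ψ.LFunction) (f := fun z => 2 + t * Complex.I + z) ha (by fun_prop)
    exact ha2.div_const
  · obtain ⟨h1, h2, h3, h4⟩ := hgeom z hz
    set s : ℂ := 2 + t * Complex.I + z
    have hs1 : 1 / 2 ≤ ‖s - 1‖ := by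
      have := Complex.abs_im_le_norm (s - 1)
      rw [Complex.sub_im, Complex.one_im, sub_zero] at this
      linarith
    have hsn : ‖s‖ ≤ 4 * |t| := by
      refine (Complex.norm_le_abs_re_add_abs_im s).trans ?_
      have : |s.re| ≤ 9 / 2 := abs_le.mpr ⟨by linarith, h2⟩
      linarith
    rw [norm_div, Complex.norm_real, Real.norm_of_nonneg (by linarith), div_le_one (by linarith)]
    refine (hb s (by linarith) hs1).trans ?_
    have h6 : 0 < 1 / (s.re + 1) := one_div_pos.mpr (by linarith)
    have h5 : 1 / (s.re + 1) ≤ 2 := by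
      rw [div_le_iff₀ (by linarith)]; linarith
    calc C * (1 + ‖s‖) ^ 3 * (1 + 1 / (s.re + 1)) ≤ (C + 1) * (5 * |t|) ^ 3 * (1 + 2) := by
          gcongr <;> linarith
      _ = M := by rw [hM, hB]; ring
  · rw [norm_div, Complex.norm_real, Real.norm_of_nonneg (by linarith), le_div_iff₀ (by linarith)]
    have h1 := norm_LFunction_ge ψ (s := 2 + t * Complex.I + 0) (by simp)
    refine le_trans ?_ h1
    have h2 : Real.log (3 * M) ≤ ⌈Real.log (3 * M) / l⌉₊ * l := by
      have := Nat.le_ceil (Real.log (3 * M) / l)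
      rwa [div_le_iff₀ hl0] at this
    have h3 : 3 * M ≤ (10 / 9 : ℝ) ^ ⌈Real.log (3 * M) / l⌉₊ := by
      rw [← Real.log_le_log_iff (by linarith) (by positivity), Real.log_pow]
      exact h2
    have h4 : (9 / 10 : ℝ) = (10 / 9)⁻¹ := by norm_num
    rw [h4, inv_pow, inv_mul_le_iff₀ (by positivity)]
    linarith

/-- There are `O(log |t|)` zeros with ordinate within `1` of `t`. -/
lemma exists_card_zeros_le : ∃ A : ℝ, 0 < A ∧ ∀ t : ℝ, 4 ≤ |t| → ∀ Z : Finset ℂ,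
    (∀ ρ ∈ Z, ρ ∈ zeros ψ ∧ |ρ.im - t| ≤ 1) → (Z.card : ℝ) ≤ A * Real.log |t| := by
  obtain ⟨A, hA, h⟩ := exists_scaled_LFunction ψ
  refine ⟨A, hA, fun t ht Z hZ => ?_⟩
  obtain ⟨n, M, hn, hM, ha, hb, h0⟩ := h t ht
  refine le_trans ?_ hn
  have := card_zeros_le n ha hb h0 (Z.map (Equiv.subRight (2 + t * Complex.I)).toEmbedding) ?_
  · rw [Finset.card_map] at this
    exact_mod_cast this
  · intro a haZ
    obtain ⟨ρ, hρ, rfl⟩ := Finset.mem_map.mp haZ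
    obtain ⟨h1, h2⟩ := hZ ρ hρ
    have hre := re_lt_one_of_mem_zeros ψ h1
    have h2' := abs_le.mp h2
    constructor
    · have e1 : (ρ - (2 + t * Complex.I)).re = ρ.re - 2 := by simp
      have e2 : (ρ - (2 + t * Complex.I)).im = ρ.im - t := by simp
      refine lt_of_pow_lt_pow_left₀ 2 (by norm_num) ?_
      change ‖ρ - (2 + t * Complex.I)‖ ^ 2 < _
      rw [Complex.sq_norm, Complex.normSq_apply, e1, e2]
      nlinarith [h1.1]
    · simp [h1.2.2]

/-- Away from its zeros, `L` is at least `exp (-A log |t| (1 + log (1/η)))`. -/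
lemma exists_norm_LFunction_ge : ∃ A : ℝ, 0 < A ∧ ∀ (w : ℂ) (η : ℝ), 4 ≤ |w.im| → 0 < η → η ≤ 1 →
    η ≤ w.re → (∀ ρ ∈ zeros ψ, η ≤ ‖w - ρ‖) →
    Real.exp (-(A * Real.log |w.im| * (1 + Real.log (1 / η)))) ≤ ‖ψ.LFunction w‖ := by
  obtain ⟨A, hA, h⟩ := exists_scaled_LFunction ψ
  refine ⟨4 * A + 4, by positivity, fun w η hw hη hη1 hηw hd => ?_⟩
  have hlog1 : 1 ≤ Real.log |w.im| := by
    rw [Real.le_log_iff_exp_le (by linarith)]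
    linarith [Real.exp_one_lt_d9]
  have hlη : 0 ≤ Real.log (1 / η) := Real.log_nonneg (by rw [le_div_iff₀ hη]; linarith)
  set L := Real.log |w.im|
  set ℓ := Real.log (1 / η) with hℓ
  rcases le_total 2 w.re with h2 | h2
  · refine le_trans ?_ (norm_LFunction_ge ψ h2)
    rw [← Real.le_log_iff_exp_le (by norm_num), one_div, Real.log_inv, neg_le_neg_iff]
    have : Real.log 3 ≤ 2 := by
      rw [Real.log_le_iff_le_exp (by norm_num)]
      linarith [Real.add_one_le_exp (2 : ℝ)]
    nlinarith [mul_nonneg hA.le hlη]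
  obtain ⟨n, M, hn, hM, ha, hb, h0⟩ := h w.im hw
  have hwz : ‖w - (2 + w.im * Complex.I)‖ ≤ 2 := by
    have : w - (2 + w.im * Complex.I) = ((w.re - 2 : ℝ) : ℂ) := by
      apply Complex.ext <;> simp
    rw [this, Complex.norm_real, Real.norm_eq_abs, abs_le]
    constructor <;> linarith
  have key := norm_ge_of_dist_zeros n ha hb h0 hwz hη hη1 ?_
  · have e : (2 : ℂ) + w.im * Complex.I + (w - (2 + w.im * Complex.I)) = w := by ring
    simp only [e] at key
    have h3 : ‖ψ.LFunction w / M‖ ≤ ‖ψ.LFunction w‖ := by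
      rw [norm_div, Complex.norm_real, Real.norm_of_nonneg (by linarith)]
      exact div_le_self (norm_nonneg _) hM
    refine le_trans ?_ (key.trans h3)
    rw [← Real.le_log_iff_exp_le (by positivity), Real.log_mul (by positivity) (by positivity),
      Real.log_pow, Real.log_pow, Real.log_div hη.ne' (by norm_num)]
    have e1 : Real.log η = -ℓ := by rw [hℓ, one_div, Real.log_inv, neg_neg]
    have e2 : Real.log 5 ≤ 2 := by
      rw [Real.log_le_iff_le_exp (by norm_num), show (2 : ℝ) = 1 + 1 by norm_num, Real.exp_add]
      nlinarith [Real.exp_one_gt_d9]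
    have e3 : -(1 / 9) ≤ Real.log (9 / 10) := by
      have := Real.one_sub_inv_le_log_of_pos (show (0 : ℝ) < 9 / 10 by norm_num)
      norm_num at this ⊢
      linarith
    rw [e1]
    push_cast
    have hn0 : (0 : ℝ) ≤ n := n.cast_nonneg
    have i1 : (n : ℝ) * (ℓ + 4) ≤ A * L * (ℓ + 4) := by gcongr
    have i2 : (n : ℝ) * Real.log 5 ≤ n * 2 := by gcongr
    have i3 : (17 * ((n : ℝ) + 1)) * -(1 / 9) ≤ (17 * ((n : ℝ) + 1)) * Real.log (9 / 10) := by
      gcongr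
    have i4 : 0 ≤ A * L * ℓ := by positivity
    have i5 : 0 ≤ L * ℓ := by positivity
    nlinarith
  · intro a ha1 ha2
    set ρ : ℂ := 2 + w.im * Complex.I + a with hρ
    have e : w - (2 + w.im * Complex.I) - a = w - ρ := by rw [hρ]; ring
    rw [e]
    have hL0 : ψ.LFunction ρ = 0 := by
      have hMC : (M : ℂ) ≠ 0 := by exact_mod_cast (by linarith : M ≠ 0)
      exact (div_eq_zero_iff.mp ha2).resolve_right hMC
    -- zeros with `Re ρ ≤ 0` are far from `w` because `Re w ≥ η`
    rcases lt_or_ge 0 ρ.re with hr | hr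
    · refine hd ρ ⟨hr, ?_, hL0⟩
      intro h1
      have : a.im = -w.im := by
        have := congrArg Complex.im h1
        simp [hρ] at this
        linarith
      have h5 := Complex.abs_im_le_norm a
      rw [this, abs_neg] at h5
      linarith
    · have := Complex.re_le_norm (w - ρ)
      rw [Complex.sub_re] at this
      linarith

/-- The `O(log T)` zeros near height `T` cannot exclude an interval of length `1`. -/
lemma exists_admissible_height : ∃ N : ℝ, 4 ≤ N ∧ ∀ x : ℝ, N ≤ x → ∃ T ∈ Set.Icc x (x + 1),
    ∀ ρ ∈ zeros ψ, 1 / T ≤ |(|ρ.im| - T)| := by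
  obtain ⟨A, hA, hcard⟩ := exists_card_zeros_le ψ
  have hlo : ∀ᶠ x : ℝ in atTop, Real.log (x + 1) ≤ 1 / (16 * A) * x := by
    have h1 := (Real.isLittleO_log_id_atTop.comp_tendsto
      (tendsto_atTop_add_const_right atTop (1 : ℝ) tendsto_id)).bound
      (show 0 < 1 / (32 * A) by positivity)
    filter_upwards [h1, eventually_ge_atTop 1] with x hx hx1
    simp only [Function.comp_apply, id] at hx
    have h2 := (le_abs_self _).trans hx
    rw [Real.norm_of_nonneg (by linarith)] at h2
    refine h2.trans ?_
    have : 1 / (16 * A) * x = 1 / (32 * A) * (2 * x) := by field_simp; norm_num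
    rw [this]
    gcongr
    linarith
  obtain ⟨N, hN⟩ := eventually_atTop.mp hlo
  refine ⟨max N 5, by linarith [le_max_right N 5], fun x hx => ?_⟩
  have hx5 : 5 ≤ x := (le_max_right _ _).trans hx
  have hxN := hN x ((le_max_left _ _).trans hx)
  set Z := (finite_zeros_im_le ψ (x + 2)).toFinset.filter (fun ρ => x - 1 ≤ |ρ.im|) with hZ
  have hZmem : ∀ ρ, ρ ∈ Z ↔ (ρ ∈ zeros ψ ∧ |ρ.im| ≤ x + 2) ∧ x - 1 ≤ |ρ.im| := by
    intro ρ; simp [hZ]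
  have hsub : ∀ t : ℝ, |t| = x ∨ |t| = x + 1 →
      ((Z.filter fun ρ => |ρ.im - t| ≤ 1).card : ℝ) ≤ A * Real.log (x + 1) := by
    intro t ht
    have ht4 : 4 ≤ |t| := by rcases ht with h | h <;> linarith
    refine (hcard t ht4 _ fun ρ hρ => ?_).trans ?_
    · rw [Finset.mem_filter, hZmem] at hρ
      exact ⟨hρ.1.1.1, hρ.2⟩
    · gcongr
      rcases ht with h | h <;> linarith
  -- four windows, around `± x` and `± (x + 1)`, contain all relevant ordinates
  have hZcard : (Z.card : ℝ) ≤ 4 * (A * Real.log (x + 1)) := by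
    have hcov : Z ⊆ ((Z.filter fun ρ => |ρ.im - x| ≤ 1) ∪ Z.filter fun ρ => |ρ.im - (x + 1)| ≤ 1) ∪
        ((Z.filter fun ρ => |ρ.im - -x| ≤ 1) ∪ Z.filter fun ρ => |ρ.im - -(x + 1)| ≤ 1) := by
      intro ρ hρ
      have h1 := (hZmem ρ).mp hρ
      simp only [Finset.mem_union, Finset.mem_filter, hρ, true_and]
      simp only [abs_le]
      rcases abs_cases ρ.im with h | h <;> rw [h.1] at h1
      · rcases le_total ρ.im (x + 1) with h2 | h2
        · exact Or.inl (Or.inl ⟨by linarith, by linarith⟩)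
        · exact Or.inl (Or.inr ⟨by linarith, by linarith⟩)
      · rcases le_total (-ρ.im) (x + 1) with h2 | h2
        · exact Or.inr (Or.inl ⟨by linarith, by linarith⟩)
        · exact Or.inr (Or.inr ⟨by linarith, by linarith⟩)
    have h1 := Finset.card_le_card hcov
    have h2 := h1.trans ((Finset.card_union_le _ _).trans
      (add_le_add (Finset.card_union_le _ _) (Finset.card_union_le _ _)))
    have h3 := (Nat.cast_le (α := ℝ)).mpr h2
    push_cast at h3
    have a1 := hsub x (Or.inl (abs_of_nonneg (by linarith)))
    have a2 := hsub (x + 1) (Or.inr (abs_of_nonneg (by linarith)))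
    have a3 := hsub (-x) (Or.inl (by rw [abs_neg, abs_of_nonneg (by linarith)]))
    have a4 := hsub (-(x + 1)) (Or.inr (by rw [abs_neg, abs_of_nonneg (by linarith)]))
    linarith
  -- the intervals excluded by the zeros have total length less than `1`
  have hex : ∃ T ∈ Set.Icc x (x + 1), T ∉ ⋃ ρ ∈ Z, Metric.ball |ρ.im| (1 / x) := by
    by_contra hcon
    push Not at hcon
    have h1 : MeasureTheory.volume (Set.Icc x (x + 1)) ≤
        ∑ ρ ∈ Z, MeasureTheory.volume (Metric.ball |ρ.im| (1 / x)) :=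
      (MeasureTheory.measure_mono hcon).trans (MeasureTheory.measure_biUnion_finset_le _ _)
    simp only [Real.volume_Icc, Real.volume_ball, Finset.sum_const, nsmul_eq_mul] at h1
    rw [show x + 1 - x = 1 by ring, ← ENNReal.ofReal_natCast,
      ← ENNReal.ofReal_mul (Nat.cast_nonneg _), ENNReal.ofReal_le_ofReal_iff (by positivity)] at h1
    have h2 : (Z.card : ℝ) * (2 * (1 / x)) ≤ 4 * (A * (1 / (16 * A) * x)) * (2 * (1 / x)) := by
      gcongr
      refine hZcard.trans ?_
      gcongr
    have h3 : 4 * (A * (1 / (16 * A) * x)) * (2 * (1 / x)) = 1 / 2 := by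
      field_simp; norm_num
    linarith
  obtain ⟨T, hT, hTn⟩ := hex
  refine ⟨T, hT, fun ρ hρ => ?_⟩
  by_contra hlt
  push Not at hlt
  have hT1 : 1 / T ≤ 1 / x := one_div_le_one_div_of_le (by linarith) hT.1
  have hx1 : 1 / x ≤ 1 := by rw [div_le_one (by linarith)]; linarith
  have habs := abs_lt.mp (hlt.trans_le hT1)
  refine hTn ?_
  simp only [Set.mem_iUnion]
  refine ⟨ρ, (hZmem ρ).mpr ⟨⟨hρ, by linarith [hT.2]⟩, by linarith [hT.1]⟩, ?_⟩
  rw [Metric.mem_ball, dist_comm, Real.dist_eq]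
  exact hlt.trans_le hT1

lemma heights_neBot : (heights ψ).NeBot := by
  obtain ⟨N, hN, h⟩ := exists_admissible_height ψ
  rw [heights, ← frequently_mem_iff_neBot, frequently_atTop]
  intro a
  obtain ⟨T, hT, hT2⟩ := h (max a N) (le_max_right _ _)
  exact ⟨T, (le_max_left _ _).trans hT.1, hT2⟩

end LowerBound

end SingularSeries

namespace SingularSeries

/-! ### Products over primes and the analytic properties of `F` -/

section Products

lemma norm_tprod_one_add_le {ι : Type*} {f : ι → ℂ} (hf : Summable fun i => ‖f i‖) :
    ‖∏' i, (1 + f i)‖ ≤ Real.exp (∑' i, ‖f i‖) := by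
  have h := (multipliable_one_add_of_summable hf).hasProd.norm
  refine le_of_tendsto' h fun S => ?_
  simp only
  calc ∏ i ∈ S, ‖1 + f i‖ ≤ ∏ i ∈ S, Real.exp ‖f i‖ := by
        refine Finset.prod_le_prod (fun _ _ => norm_nonneg _) fun i _ => ?_
        refine (norm_add_le _ _).trans ?_
        rw [norm_one, add_comm]
        exact Real.add_one_le_exp _
    _ = Real.exp (∑ i ∈ S, ‖f i‖) := (Real.exp_sum _ _).symm
    _ ≤ _ := Real.exp_le_exp.mpr (hf.sum_le_tsum _ fun _ _ => norm_nonneg _)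

lemma hasProdLocallyUniformlyOn_one_add_of_nhds {ι : Type*} {U : Set ℂ} {f : ι → ℂ → ℂ}
    (hd : ∀ i, DifferentiableOn ℂ (f i) U)
    (hb : ∀ z ∈ U, ∃ V : Set ℂ, IsOpen V ∧ z ∈ V ∧ V ⊆ U ∧ ∃ u : ι → ℝ, Summable u ∧
      ∀ i, ∀ w ∈ V, ‖f i w‖ ≤ u i) :
    HasProdLocallyUniformlyOn (fun i s => 1 + f i s) (fun s => ∏' i, (1 + f i s)) U := by
  refine hasProdLocallyUniformlyOn_of_of_forall_exists_nhds fun z hz => ?_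
  obtain ⟨V, hV, hzV, hVU, u, hu, h⟩ := hb z hz
  obtain ⟨K, hK, hzK, hKV⟩ := exists_compact_subset hV hzV
  refine ⟨K, mem_nhdsWithin_of_mem_nhds (mem_interior_iff_mem_nhds.mp hzK), ?_⟩
  exact hu.hasProdUniformlyOn_one_add hK (Eventually.of_forall fun i w hw => h i w (hKV hw))
    fun i => ((hd i).mono (hKV.trans hVU)).continuousOn

lemma differentiableOn_tprod_one_add {ι : Type*} {U : Set ℂ} (hU : IsOpen U) {f : ι → ℂ → ℂ}
    (hd : ∀ i, DifferentiableOn ℂ (f i) U)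
    (hb : ∀ z ∈ U, ∃ V : Set ℂ, IsOpen V ∧ z ∈ V ∧ V ⊆ U ∧ ∃ u : ι → ℝ, Summable u ∧
      ∀ i, ∀ w ∈ V, ‖f i w‖ ≤ u i) :
    DifferentiableOn ℂ (fun s => ∏' i, (1 + f i s)) U := by
  have h := hasProdLocallyUniformlyOn_iff_tendstoLocallyUniformlyOn.mp
    (hasProdLocallyUniformlyOn_one_add_of_nhds hd hb)
  refine h.differentiableOn (Eventually.of_forall fun S => ?_) hU
  exact DifferentiableOn.fun_finsetProd fun i _ => (hd i).const_add 1

lemma hasProd_primeFactors {q : ℕ} (hq : q ≠ 0) (c : ℕ → ℂ) :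
    HasProd (fun p : Nat.Primes => if (p : ℕ) ∣ q then c p else 1) (∏ p ∈ q.primeFactors, c p) := by
  have h1 : HasProd (fun n : ℕ => if n ∈ q.primeFactors then c n else 1)
      (∏ p ∈ q.primeFactors, c p) := by
    have := hasProd_prod_of_ne_finset_one (L := .unconditional _)
      (f := fun n : ℕ => if n ∈ q.primeFactors then c n else 1)
      (s := q.primeFactors) (fun n hn => if_neg hn)
    rwa [Finset.prod_congr rfl fun n hn => if_pos hn] at this
  have hsub : Function.mulSupport (fun n : ℕ => if n ∈ q.primeFactors then c n else 1) ⊆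
      {p : ℕ | p.Prime} := fun n hn => by
    by_contra hp
    exact hn (if_neg fun h => hp (Nat.prime_of_mem_primeFactors h))
  have h2 := (hasProd_subtype_iff_of_mulSupport_subset hsub).mpr h1
  refine h2.congr_fun fun p => ?_
  have hp : (p : ℕ).Prime := p.2
  simp [hp, hq]

lemma one_sub_rpow_neg_ge {p : ℕ} (hp : p.Prime) {δ : ℝ} (hδ : 0 < δ) :
    min δ 1 / 3 ≤ 1 - (p : ℝ) ^ (-δ) := by
  have hp2 : (2 : ℝ) ≤ p := by exact_mod_cast hp.two_le
  have h1 : 1 + δ / 2 ≤ (p : ℝ) ^ δ := by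
    have h2 : (2 : ℝ) ^ δ ≤ (p : ℝ) ^ δ := Real.rpow_le_rpow (by norm_num) hp2 hδ.le
    have h3 : δ * Real.log 2 + 1 ≤ (2 : ℝ) ^ δ := by
      rw [Real.rpow_def_of_pos (by norm_num), mul_comm]
      exact Real.add_one_le_exp _
    nlinarith [Real.log_two_gt_d9]
  have h4 : (p : ℝ) ^ (-δ) ≤ (1 + δ / 2)⁻¹ := by
    rw [Real.rpow_neg (by positivity)]
    exact inv_anti₀ (by positivity) h1
  have h5 : min δ 1 / 3 ≤ 1 - (1 + δ / 2)⁻¹ := by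
    have e : 1 - (1 + δ / 2)⁻¹ = δ / (2 + δ) := by field_simp; ring
    rw [e, div_le_div_iff₀ (by norm_num) (by linarith)]
    rcases le_total δ 1 with h | h
    · rw [min_eq_left h]; nlinarith
    · rw [min_eq_right h]; nlinarith
  linarith

lemma primes_tsum_rpow_le {δ : ℝ} (hδ : 0 < δ) :
    Summable (fun p : Nat.Primes => ((p : ℕ) : ℝ) ^ (-(1 + δ))) ∧
      ∑' p : Nat.Primes, ((p : ℕ) : ℝ) ^ (-(1 + δ)) ≤ 1 + 1 / δ := by
  have hinj : Function.Injective (fun p : Nat.Primes => (p : ℕ) - 1) := by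
    intro a b h
    have ha := a.2.one_lt
    have hb := b.2.one_lt
    simp only at h
    exact Subtype.ext (by lia)
  have e : ∀ p : Nat.Primes, ((p : ℕ) : ℝ) ^ (-(1 + δ)) =
      ((((p : ℕ) - 1 : ℕ) : ℝ) + 1) ^ (-(1 + δ)) := by
    intro p
    rw [Nat.cast_sub p.2.one_lt.le]
    simp
  have hs := summable_rpow_succ hδ
  simp_rw [e]
  refine ⟨hs.comp_injective hinj, le_trans ?_ (tsum_rpow_succ_le hδ)⟩
  exact tsum_comp_le_tsum_of_inj hs (fun n => by positivity) hinj

end Products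

section PrimeProduct

variable (q : ℕ) {m : ℕ} [NeZero m] (χ : DirichletCharacter ℂ m)

/-- The deviation from `1` of the local factor of `F` at `p`, for `p ∤ q`. -/
noncomputable def localTerm (p : ℕ) (s : ℂ) : ℂ :=
  if p ∣ q then 0
  else -(1 / ((p : ℂ) - 1) ^ 2) + 2 * (p : ℂ) * χ (p : ZMod m) /
    (((p : ℂ) - 1) ^ 2 * ((p : ℂ) ^ (s + 1) + χ (p : ZMod m)))

/-- The product over `p ∤ q` in the definition of `F`. -/
noncomputable def primeProduct (s : ℂ) : ℂ := ∏' p : Nat.Primes, (1 + localTerm q χ p s)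

/-- The product over `p ∣ q` in the definition of `F`. -/
noncomputable def badProduct (s : ℂ) : ℂ :=
  ∏ p ∈ q.primeFactors, (1 + χ (p : ZMod m) / (p : ℂ) ^ (s + 1))⁻¹

lemma F_eq (s : ℂ) : F q χ s = χ.LFunction s * χ.LFunction (s + 1) / (χ ^ 2).LFunction (2 * s + 2) *
    badProduct q χ s * primeProduct q χ s := by
  rw [F, badProduct, primeProduct]
  congr 1
  refine tprod_congr fun p => ?_
  rw [localTerm]
  split_ifs
  · simp
  · ring

variable {q χ}

lemma norm_natCast_cpow {p : ℕ} (hp : p.Prime) (s : ℂ) : ‖(p : ℂ) ^ s‖ = (p : ℝ) ^ s.re :=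
  Complex.norm_natCast_cpow_of_pos hp.pos s

omit [NeZero m] in
lemma norm_cpow_add_ge {p : ℕ} (hp : p.Prime) {s : ℂ} (hs : -1 < s.re) :
    min (s.re + 1) 1 / 3 * (p : ℝ) ^ (s.re + 1) ≤ ‖(p : ℂ) ^ (s + 1) + χ (p : ZMod m)‖ := by
  have hp0 : (0 : ℝ) < p := by exact_mod_cast hp.pos
  have h1 := norm_sub_le_norm_add ((p : ℂ) ^ (s + 1)) (χ (p : ZMod m))
  rw [norm_natCast_cpow hp, Complex.add_re, Complex.one_re] at h1
  have h2 := χ.norm_le_one (p : ZMod m)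
  have h3 := one_sub_rpow_neg_ge hp (show 0 < s.re + 1 by linarith)
  have h4 : (1 - (p : ℝ) ^ (-(s.re + 1))) * (p : ℝ) ^ (s.re + 1) = (p : ℝ) ^ (s.re + 1) - 1 := by
    rw [sub_mul, ← Real.rpow_add hp0, neg_add_cancel, Real.rpow_zero, one_mul]
  have h5 : min (s.re + 1) 1 / 3 * (p : ℝ) ^ (s.re + 1) ≤
      (1 - (p : ℝ) ^ (-(s.re + 1))) * (p : ℝ) ^ (s.re + 1) := by gcongr
  linarith

omit [NeZero m] in
lemma cpow_add_ne_zero {p : ℕ} (hp : p.Prime) {s : ℂ} (hs : -1 < s.re) :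
    (p : ℂ) ^ (s + 1) + χ (p : ZMod m) ≠ 0 := by
  have hp0 : (0 : ℝ) < p := by exact_mod_cast hp.pos
  have h : 0 < min (s.re + 1) 1 := lt_min (by linarith) one_pos
  have h2 := norm_cpow_add_ge (χ := χ) hp hs
  exact norm_pos_iff.mp (lt_of_lt_of_le (by positivity) h2)

omit [NeZero m] in
/-- The weaker exponent `1 + δ`, with a constant of order `1/δ`, reflects the approach to the
boundary `Re s = -1` of the domain. -/
lemma norm_localTerm_le {p : ℕ} (hp : p.Prime) {s : ℂ} {δ : ℝ} (hδ : 0 < δ) (hs : δ ≤ s.re + 1) :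
    ‖localTerm q χ p s‖ ≤
      4 * (p : ℝ) ^ (-(1 + 1) : ℝ) + 24 / min δ 1 * (p : ℝ) ^ (-(1 + δ)) := by
  have hp2 : (2 : ℝ) ≤ p := by exact_mod_cast hp.two_le
  have hp0 : (0 : ℝ) < p := by linarith
  have hm : 0 < min δ 1 := lt_min hδ one_pos
  rw [localTerm]
  split_ifs
  · rw [norm_zero]; positivity
  have hn : ‖(p : ℂ) - 1‖ = p - 1 := by
    rw [show (p : ℂ) - 1 = ((p - 1 : ℝ) : ℂ) by push_cast; rfl, Complex.norm_real,
      Real.norm_of_nonneg (by linarith)]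
  have hsq : (p : ℝ) ^ 2 / 4 ≤ (p - 1) ^ 2 := by nlinarith
  have hden : min δ 1 / 3 * (p : ℝ) ^ δ ≤ ‖(p : ℂ) ^ (s + 1) + χ (p : ZMod m)‖ := by
    refine le_trans ?_ (norm_cpow_add_ge (χ := χ) hp (s := s) (by linarith))
    have : 0 < min (s.re + 1) 1 := lt_min (by linarith) one_pos
    gcongr
    linarith
  refine (norm_add_le _ _).trans ?_
  rw [norm_neg, norm_div, norm_div, norm_mul, norm_mul, norm_mul, norm_pow, hn, norm_one,
    Complex.norm_natCast]
  have e2 : (p : ℝ) ^ (-(1 + 1) : ℝ) = 1 / (p : ℝ) ^ 2 := by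
    rw [Real.rpow_neg hp0.le, one_div]
    norm_num
  have e3 : (p : ℝ) ^ (-(1 + δ)) = 1 / (p * (p : ℝ) ^ δ) := by
    rw [Real.rpow_neg hp0.le, Real.rpow_add hp0, Real.rpow_one, one_div]
  rw [e2, e3]
  have hpδ : 0 < (p : ℝ) ^ δ := by positivity
  refine add_le_add ?_ ?_
  · calc 1 / ((p : ℝ) - 1) ^ 2 ≤ 1 / ((p : ℝ) ^ 2 / 4) := by gcongr
      _ = 4 * (1 / (p : ℝ) ^ 2) := by field_simp
  · calc ‖(2 : ℂ)‖ * p * ‖χ (p : ZMod m)‖ /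
          (((p : ℝ) - 1) ^ 2 * ‖(p : ℂ) ^ (s + 1) + χ (p : ZMod m)‖)
        ≤ 2 * p * 1 / ((p : ℝ) ^ 2 / 4 * (min δ 1 / 3 * (p : ℝ) ^ δ)) := by
          gcongr
          · simp
          · exact χ.norm_le_one _
      _ = 24 / min δ 1 * (1 / (p * (p : ℝ) ^ δ)) := by field_simp; norm_num

lemma summable_localTerm_bound {δ : ℝ} (hδ : 0 < δ) :
    Summable (fun p : Nat.Primes => 4 * ((p : ℕ) : ℝ) ^ (-(1 + 1) : ℝ) +
      24 / min δ 1 * ((p : ℕ) : ℝ) ^ (-(1 + δ))) :=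
  ((primes_tsum_rpow_le one_pos).1.mul_left 4).add ((primes_tsum_rpow_le hδ).1.mul_left _)

omit [NeZero m] in
lemma differentiableAt_localTerm {p : ℕ} (hp : p.Prime) {s : ℂ} (hs : -1 < s.re) :
    DifferentiableAt ℂ (localTerm q χ p) s := by
  unfold localTerm
  split_ifs with h
  · exact differentiableAt_const _
  · have hp1 : (p : ℂ) - 1 ≠ 0 := sub_ne_zero.mpr (by exact_mod_cast hp.one_lt.ne')
    have h1 : Differentiable ℂ fun s : ℂ => (p : ℂ) ^ (s + 1) :=
      differentiable_natCast_cpow hp.ne_zero (by fun_prop)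
    refine (differentiableAt_const _).add (DifferentiableAt.div (differentiableAt_const _)
      ((differentiableAt_const _).mul ((h1 s).add (differentiableAt_const _))) ?_)
    exact mul_ne_zero (pow_ne_zero _ hp1) (cpow_add_ne_zero hp hs)

lemma isOpen_re_gt (a : ℝ) : IsOpen {s : ℂ | a < s.re} :=
  isOpen_lt continuous_const Complex.continuous_re

variable (q χ)

omit [NeZero m] in
lemma differentiableOn_primeProduct :
    DifferentiableOn ℂ (primeProduct q χ) {s : ℂ | -1 < s.re} := by
  refine differentiableOn_tprod_one_add (isOpen_re_gt _)
    (fun p s hs => (differentiableAt_localTerm p.2 hs).differentiableWithinAt) fun z hz => ?_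
  have hz' : -1 < z.re := hz
  have hδ : 0 < (z.re + 1) / 2 := by linarith
  refine ⟨{s | (z.re - 1) / 2 < s.re}, isOpen_re_gt _, ?_, fun s hs => ?_, _,
    summable_localTerm_bound hδ, fun p w hw => norm_localTerm_le p.2 hδ ?_⟩
  · rw [Set.mem_ofPred_eq]; linarith
  · rw [Set.mem_ofPred_eq] at hs ⊢; linarith
  · rw [Set.mem_ofPred_eq] at hw; linarith

omit [NeZero m] in
lemma norm_primeProduct_le {s : ℂ} {δ : ℝ} (hδ : 0 < δ) (hδ1 : δ ≤ 1) (hs : δ ≤ s.re + 1) :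
    ‖primeProduct q χ s‖ ≤ Real.exp (56 / δ ^ 2) := by
  have hb := fun p : Nat.Primes => norm_localTerm_le (q := q) (χ := χ) p.2 hδ hs
  have hS := summable_localTerm_bound hδ
  have hS2 := Summable.of_nonneg_of_le (fun p : Nat.Primes => norm_nonneg _) hb hS
  refine (norm_tprod_one_add_le hS2).trans (Real.exp_le_exp.mpr ?_)
  refine (hS2.tsum_le_tsum hb hS).trans ?_
  have h1 := primes_tsum_rpow_le one_pos
  have h2 := primes_tsum_rpow_le hδ
  rw [(h1.1.mul_left 4).tsum_add (h2.1.mul_left _), tsum_mul_left, tsum_mul_left, min_eq_left hδ1]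
  have h3 : 1 ≤ 1 / δ := by rw [le_div_iff₀ hδ]; linarith
  calc _ ≤ 4 * (1 + 1 / 1) + 24 / δ * (1 + 1 / δ) := by
        gcongr
        · exact h1.2
        · exact h2.2
    _ ≤ 4 * (1 / δ * (1 / δ) + 1 / δ * (1 / δ)) + 24 / δ * (1 / δ + 1 / δ) := by
        have := mul_le_mul h3 h3 zero_le_one (zero_le_one.trans h3)
        gcongr <;> linarith
    _ = 56 / δ ^ 2 := by field_simp; norm_num

omit [NeZero m] in
lemma differentiableOn_badProduct : DifferentiableOn ℂ (badProduct q χ) {s : ℂ | -1 < s.re} := by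
  intro s hs
  refine DifferentiableAt.differentiableWithinAt ?_
  refine DifferentiableAt.fun_finsetProd fun p hp => ?_
  have hp' := Nat.prime_of_mem_primeFactors hp
  have h1 : Differentiable ℂ fun s : ℂ => (p : ℂ) ^ (s + 1) :=
    differentiable_natCast_cpow hp'.ne_zero (by fun_prop)
  have h0 : (p : ℂ) ^ (s + 1) ≠ 0 := by
    simp [Complex.cpow_eq_zero_iff, hp'.ne_zero]
  refine DifferentiableAt.inv (((differentiableAt_const _).div (h1 s) h0).const_add _) ?_
  have := cpow_add_ne_zero (χ := χ) hp' hs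
  rw [one_add_div h0]
  exact div_ne_zero this h0

omit [NeZero m] in
lemma norm_badProduct_le {s : ℂ} {δ : ℝ} (hδ : 0 < δ) (hδ1 : δ ≤ 1) (hs : δ ≤ s.re + 1) :
    ‖badProduct q χ s‖ ≤ (3 / δ) ^ q.primeFactors.card := by
  rw [badProduct, norm_prod]
  rw [← Finset.prod_const]
  refine Finset.prod_le_prod (fun _ _ => norm_nonneg _) fun p hp => ?_
  have hp' := Nat.prime_of_mem_primeFactors hp
  have hp0 : (0 : ℝ) < p := by exact_mod_cast hp'.pos
  have h0 : (p : ℂ) ^ (s + 1) ≠ 0 := by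
    simp [Complex.cpow_eq_zero_iff, hp'.ne_zero]
  have h1 := norm_cpow_add_ge (χ := χ) hp' (s := s) (by linarith)
  have h2 : δ ≤ min (s.re + 1) 1 := le_min hs hδ1
  rw [one_add_div h0, inv_div, norm_div, norm_natCast_cpow hp', Complex.add_re, Complex.one_re]
  have hpp : 0 < (p : ℝ) ^ (s.re + 1) := by positivity
  calc _ ≤ (p : ℝ) ^ (s.re + 1) / (δ / 3 * (p : ℝ) ^ (s.re + 1)) := by
        gcongr
        refine le_trans ?_ h1
        gcongr
    _ = 3 / δ := by field_simp

lemma eventually_ne_nhdsNE (a s : ℂ) : ∀ᶠ z in 𝓝[≠] s, z ≠ a := by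
  by_cases h : a = s
  · subst h; exact self_mem_nhdsWithin
  · exact nhdsWithin_le_nhds (isOpen_ne.mem_nhds (Ne.symm h))

omit χ in
/-- Multiplying away the possible pole at `1` leaves an entire function that is nonzero there. -/
lemma exists_entire_LFunction_ne_zero (ψ : DirichletCharacter ℂ m) : ∃ (k : ℕ) (W : ℂ → ℂ),
    Differentiable ℂ W ∧ W 1 ≠ 0 ∧ ∀ s, s ≠ 1 → W s = (s - 1) ^ k * ψ.LFunction s := by
  by_cases hψ : ψ = 1
  · subst hψ
    refine ⟨1, _, DirichletCharacter.differentiable_LFunctionTrivChar₁ m,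
      DirichletCharacter.LFunctionTrivChar₁_apply_one_ne_zero m, fun s hs => by
      simp [DirichletCharacter.LFunctionTrivChar₁, hs]⟩
  · refine ⟨0, _, DirichletCharacter.differentiable_LFunction hψ,
      DirichletCharacter.LFunction_ne_zero_of_one_le_re ψ (Or.inl hψ) (by simp), fun s _ => by simp⟩

/-- `F` as a quotient of analytic functions. -/
lemma exists_F_eq_div : ∃ (k : ℕ) (N D : ℂ → ℂ), DifferentiableOn ℂ N {s : ℂ | -1 < s.re} ∧
    Differentiable ℂ D ∧ (∀ s, s ≠ 1 → s ≠ 0 → s ≠ -1 / 2 →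
      D s = s * (s - 1) * ((2 * s + 1) ^ k * (χ ^ 2).LFunction (2 * s + 2))) ∧
    D (-1 / 2) ≠ 0 ∧
    ∀ s, s ≠ 1 → s ≠ 0 → s ≠ -1 / 2 → F q χ s = N s / D s := by
  obtain ⟨E, hE, hEs⟩ := exists_entire_LFunction χ
  obtain ⟨k, W, hW, hW1, hWs⟩ := exists_entire_LFunction_ne_zero (χ ^ 2)
  have hW2 : ∀ s : ℂ, s ≠ -1 / 2 →
      W (2 * s + 2) = (2 * s + 1) ^ k * (χ ^ 2).LFunction (2 * s + 2) := by
    intro s h2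
    rw [hWs (2 * s + 2) (fun h => h2 (by linear_combination h / 2))]
    ring
  refine ⟨k, fun s => E s * E (s + 1) * (2 * s + 1) ^ k * badProduct q χ s * primeProduct q χ s,
    fun s => s * (s - 1) * W (2 * s + 2), ?_, by fun_prop, ?_, ?_, ?_⟩
  · have h1 : Differentiable ℂ fun s => E s * E (s + 1) * (2 * s + 1) ^ k := by fun_prop
    exact (h1.differentiableOn.mul (differentiableOn_badProduct q χ)).mul
      (differentiableOn_primeProduct q χ)
  · intro s h1 h0 h2
    simp only
    rw [hW2 s h2]
  · norm_num
    exact hW1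
  · intro s h1 h0 h2
    have h2' : 2 * s + 1 ≠ 0 := fun h => h2 (by linear_combination h / 2)
    simp only
    rw [F_eq, hEs s h1, hEs (s + 1) (by simpa using h0), hW2 s h2]
    have h1' : s - 1 ≠ 0 := sub_ne_zero.mpr h1
    have e1 : s + 1 - 1 = s := by ring
    rw [e1]
    generalize (χ ^ 2).LFunction (2 * s + 2) = l
    generalize 2 * s + 1 = t at h2'
    by_cases hL : l = 0
    · simp [hL]
    · field_simp

lemma meromorphicOn_F : MeromorphicOn (F q χ) {s : ℂ | -1 < s.re} := by
  obtain ⟨k, N, D, hN, hD, -, -, h⟩ := exists_F_eq_div q χ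
  intro s hs
  have h1 : MeromorphicAt N s := (hN.analyticAt ((isOpen_re_gt _).mem_nhds hs)).meromorphicAt
  have h2 : MeromorphicAt D s := (hD.analyticAt s).meromorphicAt
  refine (h1.div h2).congr ?_
  filter_upwards [eventually_ne_nhdsNE 1 s, eventually_ne_nhdsNE 0 s,
    eventually_ne_nhdsNE (-1 / 2) s] with z a b c
  rw [h z a b c]; rfl

lemma differentiableAt_F {s : ℂ} (hs : -1 < s.re) (h1 : s ≠ 1) (h0 : s ≠ 0) (h2 : s ≠ -1 / 2)
    (hL : 2 * s + 2 ∉ zeros (χ ^ 2)) : DifferentiableAt ℂ (F q χ) s := by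
  obtain ⟨k, N, D, hN, hD, hDs, -, h⟩ := exists_F_eq_div q χ
  have h3 : F q χ =ᶠ[𝓝 s] fun z => N z / D z := by
    filter_upwards [isOpen_ne.mem_nhds h1, isOpen_ne.mem_nhds h0,
      isOpen_ne.mem_nhds h2] with z a b c
    exact h z a b c
  refine DifferentiableAt.congr_of_eventuallyEq ?_ h3
  refine (hN.differentiableAt ((isOpen_re_gt _).mem_nhds hs)).div (hD s) ?_
  rw [hDs s h1 h0 h2]
  have h2' : 2 * s + 1 ≠ 0 := fun h => h2 (by linear_combination h / 2)
  refine mul_ne_zero (mul_ne_zero h0 (sub_ne_zero.mpr h1))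
    (mul_ne_zero (pow_ne_zero _ h2') fun hz => hL ⟨?_, ?_, hz⟩)
  · simp; linarith
  · intro h; exact h2 (by linear_combination h / 2)

/-- The pole of `L(2s+2, χ²)`, if any, makes `F` have a removable singularity at `-1/2`. -/
lemma exists_analyticAt_F_neg_half : ∃ G : ℂ → ℂ, AnalyticAt ℂ G (-1 / 2) ∧
    F q χ =ᶠ[𝓝[≠] (-1 / 2)] G := by
  obtain ⟨k, N, D, hN, hD, -, hD0, h⟩ := exists_F_eq_div q χ
  refine ⟨fun z => N z / D z, ?_, ?_⟩
  · exact (hN.analyticAt ((isOpen_re_gt _).mem_nhds (by norm_num))).div (hD.analyticAt _) hD0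
  · filter_upwards [eventually_ne_nhdsNE 1 (-1 / 2), eventually_ne_nhdsNE 0 (-1 / 2),
      self_mem_nhdsWithin] with z a b c
    exact h z a b c

end PrimeProduct

end SingularSeries

namespace SingularSeries

/-! ### Decay of `F(s) Γ(s)` away from the poles -/

section Decay

variable (q : ℕ) {m : ℕ} [NeZero m] (χ : DirichletCharacter ℂ m)

/-- The growth `exp (B u²)` is absorbed by the decay in `u⁴ - 1`. -/
lemma exp_neg_le_of_quartic {B u : ℝ} :
    Real.exp (B * u ^ 2) * Real.exp (-(Real.pi / 4 * (u ^ 4 - 1))) ≤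
      Real.exp (B ^ 2 + 1) * Real.exp (-((u ^ 4 - 1) / 2)) := by
  rw [← Real.exp_add, ← Real.exp_add, Real.exp_le_exp]
  have h1 := Real.pi_gt_d2
  have h2 := Real.pi_lt_d2
  have h4 : 0 ≤ u ^ 4 := by positivity
  nlinarith [sq_nonneg (u ^ 2 / 2 - B), mul_nonneg h4 (show 0 ≤ Real.pi / 4 - 3 / 4 by linarith)]

set_option maxHeartbeats 1000000 in
/-- In the region to the right of the curve `Re s = -1 + κ (1+|t|)^(-1/4)`, and at distance
`κ / (1+|t|)` from the zeros, the decay of `Γ` outweighs all other factors. -/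
lemma exists_norm_F_mul_Gamma_le {κ : ℝ} (hκ : 0 < κ) (hκ1 : κ ≤ 1) : ∃ C : ℝ, 0 < C ∧ ∀ s : ℂ,
    4 ≤ |s.im| → κ * (1 + |s.im|) ^ (-(1 / 4) : ℝ) ≤ s.re + 1 → s.re ≤ 2 →
    (∀ ρ ∈ zeros (χ ^ 2), κ / (1 + |s.im|) ≤ ‖2 * s + 2 - ρ‖) →
    ‖F q χ s * Complex.Gamma s‖ ≤ C * Real.exp (-(|s.im| / 2)) := by
  obtain ⟨C₁, hC₁, hb₁⟩ := exists_norm_LFunction_le χ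
  obtain ⟨A, hA, hb₂⟩ := exists_norm_LFunction_ge (χ ^ 2)
  obtain ⟨C₂, hC₂, hb₃⟩ := exists_norm_Gamma_le
  set k := q.primeFactors.card with hk
  set ℓ := Real.log (1 / κ) with hℓ
  have hℓ0 : 0 ≤ ℓ := Real.log_nonneg (by rw [le_div_iff₀ hκ]; linarith)
  set B := A * 5 * (5 + ℓ) + 56 / κ ^ 2 + (25 + k : ℕ) with hB
  refine ⟨54 * C₁ / κ * (128 * C₁) * (3 / κ) ^ k * C₂ * Real.exp (B ^ 2 + 1), by positivity,
    fun s ht hre hre2 hd => ?_⟩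
  set t := s.im with htdef
  -- in terms of `u` all factors but `Γ` are at most `exp (O(u²))`,
  -- while `Γ` is at most `exp (-π/4 (u⁴ - 1))` up to a constant
  set u := (1 + |t|) ^ (1 / 4 : ℝ) with hu
  have hy : 5 ≤ 1 + |t| := by linarith
  have hu4 : u ^ 4 = 1 + |t| := by
    rw [hu, ← Real.rpow_natCast, ← Real.rpow_mul (by linarith)]; norm_num
  have hu1 : 1 ≤ u := Real.one_le_rpow (by linarith) (by norm_num)
  have hui : (1 + |t|) ^ (-(1 / 4) : ℝ) = u⁻¹ := Real.rpow_neg (by linarith) _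
  rw [hui, ← div_eq_mul_inv] at hre
  have hu2 : u ≤ u ^ 2 := by nlinarith
  have hδ : 0 < κ / u := by positivity
  have hδ1 : κ / u ≤ 1 := by rw [div_le_one (by linarith)]; linarith
  have hre0 : -1 < s.re := by linarith
  have habs : |s.re| ≤ 2 := abs_le.mpr ⟨by linarith, hre2⟩
  have hsn : ‖s‖ ≤ 2 + |t| := (Complex.norm_le_abs_re_add_abs_im s).trans (by linarith)
  have hinv : 1 / (s.re + 1) ≤ u / κ := by
    rw [show u / κ = 1 / (κ / u) by field_simp]
    exact one_div_le_one_div_of_le hδ hre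
  have hinv0 : 0 < 1 / (s.re + 1) := one_div_pos.mpr (by linarith)
  have huκ : 1 ≤ u / κ := by rw [le_div_iff₀ hκ]; linarith
  have g1 : ‖χ.LFunction s‖ ≤ 54 * C₁ / κ * u ^ 13 := by
    have h1 : 1 / 2 ≤ ‖s - 1‖ := by
      have := Complex.abs_im_le_norm (s - 1)
      rw [Complex.sub_im, Complex.one_im, sub_zero] at this
      linarith
    calc _ ≤ C₁ * (1 + ‖s‖) ^ 3 * (1 + 1 / (s.re + 1)) := hb₁ s hre0 h1
      _ ≤ C₁ * (3 * u ^ 4) ^ 3 * (u / κ + u / κ) := by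
          gcongr
          linarith
      _ = _ := by field_simp; ring
  have g2 : ‖χ.LFunction (s + 1)‖ ≤ 128 * C₁ * u ^ 12 := by
    have h1 : 1 / 2 ≤ ‖s + 1 - 1‖ := by
      have := Complex.abs_im_le_norm s
      rw [add_sub_cancel_right]
      linarith
    have h2 : ‖s + 1‖ ≤ 3 + |t| := (norm_add_le _ _).trans (by rw [norm_one]; linarith)
    have h3 : 1 / ((s + 1).re + 1) ≤ 1 := by
      rw [Complex.add_re, Complex.one_re, div_le_one (by linarith)]; linarith
    have h4 : 0 < 1 / ((s + 1).re + 1) := by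
      rw [Complex.add_re, Complex.one_re]; exact one_div_pos.mpr (by linarith)
    calc _ ≤ C₁ * (1 + ‖s + 1‖) ^ 3 * (1 + 1 / ((s + 1).re + 1)) :=
          hb₁ (s + 1) (by simp; linarith) h1
      _ ≤ C₁ * (4 * u ^ 4) ^ 3 * (1 + 1) := by
          gcongr
          linarith
      _ = _ := by ring
  have hlogu : Real.log (1 + |t|) ≤ 4 * u := by
    rw [← hu4, Real.log_pow]
    have := Real.log_le_sub_one_of_pos (show 0 < u by linarith)
    push_cast
    linarith
  have g3 : ‖(χ ^ 2).LFunction (2 * s + 2)‖⁻¹ ≤ Real.exp (A * 5 * (5 + ℓ) * u ^ 2) := by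
    have him : (2 * s + 2).im = 2 * t := by simp [htdef]
    have hrew : (2 * s + 2).re = 2 * s.re + 2 := by simp
    have habs2 : |(2 * s + 2).im| = 2 * |t| := by rw [him, abs_mul]; norm_num
    have hη : 0 < κ / (1 + |t|) := by positivity
    have hηu : κ / (1 + |t|) ≤ κ / u := by
      gcongr
      rw [← hu4]
      nlinarith [pow_le_pow_right₀ hu1 (show 1 ≤ 4 by norm_num)]
    have h1 := hb₂ (2 * s + 2) (κ / (1 + |t|)) (by rw [habs2]; linarith) hη (by linarith)
      (by rw [hrew]; linarith) hd
    rw [Real.exp_neg] at h1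
    have h2 := inv_anti₀ (by positivity) h1
    rw [inv_inv] at h2
    refine h2.trans (Real.exp_le_exp.mpr ?_)
    rw [habs2, one_div_div, ← one_div_mul_eq_div,
      Real.log_mul (by positivity) (by positivity), Real.log_mul (by positivity) (by positivity)]
    have h3 : Real.log |t| ≤ 4 * u :=
      (Real.log_le_log (by linarith) (by linarith)).trans hlogu
    have h4 : Real.log 2 ≤ 1 := by linarith [Real.log_two_lt_d9]
    have h5 : 0 ≤ Real.log 2 + Real.log |t| :=
      add_nonneg (Real.log_nonneg (by norm_num)) (Real.log_nonneg (by linarith))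
    have h6 : 0 ≤ Real.log (1 + |t|) := Real.log_nonneg (by linarith)
    calc A * (Real.log 2 + Real.log |t|) * (1 + (ℓ + Real.log (1 + |t|)))
        ≤ A * (5 * u) * ((5 + ℓ) * u) := by
          gcongr
          · linarith
          · nlinarith
      _ = _ := by ring
  have g4 := norm_badProduct_le q χ (s := s) hδ hδ1 hre
  have g5 := norm_primeProduct_le q χ (s := s) hδ hδ1 hre
  have g6 := hb₃ s (by linarith) hre2 (by linarith)
  rw [← hk, show 3 / (κ / u) = 3 / κ * u by field_simp, mul_pow] at g4
  rw [show 56 / (κ / u) ^ 2 = 56 / κ ^ 2 * u ^ 2 by field_simp] at g5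
  have hun : u ^ (25 + k) ≤ Real.exp ((25 + k : ℕ) * u ^ 2) := by
    rw [Real.exp_nat_mul]
    gcongr
    linarith [Real.add_one_le_exp (u ^ 2)]
  rw [F_eq, norm_mul, norm_mul, norm_mul, norm_div, norm_mul, div_eq_mul_inv]
  set e₁ := Real.exp (A * 5 * (5 + ℓ) * u ^ 2) with he₁
  set e₂ := Real.exp (56 / κ ^ 2 * u ^ 2) with he₂
  set e₃ := Real.exp (-(Real.pi / 4 * |t|)) with he₃
  set e₄ := Real.exp ((25 + k : ℕ) * u ^ 2) with he₄
  have he₀ : 0 < e₁ ∧ 0 < e₂ ∧ 0 < e₃ ∧ 0 < e₄ :=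
    ⟨Real.exp_pos _, Real.exp_pos _, Real.exp_pos _, Real.exp_pos _⟩
  obtain ⟨he10, he20, he30, he40⟩ := he₀
  have hexp : e₄ * e₁ * e₂ * e₃ ≤ Real.exp (B ^ 2 + 1) * Real.exp (-(|t| / 2)) := by
    have h := exp_neg_le_of_quartic (B := B) (u := u)
    have e : u ^ 4 - 1 = |t| := by rw [hu4]; ring
    rw [e] at h
    refine le_trans (le_of_eq ?_) h
    rw [he₁, he₂, he₃, he₄, ← Real.exp_add, ← Real.exp_add, ← Real.exp_add, ← Real.exp_add, hB]
    ring_nf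
  clear_value e₁ e₂ e₃ e₄ u B k
  have hu0 : 0 < u := by linarith
  generalize ‖χ.LFunction s‖ = a₁ at g1 ⊢
  have n2 : 0 ≤ ‖χ.LFunction (s + 1)‖ := norm_nonneg _
  generalize ‖χ.LFunction (s + 1)‖ = a₂ at g2 n2 ⊢
  have n3 : 0 ≤ ‖(χ ^ 2).LFunction (2 * s + 2)‖⁻¹ := by positivity
  generalize ‖(χ ^ 2).LFunction (2 * s + 2)‖⁻¹ = a₃ at g3 n3 ⊢
  have n4 : 0 ≤ ‖badProduct q χ s‖ := norm_nonneg _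
  generalize ‖badProduct q χ s‖ = a₄ at g4 n4 ⊢
  have n5 : 0 ≤ ‖primeProduct q χ s‖ := norm_nonneg _
  generalize ‖primeProduct q χ s‖ = a₅ at g5 n5 ⊢
  have n6 : 0 ≤ ‖Complex.Gamma s‖ := norm_nonneg _
  generalize ‖Complex.Gamma s‖ = a₆ at g6 n6 ⊢
  have f0 : a₁ * a₂ ≤ 54 * C₁ / κ * u ^ 13 * (128 * C₁ * u ^ 12) := by
    exact mul_le_mul g1 g2 n2 (by positivity)
  have f1 : a₁ * a₂ * a₃ * a₄ * a₅ * a₆ ≤ 54 * C₁ / κ * u ^ 13 * (128 * C₁ * u ^ 12) * e₁ *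
      ((3 / κ) ^ k * u ^ k) * e₂ * (C₂ * e₃) := by
    gcongr
  refine f1.trans ?_
  calc 54 * C₁ / κ * u ^ 13 * (128 * C₁ * u ^ 12) * e₁ * ((3 / κ) ^ k * u ^ k) * e₂ * (C₂ * e₃)
      = 54 * C₁ / κ * (128 * C₁) * (3 / κ) ^ k * C₂ * (u ^ (25 + k) * e₁ * e₂ * e₃) := by ring
    _ ≤ 54 * C₁ / κ * (128 * C₁) * (3 / κ) ^ k * C₂ * (e₄ * e₁ * e₂ * e₃) := by gcongr
    _ ≤ 54 * C₁ / κ * (128 * C₁) * (3 / κ) ^ k * C₂ *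
        (Real.exp (B ^ 2 + 1) * Real.exp (-(|t| / 2))) := by gcongr
    _ = _ := by ring

end Decay

end SingularSeries

namespace SingularSeries

/-! ### Shifting the contour -/

section Contour

variable (q : ℕ) {m : ℕ} [NeZero m] (χ : DirichletCharacter ℂ m)

/-- The integrand `F(s) X^s Γ(s)`. -/
noncomputable def integrand (X : ℝ) (s : ℂ) : ℂ := F q χ s * (X : ℂ) ^ s * Complex.Gamma s

lemma norm_integrand {X : ℝ} (hX : 0 < X) (s : ℂ) :
    ‖integrand q χ X s‖ = ‖F q χ s * Complex.Gamma s‖ * X ^ s.re := by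
  rw [integrand, norm_mul, norm_mul, norm_mul, Complex.norm_cpow_eq_rpow_re_of_pos hX]
  ring

lemma Gamma_ne_neg_nat {s : ℂ} (hs : -1 < s.re) (h0 : s ≠ 0) (n : ℕ) : s ≠ -n := by
  rintro rfl
  rcases n with _ | n
  · simp at h0
  · simp at hs
    linarith [n.cast_nonneg (α := ℝ)]

lemma differentiableAt_F_mul_Gamma {s : ℂ} (hs : -1 < s.re) (h1 : s ≠ 1)
    (h0 : s ≠ 0) (h2 : s ≠ -1 / 2) (hL : 2 * s + 2 ∉ zeros (χ ^ 2)) :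
    DifferentiableAt ℂ (fun s => F q χ s * Complex.Gamma s) s :=
  (differentiableAt_F q χ hs h1 h0 h2 hL).mul
    (Complex.differentiableAt_Gamma _ (Gamma_ne_neg_nat hs h0))

lemma differentiableAt_integrand {X : ℝ} (hX : 0 < X) {s : ℂ} (hs : -1 < s.re) (h1 : s ≠ 1)
    (h0 : s ≠ 0) (h2 : s ≠ -1 / 2) (hL : 2 * s + 2 ∉ zeros (χ ^ 2)) :
    DifferentiableAt ℂ (integrand q χ X) s := by
  refine ((differentiableAt_F q χ hs h1 h0 h2 hL).mul ?_).mul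
    (Complex.differentiableAt_Gamma _ (Gamma_ne_neg_nat hs h0))
  exact differentiableAt_id.const_cpow (Or.inl (by exact_mod_cast hX.ne'))

lemma meromorphicAt_integrand {X : ℝ} (hX : 0 < X) {s : ℂ} (hs : -1 < s.re) :
    MeromorphicAt (integrand q χ X) s := by
  have h1 : MeromorphicAt Complex.Gamma s := by
    have h : MeromorphicAt (fun z => (fun z => (Complex.Gamma z)⁻¹) z) s :=
      (Complex.differentiable_one_div_Gamma.analyticAt s).meromorphicAt
    refine h.inv.congr (Eventually.of_forall fun z => by simp)
  have h2 : AnalyticAt ℂ (fun s : ℂ => (X : ℂ) ^ s) s :=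
    Differentiable.analyticAt (differentiable_id.const_cpow (Or.inl (by exact_mod_cast hX.ne'))) s
  exact ((meromorphicOn_F q χ s hs).mul h2.meromorphicAt).mul h1

/-- The abscissa of the left edge of the contour whose horizontal edges have height `T/2`. -/
noncomputable def leftEdge (θ T : ℝ) : ℝ := -1 + θ * (2 + T) ^ (-(1 / 4) : ℝ)

/-- The parameter `θ` keeps the left edges away from the poles at `ρ/2 - 1`. -/
structure IsMargin {m : ℕ} [NeZero m] (ψ : DirichletCharacter ℂ m) (θ : ℝ) : Prop where
  pos : 0 < θ
  le : θ ≤ 1 / 4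
  le_re : ∀ T : ℝ, 0 ≤ T → ∀ ρ ∈ zeros ψ, |ρ.im| ≤ T + 1 →
    4 * (θ * (2 + T) ^ (-(1 / 4) : ℝ)) ≤ ρ.re

/-- The zeros stay to the right of a curve `Re ρ = c (1 + |Im ρ|)^(-1/4)`, so `θ ≤ c/4` is
small enough. -/
lemma exists_isMargin {m : ℕ} [NeZero m] (ψ : DirichletCharacter ℂ m) {ε : ℝ} (hε : 0 < ε) :
    ∃ θ ≤ ε, IsMargin ψ θ := by
  obtain ⟨c, hc, h⟩ := exists_le_re_zeros ψ
  refine ⟨min ε (min (1 / 4) (c / 4)), min_le_left _ _, by positivity,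
    (min_le_right _ _).trans (min_le_left _ _), fun T hT ρ hρ hρT => le_trans ?_ (h ρ hρ)⟩
  have h1 : (2 + T) ^ (-(1 / 4) : ℝ) ≤ (1 + |ρ.im|) ^ (-(1 / 4) : ℝ) :=
    Real.rpow_le_rpow_of_nonpos (by positivity) (by linarith) (by norm_num)
  have h2 : min ε (min (1 / 4) (c / 4)) ≤ c / 4 := (min_le_right _ _).trans (min_le_right _ _)
  have h3 : 0 < (2 + T) ^ (-(1 / 4) : ℝ) := by positivity
  calc _ ≤ 4 * (c / 4 * (1 + |ρ.im|) ^ (-(1 / 4) : ℝ)) := by gcongr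
    _ = _ := by ring

variable {q χ} {θ : ℝ}

lemma margin_bounds (hθ : IsMargin (χ ^ 2) θ) {T : ℝ} (hT : 0 ≤ T) :
    0 < θ * (2 + T) ^ (-(1 / 4) : ℝ) ∧ θ * (2 + T) ^ (-(1 / 4) : ℝ) ≤ θ := by
  have h1 : (2 + T) ^ (-(1 / 4) : ℝ) ≤ 1 :=
    Real.rpow_le_one_of_one_le_of_nonpos (by linarith) (by norm_num)
  have h2 : 0 < (2 + T) ^ (-(1 / 4) : ℝ) := by positivity
  exact ⟨mul_pos hθ.pos h2, by nlinarith [hθ.pos]⟩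

lemma leftEdge_bounds (hθ : IsMargin (χ ^ 2) θ) {T : ℝ} (hT : 0 ≤ T) :
    -1 < leftEdge θ T ∧ leftEdge θ T ≤ -1 + θ := by
  have := margin_bounds hθ hT
  unfold leftEdge
  constructor <;> linarith

lemma leftEdge_anti (hθ : IsMargin (χ ^ 2) θ) {a b : ℝ} (ha : 0 ≤ a) (hab : a ≤ b) :
    leftEdge θ b ≤ leftEdge θ a := by
  have h1 : (2 + b) ^ (-(1 / 4) : ℝ) ≤ (2 + a) ^ (-(1 / 4) : ℝ) :=
    Real.rpow_le_rpow_of_nonpos (by positivity) (by linarith) (by norm_num)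
  unfold leftEdge
  nlinarith [hθ.pos]

lemma leftEdge_lt_of_mem_zeros (hθ : IsMargin (χ ^ 2) θ) {T : ℝ} (hT : 0 ≤ T) {ρ : ℂ}
    (hρ : ρ ∈ zeros (χ ^ 2)) (h : |ρ.im| ≤ T + 1) : leftEdge θ T < (ρ / 2 - 1).re := by
  have h1 := hθ.le_re T hT ρ hρ h
  have h2 := (margin_bounds hθ hT).1
  have e : (ρ / 2 - 1).re = ρ.re / 2 - 1 := by simp
  rw [e, leftEdge]
  linarith

variable (q)

/-- Decay of `F(s) Γ(s)` on the left edges and on horizontal segments of admissible height. -/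
lemma exists_decay (hθ : IsMargin (χ ^ 2) θ) : ∃ C : ℝ, 0 < C ∧ ∀ (b : ℝ) (s : ℂ),
    4 ≤ |s.im| → 0 ≤ b → b ≤ 2 * |s.im| + 3 → leftEdge θ b ≤ s.re → s.re ≤ 2 →
    ((s.re = leftEdge θ b ∧ 2 * |s.im| ≤ b) ∨
      ∀ ρ ∈ zeros (χ ^ 2), 1 / (2 * |s.im|) ≤ |(|ρ.im| - 2 * |s.im|)|) →
    ‖F q χ s * Complex.Gamma s‖ ≤ C * Real.exp (-(|s.im| / 2)) := by
  have hθ0 := hθ.pos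
  have hθ1 := hθ.le
  obtain ⟨C, hC, h⟩ := exists_norm_F_mul_Gamma_le q χ (κ := θ / 2) (by linarith) (by linarith)
  refine ⟨C, hC, fun b s ht hb0 hb hre hre2 hd => ?_⟩
  -- `b ≤ 2 |Im s| + 3` makes `2 + b` at most `16 (1 + |Im s|)`, and `16 ^ (-1/4) = 1/2`
  have hpow : (1 + |s.im|) ^ (-(1 / 4) : ℝ) / 2 ≤ (2 + b) ^ (-(1 / 4) : ℝ) := by
    have h1 : (16 * (1 + |s.im|)) ^ (-(1 / 4) : ℝ) ≤ (2 + b) ^ (-(1 / 4) : ℝ) :=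
      Real.rpow_le_rpow_of_nonpos (by positivity) (by linarith) (by norm_num)
    rw [Real.mul_rpow (by norm_num) (by positivity)] at h1
    have h2 : (16 : ℝ) ^ (-(1 / 4) : ℝ) = 1 / 2 := by
      rw [show (16 : ℝ) = 2 ^ (4 : ℝ) by norm_num, ← Real.rpow_mul (by norm_num)]
      norm_num
    rw [h2] at h1
    linarith
  have hpow2 : 1 / (1 + |s.im|) ≤ (1 + |s.im|) ^ (-(1 / 4) : ℝ) := by
    rw [one_div, ← Real.rpow_neg_one]
    exact Real.rpow_le_rpow_of_exponent_le (by linarith) (by norm_num)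
  have hmar : θ / 2 * (1 + |s.im|) ^ (-(1 / 4) : ℝ) ≤ θ * (2 + b) ^ (-(1 / 4) : ℝ) := by
    nlinarith
  refine h s ht ?_ hre2 fun ρ hρ => ?_
  · unfold leftEdge at hre
    linarith
  · have e : θ / 2 / (1 + |s.im|) = θ / 2 * (1 / (1 + |s.im|)) := by ring
    have him : (2 * s + 2 - ρ).im = 2 * s.im - ρ.im := by simp
    have hrew : (2 * s + 2 - ρ).re = 2 * s.re + 2 - ρ.re := by simp
    have hsmall : θ / 2 / (1 + |s.im|) ≤ 1 := by
      rw [div_le_one (by positivity)]; linarith [abs_nonneg s.im]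
    have habs2 : |2 * s.im| = 2 * |s.im| := by rw [abs_mul]; norm_num
    -- on the left edge, zeros of height at most `b + 1` are separated from `2 s + 2` in real part,
    -- the others in imaginary part
    rcases hd with ⟨hd1, hd2⟩ | hd
    · rcases le_or_gt |ρ.im| (b + 1) with h1 | h1
      · have h2 := hθ.le_re b hb0 ρ hρ h1
        have h3 := Complex.abs_re_le_norm (2 * s + 2 - ρ)
        rw [hrew, hd1, leftEdge] at h3
        have h4 := (neg_le_abs _).trans h3
        have h5 : θ / 2 * (1 / (1 + |s.im|)) ≤ θ / 2 * (1 + |s.im|) ^ (-(1 / 4) : ℝ) := by gcongr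
        rw [e]
        linarith [(margin_bounds hθ hb0).1]
      · have h3 := Complex.abs_im_le_norm (2 * s + 2 - ρ)
        rw [him] at h3
        have h4 := abs_sub_abs_le_abs_sub ρ.im (2 * s.im)
        rw [abs_sub_comm, habs2] at h4
        linarith
    · have h1 := hd ρ hρ
      have h3 := Complex.abs_im_le_norm (2 * s + 2 - ρ)
      rw [him] at h3
      have h4 := abs_abs_sub_abs_le_abs_sub ρ.im (2 * s.im)
      rw [abs_sub_comm ρ.im, habs2] at h4
      refine le_trans ?_ (h1.trans (h4.trans h3))
      rw [div_le_div_iff₀ (by positivity) (by linarith)]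
      nlinarith [abs_nonneg s.im]

/-- Decay of `F(s) Γ(s)` on a vertical line to the right of the zeros. -/
lemma exists_decay_vertical (χ : DirichletCharacter ℂ m) {c : ℝ} (hc : -(1 / 2) < c) (hc2 : c ≤ 2)
    (hc0 : c ≠ 0) (hc1 : c ≠ 1) : ∃ C : ℝ, 0 < C ∧ ∀ t : ℝ,
    ‖F q χ (c + t * Complex.I) * Complex.Gamma (c + t * Complex.I)‖ ≤
      C * Real.exp (-(|t| / 2)) := by
  obtain ⟨C, hC, h⟩ := exists_norm_F_mul_Gamma_le q χ (κ := min (1 / 2) (2 * c + 1))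
    (by rw [lt_min_iff]; constructor <;> linarith) ((min_le_left _ _).trans (by norm_num))
  have hκ1 : min (1 / 2) (2 * c + 1) ≤ 1 / 2 := min_le_left _ _
  have hκ2 : min (1 / 2) (2 * c + 1) ≤ 2 * c + 1 := min_le_right _ _
  have hκ0 : 0 < min (1 / 2) (2 * c + 1) := by rw [lt_min_iff]; constructor <;> linarith
  set κ := min (1 / 2) (2 * c + 1)
  have hcont : Continuous fun t : ℝ =>
      ‖F q χ (c + t * Complex.I) * Complex.Gamma (c + t * Complex.I)‖ := by
    refine continuous_norm.comp (continuous_iff_continuousAt.mpr fun t => ?_)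
    have hd : DifferentiableAt ℂ (fun s => F q χ s * Complex.Gamma s) (c + t * Complex.I) := by
      refine differentiableAt_F_mul_Gamma q χ (by simp; linarith) ?_ ?_ ?_ ?_
      · intro h; exact hc1 (by simpa using congrArg Complex.re h)
      · intro h; exact hc0 (by simpa using congrArg Complex.re h)
      · intro h
        have := congrArg Complex.re h
        simp at this
        norm_num at this
        linarith
      · intro h
        have := re_lt_one_of_mem_zeros _ h
        simp at this
        linarith
    exact ContinuousAt.comp (f := fun t : ℝ => (c + t * Complex.I : ℂ))
      (g := fun s => F q χ s * Complex.Gamma s) hd.continuousAt (by fun_prop)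
  -- heights below `4` are covered by compactness
  obtain ⟨B, hB⟩ := (isCompact_Icc (a := (-4 : ℝ)) (b := 4)).exists_bound_of_continuousOn
    hcont.continuousOn
  have hB0 : 0 ≤ B := (norm_nonneg _).trans (hB 0 (by norm_num))
  refine ⟨C + B * Real.exp 2, by positivity, fun t => ?_⟩
  rcases le_or_gt 4 |t| with ht | ht
  · have := h (c + t * Complex.I) (by simpa using ht) ?_ (by simpa using hc2) fun ρ hρ => ?_
    · refine this.trans ?_
      simp only [Complex.add_im, Complex.ofReal_im, Complex.mul_im, Complex.ofReal_re,
        Complex.I_im, mul_one, Complex.I_re, mul_zero, add_zero, zero_add]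
      gcongr
      have : 0 ≤ B * Real.exp 2 := by positivity
      linarith
    · simp
      have h1 : (1 + |t|) ^ (-(1 / 4) : ℝ) ≤ 1 :=
        Real.rpow_le_one_of_one_le_of_nonpos (by linarith) (by norm_num)
      have h2 : 0 < (1 + |t|) ^ (-(1 / 4) : ℝ) := by positivity
      norm_num at h1 h2
      nlinarith
    · have h1 := re_lt_one_of_mem_zeros _ hρ
      have h2 := Complex.re_le_norm (2 * (c + t * Complex.I) + 2 - ρ)
      simp at h2
      simp
      have h3 : κ / (1 + |t|) ≤ κ := div_le_self hκ0.le (by linarith)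
      linarith
  · have h1 := hB t (abs_le.mp ht.le)
    rw [norm_norm] at h1
    have h2 : 1 ≤ Real.exp 2 * Real.exp (-(|t| / 2)) := by
      rw [← Real.exp_add]
      exact Real.one_le_exp (by linarith)
    have h3 : 0 < C * Real.exp (-(|t| / 2)) := by positivity
    nlinarith

end Contour

end SingularSeries

namespace SingularSeries

section ZeroSum

variable (q : ℕ) {m : ℕ} [NeZero m] (χ : DirichletCharacter ℂ m)

/-- The heights `T` at distance at least `1/T` from the ordinates of all zeros. -/
def Admissible {m : ℕ} [NeZero m] (ψ : DirichletCharacter ℂ m) (T : ℝ) : Prop :=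
  ∀ ρ ∈ zeros ψ, 1 / T ≤ |(|ρ.im| - T)|

lemma finite_zeros_im_lt {m : ℕ} [NeZero m] (ψ : DirichletCharacter ℂ m) (T : ℝ) :
    {ρ : ℂ | ρ ∈ zeros ψ ∧ |ρ.im| < T}.Finite :=
  (finite_zeros_im_le ψ T).subset fun _ hρ => ⟨hρ.1, hρ.2.le⟩

/-- The poles of `F` coming from the zeros with `|Im ρ| < T`. -/
noncomputable def zeroPoles (T : ℝ) : Finset ℂ :=
  (finite_zeros_im_lt (χ ^ 2) T).toFinset.image fun ρ => ρ / 2 - 1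

lemma mem_zeroPoles {T : ℝ} {s : ℂ} :
    s ∈ zeroPoles χ T ↔ 2 * s + 2 ∈ zeros (χ ^ 2) ∧ 2 * |s.im| < T := by
  have him : |(2 * s + 2).im| = 2 * |s.im| := by simp [abs_mul]
  simp only [zeroPoles, Finset.mem_image, Set.Finite.mem_toFinset]
  constructor
  · rintro ⟨ρ, ⟨h1, h2⟩, rfl⟩
    have e : 2 * (ρ / 2 - 1) + 2 = ρ := by ring
    rw [← him, e]
    exact ⟨h1, h2⟩
  · rintro ⟨h1, h2⟩
    exact ⟨2 * s + 2, ⟨h1, by rwa [him]⟩, by ring⟩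

lemma partialZeroSum_eq (X T : ℝ) :
    partialZeroSum q χ X T = ∑ s ∈ zeroPoles χ T, residue (integrand q χ X) s := by
  rw [partialZeroSum, finsum_mem_eq_finite_toFinset_sum _ (finite_zeros_im_lt (χ ^ 2) T), zeroPoles,
    Finset.sum_image fun a _ b _ h => by simpa using h]
  rfl

variable {χ} {θ : ℝ}

lemma differentiableAt_integrand_of_notMem_zeroPoles {X : ℝ} (hX : 0 < X) {T : ℝ}
    (hT : 0 < T) (hA : Admissible (χ ^ 2) T) {s : ℂ} (hs : -1 < s.re) (him : 2 * |s.im| ≤ T)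
    (h1 : s ≠ 1) (h0 : s ≠ 0) (h2 : s ≠ -1 / 2) (hn : s ∉ zeroPoles χ T) :
    DifferentiableAt ℂ (integrand q χ X) s := by
  refine differentiableAt_integrand q χ hX hs h1 h0 h2 fun hz => hn ?_
  rw [mem_zeroPoles]
  refine ⟨hz, lt_of_le_of_ne him fun he => ?_⟩
  have h := hA _ hz
  have him2 : |(2 * s + 2).im| = 2 * |s.im| := by simp [abs_mul]
  rw [him2, he, sub_self, abs_zero] at h
  have : 0 < 1 / T := by positivity
  linarith

/-- No poles lie between the left edges belonging to two heights `a ≤ b`, up to height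
`(a + 1) / 2`. -/
lemma differentiableAt_integrand_left (hθ : IsMargin (χ ^ 2) θ) {X : ℝ} (hX : 0 < X) {T a b : ℝ}
    (ha : 0 ≤ a) (hab : a ≤ b) (hT : T ≤ a + 1) {s : ℂ} (hs1 : leftEdge θ b ≤ s.re)
    (hs2 : s.re ≤ leftEdge θ a) (him : 2 * |s.im| ≤ T) :
    DifferentiableAt ℂ (integrand q χ X) s := by
  have hb1 := leftEdge_bounds hθ (ha.trans hab)
  have ha1 := leftEdge_bounds hθ ha
  have hθ1 := hθ.le
  refine differentiableAt_integrand q χ hX (by linarith) ?_ ?_ ?_ fun hz => ?_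
  · rintro rfl; simp at hs2; linarith
  · rintro rfl; simp at hs2; linarith
  · rintro rfl
    norm_num at hs2
    linarith
  · have him2 : |(2 * s + 2).im| = 2 * |s.im| := by simp [abs_mul]
    have := leftEdge_lt_of_mem_zeros hθ ha hz (by rw [him2]; linarith)
    rw [show (2 * s + 2) / 2 - 1 = s by ring] at this
    linarith

/-- The integral along the left edge. -/
noncomputable def leftIntegral (χ : DirichletCharacter ℂ m) (X θ T : ℝ) : ℂ :=
  ∫ t in (-(T / 2))..(T / 2), integrand q χ X (leftEdge θ T + t * Complex.I)

/-- The residue theorem for the rectangle of height `T/2`. -/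
lemma rectIntegral_integrand (hθ : IsMargin (χ ^ 2) θ) {X : ℝ} (hX : 0 < X) {T : ℝ} (hT : 0 < T)
    (hA : Admissible (χ ^ 2) T) {c : ℝ} (hc : -(1 / 2) < c) {P : Finset ℂ}
    (hP1 : ∀ z ∈ P, z.im = 0 ∧ -(1 / 2) ≤ z.re ∧ z.re < c)
    (hP2 : ∀ z : ℂ, z = 1 ∨ z = 0 ∨ z = -1 / 2 → z ∈ P ∨ c < z.re) :
    rectIntegral (integrand q χ X) (leftEdge θ T) c (-(T / 2)) (T / 2) = 2 * Real.pi * Complex.I *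
      (partialZeroSum q χ X T + ∑ z ∈ P, residue (integrand q χ X) z) := by
  classical
  have hl := leftEdge_bounds hθ hT.le
  have hθ1 := hθ.le
  have hre : ∀ s ∈ zeroPoles χ T, leftEdge θ T < s.re ∧ s.re < -(1 / 2) := by
    intro s hs
    rw [mem_zeroPoles] at hs
    have him2 : |(2 * s + 2).im| = 2 * |s.im| := by simp [abs_mul]
    have h1 := leftEdge_lt_of_mem_zeros hθ hT.le hs.1 (by rw [him2]; linarith)
    have h2 := re_lt_one_of_mem_zeros _ hs.1
    rw [show (2 * s + 2) / 2 - 1 = s by ring] at h1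
    simp at h2
    exact ⟨h1, by linarith⟩
  have hdisj : Disjoint (zeroPoles χ T) P := by
    rw [Finset.disjoint_left]
    intro s hs hsP
    linarith [(hre s hs).2, (hP1 s hsP).2.1]
  rw [partialZeroSum_eq, ← Finset.sum_union hdisj]
  refine rectIntegral_eq_sum (by linarith) (by linarith) _ _ (fun z hz => ?_)
    (fun s hs1 hs2 hs3 => ?_) fun z hz => ?_
  · rcases Finset.mem_union.mp hz with h | h
    · have h1 := hre z h
      have h2 := (mem_zeroPoles χ).mp h
      have h3 := abs_lt.mp (show |z.im| < T / 2 by linarith [h2.2])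
      exact ⟨h1.1, by linarith, h3.1, h3.2⟩
    · have h1 := hP1 z h
      rw [h1.1]
      exact ⟨by linarith, h1.2.2, by linarith, by linarith⟩
  · rw [Finset.mem_union, not_or] at hs3
    have hne : ∀ z : ℂ, z = 1 ∨ z = 0 ∨ z = -1 / 2 → s ≠ z := by
      rintro z hz rfl
      rcases hP2 s hz with h | h
      · exact hs3.2 h
      · linarith [hs1.2]
    have him : |s.im| ≤ T / 2 := abs_le.mpr hs2
    exact differentiableAt_integrand_of_notMem_zeroPoles q hX hT hA (by linarith [hs1.1])
      (by linarith) (hne 1 (Or.inl rfl)) (hne 0 (Or.inr (Or.inl rfl)))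
      (hne _ (Or.inr (Or.inr rfl))) hs3.1
  · refine hasResidueAt_residue (meromorphicAt_integrand q χ hX ?_)
    rcases Finset.mem_union.mp hz with h | h
    · linarith [(hre z h).1]
    · linarith [(hP1 z h).2.1]

lemma line_re (x y : ℝ) : ((x : ℂ) + y * Complex.I).re = x := by simp
lemma line_im (x y : ℝ) : ((x : ℂ) + y * Complex.I).im = y := by simp

variable (χ) in
lemma norm_integrand_le {X : ℝ} (hX : 0 < X) {w C E : ℝ} {s : ℂ}
    (h1 : ‖F q χ s * Complex.Gamma s‖ ≤ C * E) (hw : X ^ s.re ≤ w) :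
    ‖integrand q χ X s‖ ≤ C * w * E := by
  rw [norm_integrand q χ hX]
  calc _ ≤ C * E * w := by
        gcongr
        exact (norm_nonneg _).trans h1
    _ = _ := by ring

/-- Raising the height of the contour from `a` to `b` changes the integral along the left edge by
an exponentially small amount. -/
lemma exists_norm_leftIntegral_sub_le (hθ : IsMargin (χ ^ 2) θ) : ∃ C : ℝ, 0 < C ∧
    ∀ X w : ℝ, 0 < X → (∀ u ∈ Set.Icc (-1 : ℝ) (-1 + θ), X ^ u ≤ w) → ∀ a b : ℝ, 8 ≤ a → a ≤ b →
      b ≤ a + 3 → Admissible (χ ^ 2) a →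
      ‖leftIntegral q χ X θ b - leftIntegral q χ X θ a‖ ≤ C * w * Real.exp (-(a / 4)) := by
  obtain ⟨C, hC, hdec⟩ := exists_decay q hθ
  refine ⟨5 * C, by positivity, fun X w hX hw a b ha hab hab3 hadm => ?_⟩
  have hθ0 := hθ.pos
  have hθ1 := hθ.le
  have hla := leftEdge_bounds hθ (show 0 ≤ a by linarith)
  have hlb := leftEdge_bounds hθ (show 0 ≤ b by linarith)
  have hanti := leftEdge_anti hθ (show 0 ≤ a by linarith) hab
  have hw0 : 0 < w := lt_of_lt_of_le (Real.rpow_pos_of_pos hX (-1)) (hw (-1) ⟨le_rfl, by linarith⟩)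
  set Φ := integrand q χ X with hΦ
  -- the pieces of the left edge between the two heights
  have hvert : ∀ t : ℝ, a / 2 ≤ |t| → |t| ≤ b / 2 →
      ‖Φ (leftEdge θ b + t * Complex.I)‖ ≤ C * w * Real.exp (-(a / 4)) := by
    intro t h1 h2
    refine norm_integrand_le q χ hX ?_ (hw _ ?_)
    · refine (hdec b _ ?_ ?_ ?_ ?_ ?_ (Or.inl ⟨?_, ?_⟩)).trans ?_ <;>
        (try simp only [line_re, line_im]) <;> try linarith
      exact mul_le_mul_of_nonneg_left (Real.exp_le_exp.mpr (by linarith)) hC.le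
    · rw [line_re]; exact ⟨hlb.1.le, hlb.2⟩
  -- the horizontal segments joining the two left edges
  have hhor : ∀ u ∈ Set.Icc (leftEdge θ b) (leftEdge θ a), ∀ y : ℝ, |y| = a / 2 →
      ‖Φ (u + y * Complex.I)‖ ≤ C * w * Real.exp (-(a / 4)) := by
    intro u hu y hy
    refine norm_integrand_le q χ hX ?_ (hw _ ?_)
    · refine (hdec b _ ?_ ?_ ?_ ?_ ?_ (Or.inr ?_)).trans ?_ <;>
        (try simp only [line_re, line_im]) <;> try linarith [hu.1, hu.2]
      · rw [hy, mul_div_cancel₀ _ (two_ne_zero' ℝ)]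
        exact hadm
      · exact mul_le_mul_of_nonneg_left (Real.exp_le_exp.mpr (by linarith)) hC.le
    · rw [line_re]; exact ⟨by linarith [hu.1], by linarith [hu.2]⟩
  have hdiff : ∀ s : ℂ, leftEdge θ b ≤ s.re → s.re ≤ leftEdge θ a → 2 * |s.im| ≤ a →
      DifferentiableAt ℂ Φ s := fun s h1 h2 h3 =>
    differentiableAt_integrand_left q hθ hX (by linarith) hab (by linarith) h1 h2 h3
  have hdiffb : ∀ t : ℝ, 2 * |t| ≤ b →
      ContinuousAt (fun t : ℝ => Φ (leftEdge θ b + t * Complex.I)) t := by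
    intro t ht
    have hd : DifferentiableAt ℂ Φ (leftEdge θ b + t * Complex.I) :=
      differentiableAt_integrand_left q hθ hX (show 0 ≤ b by linarith) le_rfl
        (show b ≤ b + 1 by linarith) (by rw [line_re]) (by rw [line_re]) (by rwa [line_im])
    exact ContinuousAt.comp (f := fun t : ℝ => (leftEdge θ b + t * Complex.I : ℂ)) (g := Φ)
      hd.continuousAt (by fun_prop)
  have hint : ∀ x y : ℝ, |x| ≤ b / 2 → |y| ≤ b / 2 → IntervalIntegrable
      (fun t : ℝ => Φ (leftEdge θ b + t * Complex.I)) MeasureTheory.volume x y := by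
    intro x y hx hy
    refine ContinuousOn.intervalIntegrable fun t ht => (hdiffb t ?_).continuousWithinAt
    have h1 := abs_le.mp hx
    have h2 := abs_le.mp hy
    have h3 : |t| ≤ b / 2 := by
      rw [abs_le]
      rcases Set.mem_uIcc.mp ht with h | h <;> constructor <;> linarith
    linarith
  have hb2 : |b / 2| ≤ b / 2 := (abs_of_nonneg (by linarith)).le
  have hb2' : |-(b / 2)| ≤ b / 2 := by rw [abs_neg]; exact hb2
  have ha2e : |a / 2| = a / 2 := abs_of_nonneg (by linarith)
  have ha2 : |a / 2| ≤ b / 2 := by rw [ha2e]; linarith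
  have ha2' : |-(a / 2)| ≤ b / 2 := by rw [abs_neg]; exact ha2
  have hsplit : leftIntegral q χ X θ b =
      (∫ t in (-(b / 2))..(-(a / 2)), Φ (leftEdge θ b + t * Complex.I)) +
      (∫ t in (-(a / 2))..(a / 2), Φ (leftEdge θ b + t * Complex.I)) +
      ∫ t in (a / 2)..(b / 2), Φ (leftEdge θ b + t * Complex.I) := by
    rw [leftIntegral, intervalIntegral.integral_add_adjacent_intervals (hint _ _ hb2' ha2')
      (hint _ _ ha2' ha2), intervalIntegral.integral_add_adjacent_intervals (hint _ _ hb2' ha2)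
      (hint _ _ ha2 hb2)]
  -- up to the height `a / 2` the two left edges bound a rectangle without poles
  have hrect := rectIntegral_eq_sum (f := Φ) hanti (show -(a / 2) ≤ a / 2 by linarith) ∅ 0 (by simp)
    (fun s h1 h2 _ => hdiff s h1.1 h1.2 (by linarith [abs_le.mpr h2])) (by simp)
  rw [Finset.sum_empty, mul_zero, rectIntegral] at hrect
  have hLa : leftIntegral q χ X θ a =
      ∫ t in (-(a / 2))..(a / 2), Φ (leftEdge θ a + t * Complex.I) := rfl
  rw [← hLa] at hrect
  set E := C * w * Real.exp (-(a / 4)) with hE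
  have hE0 : 0 ≤ E := by positivity
  have n1 : ‖∫ t in (-(b / 2))..(-(a / 2)), Φ (leftEdge θ b + t * Complex.I)‖ ≤ E * (3 / 2) := by
    refine (intervalIntegral.norm_integral_le_of_norm_le_const fun t ht => hvert t ?_ ?_).trans ?_
    · rw [Set.uIoc_of_le (by linarith)] at ht
      rw [abs_of_nonpos (by linarith [ht.2])]; linarith [ht.2]
    · rw [Set.uIoc_of_le (by linarith)] at ht
      rw [abs_of_nonpos (by linarith [ht.2])]; linarith [ht.1]
    · rw [abs_of_nonneg (by linarith)]
      gcongr
      linarith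
  have n2 : ‖∫ t in (a / 2)..(b / 2), Φ (leftEdge θ b + t * Complex.I)‖ ≤ E * (3 / 2) := by
    refine (intervalIntegral.norm_integral_le_of_norm_le_const fun t ht => hvert t ?_ ?_).trans ?_
    · rw [Set.uIoc_of_le (by linarith)] at ht
      rw [abs_of_nonneg (by linarith [ht.1])]; linarith [ht.1]
    · rw [Set.uIoc_of_le (by linarith)] at ht
      rw [abs_of_nonneg (by linarith [ht.1])]; linarith [ht.2]
    · rw [abs_of_nonneg (by linarith)]
      gcongr
      linarith
  have nh : ∀ y : ℝ, |y| = a / 2 →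
      ‖∫ u in (leftEdge θ b)..(leftEdge θ a), Φ (u + y * Complex.I)‖ ≤ E * 1 := by
    intro y hy
    refine (intervalIntegral.norm_integral_le_of_norm_le_const fun t ht => hhor t ?_ y hy).trans ?_
    · rw [Set.uIoc_of_le hanti] at ht
      exact ⟨ht.1.le, ht.2⟩
    · rw [abs_of_nonneg (by linarith)]
      gcongr
      linarith
  have n3 := nh (a / 2) ha2e
  have n4 := nh (-(a / 2)) (by rw [abs_neg, ha2e])
  set I₁ := ∫ t in (-(b / 2))..(-(a / 2)), Φ (leftEdge θ b + t * Complex.I)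
  set I₂ := ∫ t in (a / 2)..(b / 2), Φ (leftEdge θ b + t * Complex.I)
  set M := ∫ t in (-(a / 2))..(a / 2), Φ (leftEdge θ b + t * Complex.I)
  set B := ∫ u in (leftEdge θ b)..(leftEdge θ a), Φ (u + ((-(a / 2) : ℝ) : ℂ) * Complex.I)
  set U := ∫ u in (leftEdge θ b)..(leftEdge θ a), Φ (u + ((a / 2 : ℝ) : ℂ) * Complex.I)
  have key : leftIntegral q χ X θ b - leftIntegral q χ X θ a = I₁ + I₂ + Complex.I * (U - B) := by
    rw [hsplit]
    linear_combination (Complex.I) * hrect + (leftIntegral q χ X θ a - M) * (-Complex.I_sq)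
  rw [key]
  calc _ ≤ ‖I₁‖ + ‖I₂‖ + ‖Complex.I * (U - B)‖ := norm_add₃_le
    _ ≤ E * (3 / 2) + E * (3 / 2) + (E * 1 + E * 1) := by
        rw [norm_mul, Complex.norm_I, one_mul]
        gcongr
        exact (norm_sub_le _ _).trans (add_le_add n3 n4)
    _ = _ := by rw [hE]; ring

/-- At a fixed height the dependence on `X` is only through a bound `w` for `X^u` on the left
edges. -/
lemma exists_norm_leftIntegral_le (hθ : IsMargin (χ ^ 2) θ) {T : ℝ} (hT : 0 < T) :
    ∃ C : ℝ, 0 < C ∧ ∀ X w : ℝ, 0 < X → (∀ u ∈ Set.Icc (-1 : ℝ) (-1 + θ), X ^ u ≤ w) →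
      ‖leftIntegral q χ X θ T‖ ≤ C * w := by
  have hθ0 := hθ.pos
  have hl := leftEdge_bounds hθ hT.le
  have hc : ContinuousOn (fun t : ℝ => integrand q χ 1 (leftEdge θ T + t * Complex.I))
      (Set.Icc (-(T / 2)) (T / 2)) := by
    intro t ht
    have hd : DifferentiableAt ℂ (integrand q χ 1) (leftEdge θ T + t * Complex.I) :=
      differentiableAt_integrand_left q hθ one_pos hT.le le_rfl
        (show T ≤ T + 1 by linarith) (by rw [line_re]) (by rw [line_re])
        (by rw [line_im]; linarith [abs_le.mpr ht])
    exact (ContinuousAt.comp (f := fun t : ℝ => (leftEdge θ T + t * Complex.I : ℂ))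
      (g := integrand q χ 1) hd.continuousAt (by fun_prop)).continuousWithinAt
  obtain ⟨B, hB⟩ := isCompact_Icc.exists_bound_of_continuousOn hc
  have hB0 : 0 ≤ B := (norm_nonneg _).trans (hB 0 ⟨by linarith, by linarith⟩)
  refine ⟨(B + 1) * T, by positivity, fun X w hX hw => ?_⟩
  have h1 : ∀ t ∈ Set.uIoc (-(T / 2)) (T / 2),
      ‖integrand q χ X (leftEdge θ T + t * Complex.I)‖ ≤ (B + 1) * w := by
    intro t ht
    rw [Set.uIoc_of_le (by linarith)] at ht
    have h2 := hB t ⟨ht.1.le, ht.2⟩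
    rw [norm_integrand q χ one_pos, Real.one_rpow, mul_one] at h2
    rw [norm_integrand q χ hX, line_re]
    have h3 := hw (leftEdge θ T) ⟨hl.1.le, hl.2⟩
    have h4 : 0 < X ^ leftEdge θ T := by positivity
    gcongr
    linarith
  refine (intervalIntegral.norm_integral_le_of_norm_le_const h1).trans (le_of_eq ?_)
  rw [abs_of_nonneg (by linarith)]
  ring

end ZeroSum

end SingularSeries

namespace SingularSeries

section Limit

variable (q : ℕ) {m : ℕ} [NeZero m] {χ : DirichletCharacter ℂ m} {θ : ℝ}

instance heights_isCountablyGenerated {m : ℕ} [NeZero m] (ψ : DirichletCharacter ℂ m) :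
    (heights ψ).IsCountablyGenerated := by
  unfold heights
  infer_instance

lemma tendsto_exp_neg_div_heights {m : ℕ} [NeZero m] (ψ : DirichletCharacter ℂ m) :
    Tendsto (fun T : ℝ => Real.exp (-(T / 4))) (heights ψ) (𝓝 0) := by
  have h : Tendsto (fun T : ℝ => Real.exp (-(T / 4))) atTop (𝓝 0) :=
    Real.tendsto_exp_neg_atTop_nhds_zero.comp (tendsto_id.atTop_div_const (by norm_num))
  exact h.mono_left inf_le_left

lemma eventually_heights {m : ℕ} [NeZero m] (ψ : DirichletCharacter ℂ m) (N : ℝ) :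
    ∀ᶠ T in heights ψ, N ≤ T ∧ Admissible ψ T := by
  have h1 : ∀ᶠ T in heights ψ, N ≤ T := (eventually_ge_atTop N).filter_mono inf_le_left
  have h2 : ∀ᶠ T in heights ψ, Admissible ψ T :=
    mem_of_superset (mem_inf_of_right (mem_principal_self _)) fun T hT => hT
  exact h1.and h2

/-- The integrals along the left edges converge, with a limit bounded like the integrand. -/
lemma exists_tendsto_leftIntegral (hθ : IsMargin (χ ^ 2) θ) : ∃ C : ℝ, 0 < C ∧
    ∀ X w : ℝ, 0 < X → (∀ u ∈ Set.Icc (-1 : ℝ) (-1 + θ), X ^ u ≤ w) →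
      ∃ l : ℂ, Tendsto (leftIntegral q χ X θ) (heights (χ ^ 2)) (𝓝 l) ∧ ‖l‖ ≤ C * w := by
  obtain ⟨N, hN4, hN⟩ := exists_admissible_height (χ ^ 2)
  obtain ⟨C, hC, hstep⟩ := exists_norm_leftIntegral_sub_le q hθ
  set n₀ : ℕ := max ⌈N⌉₊ 8 with hn₀
  have hn8 : (8 : ℝ) ≤ n₀ := by exact_mod_cast le_max_right _ _
  have hnN : N ≤ n₀ := (Nat.le_ceil N).trans (by exact_mod_cast le_max_left _ _)
  -- one admissible height in every interval of length `1`
  choose T hT hadm using fun n : ℕ => hN ((n₀ : ℝ) + n) (by linarith [n.cast_nonneg (α := ℝ)])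
  obtain ⟨C₀, hC₀, hbase⟩ := exists_norm_leftIntegral_le q hθ (T := T 0)
    (by have := (hT 0).1; push_cast at this; linarith)
  set r := Real.exp (-(1 / 4)) with hr
  have hr1 : r < 1 := by rw [hr, ← Real.exp_zero]; exact Real.exp_lt_exp.mpr (by norm_num)
  have hr0 : 0 < r := Real.exp_pos _
  have hrn : ∀ n : ℕ, r ^ n = Real.exp (-(n / 4)) := by
    intro n
    rw [hr, ← Real.exp_nat_mul]
    ring_nf
  refine ⟨C₀ + C / (1 - r), by have : 0 < 1 - r := by linarith
                               positivity, fun X w hX hw => ?_⟩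
  have hθ0 := hθ.pos
  have hw0 : 0 < w := lt_of_lt_of_le (Real.rpow_pos_of_pos hX (-1)) (hw (-1) ⟨le_rfl, by linarith⟩)
  set L := leftIntegral q χ X θ with hL
  have hTn : ∀ n : ℕ, (n : ℝ) ≤ T n := fun n => by linarith [(hT n).1]
  -- along these heights the integrals form a Cauchy sequence with geometric increments
  have hdist : ∀ n, dist (L (T n)) (L (T (n + 1))) ≤ C * w * r ^ n := by
    intro n
    have h0 := hT n
    have h1 := hT (n + 1)
    push_cast at h1
    rw [dist_comm, dist_eq_norm]
    refine (hstep X w hX hw (T n) (T (n + 1)) (by linarith [h0.1, n.cast_nonneg (α := ℝ)])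
      (by linarith [h0.2, h1.1]) (by linarith [h0.1, h1.2]) (hadm n)).trans ?_
    rw [hrn]
    have := hTn n
    gcongr
  obtain ⟨l, hl⟩ := cauchySeq_tendsto_of_complete (cauchySeq_of_le_geometric r (C * w) hr1 hdist)
  refine ⟨l, ?_, ?_⟩
  · rw [tendsto_iff_norm_sub_tendsto_zero]
    set M := C * w * Real.exp (1 / 2) + C * w * Real.exp ((n₀ + 2) / 4) / (1 - r) with hM
    refine squeeze_zero' (Eventually.of_forall fun _ => norm_nonneg _) (g := fun T =>
      M * Real.exp (-(T / 4))) ?_ (by simpa using (tendsto_exp_neg_div_heights (χ ^ 2)).const_mul M)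
    -- an arbitrary admissible height `S` is compared with the last `T n` that surely precedes it
    filter_upwards [eventually_heights (χ ^ 2) (n₀ + 1)] with S hS
    obtain ⟨n, hn⟩ : ∃ n : ℕ, ⌊S⌋₊ = n₀ + 1 + n :=
      Nat.exists_eq_add_of_le (Nat.le_floor (by push_cast; exact hS.1))
    have hf1 := Nat.floor_le (show 0 ≤ S by linarith [hS.1])
    have hf2 := Nat.lt_floor_add_one S
    rw [hn] at hf1 hf2
    push_cast at hf1 hf2
    have h0 := hT n
    have h1 := hstep X w hX hw (T n) S (by linarith [h0.1, n.cast_nonneg (α := ℝ)])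
      (by linarith [h0.2]) (by linarith [h0.1]) (hadm n)
    have h2 := dist_le_of_le_geometric_of_tendsto r (C * w) hr1 hdist hl n
    rw [dist_eq_norm] at h2
    have h3 : Real.exp (-(T n / 4)) ≤ Real.exp (1 / 2) * Real.exp (-(S / 4)) := by
      rw [← Real.exp_add]
      exact Real.exp_le_exp.mpr (by linarith [h0.1])
    have h4 : r ^ n ≤ Real.exp ((n₀ + 2) / 4) * Real.exp (-(S / 4)) := by
      rw [hrn, ← Real.exp_add]
      exact Real.exp_le_exp.mpr (by linarith)
    have h5 : 0 < 1 - r := by linarith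
    calc ‖L S - l‖ ≤ ‖L S - L (T n)‖ + ‖L (T n) - l‖ := norm_sub_le_norm_sub_add_norm_sub _ _ _
      _ ≤ C * w * (Real.exp (1 / 2) * Real.exp (-(S / 4))) +
          C * w * (Real.exp ((n₀ + 2) / 4) * Real.exp (-(S / 4))) / (1 - r) := by
          refine add_le_add (h1.trans ?_) (h2.trans ?_) <;> gcongr
      _ = _ := by rw [hM]; ring
  · have h2 := dist_le_of_le_geometric_of_tendsto₀ r (C * w) hr1 hdist hl
    rw [dist_comm, dist_eq_norm] at h2
    have h3 := hbase X w hX hw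
    calc ‖l‖ ≤ ‖L (T 0)‖ + ‖l - L (T 0)‖ := norm_le_norm_add_norm_sub' _ _
      _ ≤ C₀ * w + C * w / (1 - r) := add_le_add h3 h2
      _ = _ := by ring

lemma rpow_le_of_mem_Icc {X u : ℝ} (hX : 0 < X) (h1 : -1 ≤ u) (h2 : u ≤ 2) :
    X ^ u ≤ X ^ (-1 : ℝ) + X ^ (2 : ℝ) := by
  have h3 : 0 < X ^ (-1 : ℝ) := by positivity
  have h4 : 0 < X ^ (2 : ℝ) := by positivity
  rcases le_total 1 X with h | h
  · have := Real.rpow_le_rpow_of_exponent_le h h2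
    linarith
  · have := Real.rpow_le_rpow_of_exponent_ge hX h h1
    linarith

/-- At admissible heights the horizontal edges, at heights `± T/2`, contribute `o(1)`. -/
lemma tendsto_horizontal (hθ : IsMargin (χ ^ 2) θ) {X : ℝ} (hX : 0 < X) {c : ℝ}
    (hc : -(1 / 2) < c) (hc2 : c ≤ 2) (σ : ℝ) (hσ : |σ| = 1) :
    Tendsto (fun T : ℝ => ∫ u in (leftEdge θ T)..c,
      integrand q χ X (u + ((σ * (T / 2) : ℝ) : ℂ) * Complex.I)) (heights (χ ^ 2)) (𝓝 0) := by
  obtain ⟨C, hC, hdec⟩ := exists_decay q hθ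
  set W := X ^ (-1 : ℝ) + X ^ (2 : ℝ) with hW
  have hW0 : 0 < W := by positivity
  refine squeeze_zero_norm' (a := fun T => C * W * 3 * Real.exp (-(T / 4))) ?_
    (by simpa using (tendsto_exp_neg_div_heights (χ ^ 2)).const_mul (C * W * 3))
  filter_upwards [eventually_heights (χ ^ 2) 8] with T ⟨hT, hadm⟩
  have hl := leftEdge_bounds hθ (show 0 ≤ T by linarith)
  have hθ1 := hθ.le
  have hy : |σ * (T / 2)| = T / 2 := by rw [abs_mul, hσ, one_mul, abs_of_nonneg (by linarith)]
  have hb : ∀ u ∈ Set.uIoc (leftEdge θ T) c,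
      ‖integrand q χ X (u + ((σ * (T / 2) : ℝ) : ℂ) * Complex.I)‖ ≤
        C * W * Real.exp (-(T / 4)) := by
    intro u hu
    rw [Set.uIoc_of_le (by linarith)] at hu
    refine norm_integrand_le q χ hX ?_ ?_
    · have := hdec T (u + ((σ * (T / 2) : ℝ) : ℂ) * Complex.I)
      rw [line_re, line_im, hy] at this
      refine (this (by linarith) (by linarith) (by linarith) hu.1.le (by linarith [hu.2])
        (Or.inr ?_)).trans (le_of_eq ?_)
      · rw [mul_div_cancel₀ _ (two_ne_zero' ℝ)]; exact hadm
      · ring_nf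
    · rw [line_re]
      exact rpow_le_of_mem_Icc hX (by linarith [hu.1]) (by linarith [hu.2])
  refine (intervalIntegral.norm_integral_le_of_norm_le_const hb).trans ?_
  rw [abs_of_nonneg (by linarith)]
  calc _ ≤ C * W * Real.exp (-(T / 4)) * 3 := by gcongr; linarith
    _ = _ := by ring

lemma integrable_exp_neg_abs_div : MeasureTheory.Integrable fun t : ℝ => Real.exp (-(|t| / 2)) := by
  have h1 : MeasureTheory.IntegrableOn (fun t : ℝ => Real.exp (-(|t| / 2))) (Set.Ioi 0) := by
    refine (exp_neg_integrableOn_Ioi 0 (b := 1 / 2) (by norm_num)).congr_fun (fun t ht => ?_)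
      measurableSet_Ioi
    simp only
    rw [abs_of_pos ht]
    ring_nf
  have h2 : MeasureTheory.IntegrableOn (fun t : ℝ => Real.exp (-(|t| / 2))) (Set.Iic 0) := by
    refine (integrableOn_exp_mul_Iic (a := 1 / 2) (by norm_num) 0).congr_fun (fun t ht => ?_)
      measurableSet_Iic
    simp only
    rw [abs_of_nonpos ht]
    ring_nf
  rw [← MeasureTheory.integrableOn_univ, ← Set.Iic_union_Ioi (a := (0 : ℝ))]
  exact h2.union h1

lemma continuous_integrand_vertical (χ : DirichletCharacter ℂ m) {X : ℝ} (hX : 0 < X) {c : ℝ}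
    (hc : -(1 / 2) < c) (hc0 : c ≠ 0) (hc1 : c ≠ 1) :
    Continuous fun t : ℝ => integrand q χ X (c + t * Complex.I) := by
  refine continuous_iff_continuousAt.mpr fun t => ?_
  have hd : DifferentiableAt ℂ (integrand q χ X) (c + t * Complex.I) := by
    refine differentiableAt_integrand q χ hX (by simp; linarith) ?_ ?_ ?_ ?_
    · intro h; exact hc1 (by simpa using congrArg Complex.re h)
    · intro h; exact hc0 (by simpa using congrArg Complex.re h)
    · intro h
      have := congrArg Complex.re h
      simp at this
      norm_num at this
      linarith
    · intro h
      have := re_lt_one_of_mem_zeros _ h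
      simp at this
      linarith
  exact ContinuousAt.comp (f := fun t : ℝ => (c + t * Complex.I : ℂ))
    (g := integrand q χ X) hd.continuousAt (by fun_prop)

/-- The vertical integrals are absolutely convergent, and `O(X^c)`. -/
lemma exists_integrable_vertical (χ : DirichletCharacter ℂ m) {c : ℝ} (hc : -(1 / 2) < c)
    (hc2 : c ≤ 2) (hc0 : c ≠ 0) (hc1 : c ≠ 1) : ∃ C : ℝ, 0 < C ∧ ∀ X : ℝ, 0 < X →
      MeasureTheory.Integrable (fun t : ℝ => integrand q χ X (c + t * Complex.I)) ∧
      ‖∫ t : ℝ, integrand q χ X (c + t * Complex.I)‖ ≤ C * X ^ c := by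
  obtain ⟨C, hC, h⟩ := exists_decay_vertical q χ hc hc2 hc0 hc1
  have hI : 0 ≤ ∫ t : ℝ, Real.exp (-(|t| / 2)) :=
    MeasureTheory.integral_nonneg fun t => (Real.exp_pos _).le
  refine ⟨C * (∫ t : ℝ, Real.exp (-(|t| / 2))) + 1, by positivity, fun X hX => ?_⟩
  have hb : ∀ t : ℝ, ‖integrand q χ X (c + t * Complex.I)‖ ≤
      C * X ^ c * Real.exp (-(|t| / 2)) := fun t =>
    norm_integrand_le q χ hX (h t) (by rw [line_re])
  have hi := integrable_exp_neg_abs_div.const_mul (C * X ^ c)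
  refine ⟨hi.mono' (continuous_integrand_vertical q χ hX hc hc0 hc1).aestronglyMeasurable
    (Eventually.of_forall hb), ?_⟩
  refine (MeasureTheory.norm_integral_le_of_norm_le hi (Eventually.of_forall hb)).trans ?_
  rw [MeasureTheory.integral_const_mul]
  have : 0 < X ^ c := by positivity
  nlinarith

/-- The sum over zeros converges, and the integral along `Re s = c` equals the sum of the residues
to the left of that line up to the contribution of the edge near `Re s = -1`. -/
theorem exists_tendsto_partialZeroSum (χ : DirichletCharacter ℂ m) {ε c : ℝ} (hε : 0 < ε)
    (hc : -(1 / 2) < c) (hc2 : c ≤ 2) (hc0 : c ≠ 0) (hc1 : c ≠ 1) {P : Finset ℂ}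
    (hP1 : ∀ z ∈ P, z.im = 0 ∧ -(1 / 2) ≤ z.re ∧ z.re < c)
    (hP2 : ∀ z : ℂ, z = 1 ∨ z = 0 ∨ z = -1 / 2 → z ∈ P ∨ c < z.re) :
    ∃ C : ℝ, 0 < C ∧ ∀ X w : ℝ, 0 < X → (∀ u ∈ Set.Icc (-1 : ℝ) (-1 + ε), X ^ u ≤ w) →
      ∃ Z : ℂ, Tendsto (fun T => partialZeroSum q χ X T) (heights (χ ^ 2)) (𝓝 Z) ∧
        ‖Complex.I * (∫ t : ℝ, integrand q χ X (c + t * Complex.I)) -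
          2 * Real.pi * Complex.I * (Z + ∑ z ∈ P, residue (integrand q χ X) z)‖ ≤ C * w := by
  obtain ⟨θ, hθε, hθ⟩ := exists_isMargin (χ ^ 2) hε
  obtain ⟨C, hC, hleft⟩ := exists_tendsto_leftIntegral q hθ
  obtain ⟨C₁, hC₁, hvert⟩ := exists_integrable_vertical q χ hc hc2 hc0 hc1
  refine ⟨C, hC, fun X w hX hw => ?_⟩
  obtain ⟨l, hl, hlw⟩ := hleft X w hX fun u hu => hw u ⟨hu.1, by linarith [hu.2]⟩
  have hinf : Tendsto (fun T : ℝ => T / 2) (heights (χ ^ 2)) atTop :=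
    (tendsto_id.atTop_div_const (by norm_num)).mono_left inf_le_left
  have hV : Tendsto (fun T : ℝ => ∫ t in (-(T / 2))..(T / 2),
      integrand q χ X (c + t * Complex.I)) (heights (χ ^ 2))
      (𝓝 (∫ t : ℝ, integrand q χ X (c + t * Complex.I))) :=
    MeasureTheory.intervalIntegral_tendsto_integral (hvert X hX).1
      (tendsto_neg_atTop_atBot.comp hinf) hinf
  have hB := tendsto_horizontal q hθ hX hc hc2 (-1) (by simp)
  have hU := tendsto_horizontal q hθ hX hc hc2 1 (by simp)
  set V := ∫ t : ℝ, integrand q χ X (c + t * Complex.I)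
  set R := ∑ z ∈ P, residue (integrand q χ X) z
  have hpi : (2 * Real.pi * Complex.I : ℂ) ≠ 0 := Complex.two_pi_I_ne_zero
  -- the residue theorem at height `T`, solved for the partial sum over zeros, in the limit
  have hmain := (((hB.sub hU).add (hV.const_mul Complex.I)).sub (hl.const_mul Complex.I)).const_mul
    (2 * Real.pi * Complex.I : ℂ)⁻¹ |>.sub_const R
  refine ⟨(2 * Real.pi * Complex.I : ℂ)⁻¹ * (0 - 0 + Complex.I * V - Complex.I * l) - R,
    hmain.congr' ?_, ?_⟩
  · filter_upwards [eventually_heights (χ ^ 2) 8] with T ⟨hT, hadm⟩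
    have h := rectIntegral_integrand q hθ hX (by linarith) hadm hc hP1 hP2
    rw [rectIntegral] at h
    simp only [neg_mul, one_mul]
    rw [leftIntegral, h, inv_mul_cancel_left₀ hpi]
    ring
  · have e : Complex.I * V - 2 * Real.pi * Complex.I * ((2 * Real.pi * Complex.I : ℂ)⁻¹ *
        (0 - 0 + Complex.I * V - Complex.I * l) - R + R) = Complex.I * l := by
      rw [sub_add_cancel, mul_inv_cancel_left₀ hpi]
      ring
    rw [e, norm_mul, Complex.norm_I, one_mul]
    exact hlw

end Limit

end SingularSeries

namespace SingularSeries

/-! ### The singular series of a pair -/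

section Pair

/-- The local factor at `p` of the singular series of `{0, h}`, for `p ∤ q`. -/
noncomputable def pairFactor (q h p : ℕ) : ℝ :=
  if p ∣ q then 1
  else 1 - 1 / ((p : ℝ) - 1) ^ 2 + if p ∣ h then (p : ℝ) / ((p : ℝ) - 1) ^ 2 else 0

lemma singularSeries_empty (q : ℕ) : singularSeries q ∅ = 1 := by
  simp [singularSeries]

lemma one_sub_one_div_prime_ne_zero (p : Nat.Primes) : (1 : ℝ) - 1 / ((p : ℕ) : ℝ) ≠ 0 := by
  have h : (1 : ℝ) < (p : ℕ) := by exact_mod_cast p.2.one_lt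
  have h2 : 1 / ((p : ℕ) : ℝ) < 1 := by rw [div_lt_one (by linarith)]; exact h
  linarith

lemma singularSeries_singleton (q : ℕ) (a : ℤ) : singularSeries q {a} = 1 := by
  have h : ∀ p : Nat.Primes, (1 : ℝ) - ((p : ℕ) : ℝ)⁻¹ ≠ 0 := fun p => by
    simpa using one_sub_one_div_prime_ne_zero p
  simp [singularSeries, div_self (h _)]

lemma singularSeries_pair (q : ℕ) {h : ℕ} (hh : h ≠ 0) :
    singularSeries q {0, (h : ℤ)} = ∏' p : Nat.Primes, pairFactor q h p := by
  rw [singularSeries]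
  refine tprod_congr fun p => ?_
  rw [pairFactor]
  split_ifs with h1 h2
  · rfl
  all_goals
    have hp1 : (1 : ℝ) < (p : ℕ) := by exact_mod_cast p.2.one_lt
    have hp2 : ((p : ℕ) : ℝ) ≠ 0 := by linarith
    have hp3 : ((p : ℕ) : ℝ) - 1 ≠ 0 := by linarith
    have hcard : ({0, (h : ℤ)} : Finset ℤ).card = 2 :=
      Finset.card_pair (by exact_mod_cast hh.symm)
    rw [hcard, Finset.image_insert, Finset.image_singleton]
    have hz : ((h : ℤ) : ZMod (p : ℕ)) = 0 ↔ (p : ℕ) ∣ h := by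
      rw [Int.cast_natCast, ZMod.natCast_eq_zero_iff]
  · rw [hz.mpr h2]
    simp
    field_simp
    ring
  · rw [Finset.card_pair (by rw [Int.cast_zero]; exact fun h3 => h2 (hz.mp h3.symm))]
    push_cast
    field_simp
    ring

lemma modifiedSingularSeries_pair (q : ℕ) {h : ℕ} (hh : h ≠ 0) :
    modifiedSingularSeries q {0, (h : ℤ)} = singularSeries q {0, (h : ℤ)} - 1 := by
  have h0 : (0 : ℤ) ≠ h := by exact_mod_cast hh.symm
  have e1 : ({0, (h : ℤ)} : Finset ℤ) \ {(h : ℤ)} = {0} := by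
    ext x; simp; grind
  have e2 : ({0, (h : ℤ)} : Finset ℤ) \ {0} = {(h : ℤ)} := by
    ext x; simp; grind
  rw [modifiedSingularSeries, Finset.sum_powerset_insert (by simpa using h0)]
  rw [← insert_empty_eq (h : ℤ), Finset.sum_powerset_insert (by simp),
    Finset.sum_powerset_insert (by simp)]
  simp only [insert_empty_eq, Finset.powerset_empty, Finset.sum_singleton, singularSeries_empty,
    singularSeries_singleton, e1, e2, Finset.sdiff_self, Finset.sdiff_empty, Finset.card_empty,
    Finset.card_singleton, Finset.card_pair h0]
  ring

lemma pairFactor_nonneg_le (q h : ℕ) {p : ℕ} (hp : p.Prime) :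
    0 ≤ pairFactor q h p ∧ pairFactor q h p ≤ if p ∣ h then 2 else 1 := by
  have hp2 : (2 : ℝ) ≤ p := by exact_mod_cast hp.two_le
  have h1 : 1 ≤ ((p : ℝ) - 1) ^ 2 := by nlinarith
  have h2 : 1 / ((p : ℝ) - 1) ^ 2 ≤ 1 := by rw [div_le_one (by linarith)]; exact h1
  have h3 : 0 < 1 / ((p : ℝ) - 1) ^ 2 := by positivity
  rw [pairFactor]
  split_ifs with a b b
  · norm_num
  · norm_num
  · have e : 1 - 1 / ((p : ℝ) - 1) ^ 2 + (p : ℝ) / ((p : ℝ) - 1) ^ 2 = 1 + 1 / ((p : ℝ) - 1) := by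
      have : (p : ℝ) - 1 ≠ 0 := by linarith
      field_simp
      ring
    have h4 : 1 / ((p : ℝ) - 1) ≤ 1 := by rw [div_le_one (by linarith)]; linarith
    have h5 : 0 < 1 / ((p : ℝ) - 1) := one_div_pos.mpr (by linarith)
    rw [e]
    constructor <;> linarith
  · constructor <;> linarith

lemma two_pow_card_primeFactors_le {h : ℕ} (hh : h ≠ 0) :
    2 ^ h.primeFactors.card ≤ h.divisors.card := by
  rw [Nat.card_divisors hh]
  refine Finset.pow_card_le_prod _ _ _ fun p hp => ?_
  have hp' := Nat.prime_of_mem_primeFactors hp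
  have := hp'.factorization_pos_of_dvd hh (Nat.dvd_of_mem_primeFactors hp)
  lia

/-- Uniformly in `S`, hence a majorant for passing to the limit over finite sets of primes. -/
lemma prod_pairFactor_nonneg_le (q : ℕ) {h : ℕ} (hh : h ≠ 0) (S : Finset Nat.Primes) :
    0 ≤ ∏ p ∈ S, pairFactor q h p ∧ ∏ p ∈ S, pairFactor q h p ≤ h.divisors.card := by
  refine ⟨Finset.prod_nonneg fun p _ => (pairFactor_nonneg_le q h p.2).1, ?_⟩
  calc ∏ p ∈ S, pairFactor q h p ≤ ∏ p ∈ S, (if (p : ℕ) ∣ h then 2 else 1 : ℝ) :=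
        Finset.prod_le_prod (fun p _ => (pairFactor_nonneg_le q h p.2).1)
          fun p _ => (pairFactor_nonneg_le q h p.2).2
    _ = 2 ^ (S.filter fun p : Nat.Primes => (p : ℕ) ∣ h).card := by
        rw [Finset.prod_ite, Finset.prod_const, Finset.prod_const_one, mul_one]
    _ ≤ 2 ^ h.primeFactors.card := by
        refine pow_le_pow_right₀ (by norm_num) ?_
        refine Finset.card_le_card_of_injOn (fun p => (p : ℕ)) (fun p hp => ?_)
          (fun a _ b _ hab => Subtype.ext hab)
        have := (Finset.mem_filter.mp hp).2
        simp [p.2, this, hh]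
    _ ≤ h.divisors.card := by exact_mod_cast two_pow_card_primeFactors_le hh

lemma hasProd_pairFactor (q : ℕ) {h : ℕ} (hh : h ≠ 0) :
    HasProd (fun p : Nat.Primes => pairFactor q h p) (singularSeries q {0, (h : ℤ)}) := by
  rw [singularSeries_pair q hh]
  have hs : Summable fun p : Nat.Primes => ‖pairFactor q h p - 1‖ := by
    have h1 : Summable fun p : Nat.Primes => if (p : ℕ) ∣ h then (1 : ℝ) else 0 := by
      refine summable_of_hasFiniteSupport (Set.Finite.subset
        (Set.Finite.preimage (Function.Injective.injOn Subtype.val_injective)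
          (Set.finite_le_nat h)) fun p hp => ?_)
      have : (p : ℕ) ∣ h := by
        by_contra hcon
        exact hp (if_neg hcon)
      exact Nat.le_of_dvd (Nat.pos_of_ne_zero hh) this
    have h2 := (primes_tsum_rpow_le one_pos).1.mul_left 4
    refine Summable.of_nonneg_of_le (fun _ => norm_nonneg _) (fun p => ?_) (h1.add h2)
    have hp2 : (2 : ℝ) ≤ (p : ℕ) := by exact_mod_cast p.2.two_le
    have e2 : ((p : ℕ) : ℝ) ^ (-(1 + 1) : ℝ) = 1 / ((p : ℕ) : ℝ) ^ 2 := by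
      rw [Real.rpow_neg (by linarith), one_div]
      norm_num
    have h0 := pairFactor_nonneg_le q h p.2
    have h5 : 0 < 4 * ((p : ℕ) : ℝ) ^ (-(1 + 1) : ℝ) := by positivity
    rw [Real.norm_eq_abs, abs_le]
    by_cases hd : (p : ℕ) ∣ h
    · rw [if_pos hd] at h0 ⊢
      constructor <;> linarith
    · rw [if_neg hd] at h0 ⊢
      refine ⟨?_, by linarith⟩
      rw [pairFactor, if_neg hd]
      split_ifs
      · linarith
      · rw [e2]
        have : 1 / (((p : ℕ) : ℝ) - 1) ^ 2 ≤ 1 / (((p : ℕ) : ℝ) ^ 2 / 4) := by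
          gcongr
          nlinarith
        have e3 : 1 / (((p : ℕ) : ℝ) ^ 2 / 4) = 4 * (1 / ((p : ℕ) : ℝ) ^ 2) := by
          field_simp
        linarith
  have := (multipliable_one_add_of_summable hs).hasProd
  simpa using this

lemma singularSeries_pair_nonneg_le (q : ℕ) {h : ℕ} (hh : h ≠ 0) :
    0 ≤ singularSeries q {0, (h : ℤ)} ∧ singularSeries q {0, (h : ℤ)} ≤ h.divisors.card :=
  ⟨ge_of_tendsto' (hasProd_pairFactor q hh) fun S => (prod_pairFactor_nonneg_le q hh S).1,
    le_of_tendsto' (hasProd_pairFactor q hh) fun S => (prod_pairFactor_nonneg_le q hh S).2⟩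

/-- The divisor function is the Dirichlet convolution of the constant `1` with itself. -/
lemma summable_divisors_rpow {σ : ℝ} (hσ : 1 < σ) :
    Summable fun n : ℕ => (n.divisors.card : ℝ) * (n : ℝ) ^ (-σ) := by
  have h1 : LSeriesSummable (1 : ℕ → ℂ) (σ : ℂ) := LSeriesSummable_one_iff.mpr (by simpa using hσ)
  have h2 := (h1.convolution h1).norm
  refine h2.congr fun n => ?_
  rcases eq_or_ne n 0 with rfl | hn
  · simp
  rw [LSeries.norm_term_eq, if_neg hn, LSeries.convolution_def]
  simp only [Pi.one_apply, mul_one, Finset.sum_const, nsmul_eq_mul, Complex.ofReal_re,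
    Complex.norm_natCast]
  rw [Real.rpow_neg (by positivity), ← Nat.map_div_right_divisors, Finset.card_map, div_eq_mul_inv]

end Pair

/-! ### Euler products for `F` -/

section Euler

variable (q : ℕ) {m : ℕ} (χ : DirichletCharacter ℂ m)

/-- The deviation from `1` of the local factor at `p ∤ q` of `F(s) / (L(s,χ) L(s+1,χ))`. -/
noncomputable def squareTerm (p : ℕ) (s : ℂ) : ℂ :=
  if p ∣ q then 0 else -((1 - χ (p : ZMod m) * (p : ℂ) ^ (-s)) ^ 2 / ((p : ℂ) - 1) ^ 2)

/-- The quotient `F(s) / (L(s,χ) L(s+1,χ))` as a product that converges for `Re s > -1/2`. -/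
noncomputable def regularPart (s : ℂ) : ℂ :=
  (∏ p ∈ q.primeFactors, (1 - χ (p : ZMod m) * (p : ℂ) ^ (-(s + 1)))) *
    ∏' p : Nat.Primes, (1 + squareTerm q χ p s)

lemma regularPart_zero : regularPart q χ 0 = eulerConstant q χ := by
  rw [regularPart, eulerConstant]
  congr 1
  · refine Finset.prod_congr rfl fun p _ => ?_
    rw [zero_add, Complex.cpow_neg_one, div_eq_mul_inv]
  · refine tprod_congr fun p => ?_
    rw [squareTerm]
    split_ifs
    · simp
    · simp [sub_eq_add_neg]

variable {q χ}

/-- The term has size `|p^{-s}|² / p²`, so for `Re s ≥ -(1 - η)/2` it is summable over primes. -/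
lemma norm_squareTerm_le {p : ℕ} (hp : p.Prime) {s : ℂ} {η : ℝ} (hη1 : η ≤ 1)
    (hs : -((1 - η) / 2) ≤ s.re) : ‖squareTerm q χ p s‖ ≤ 16 * (p : ℝ) ^ (-(1 + η)) := by
  have hp2 : (2 : ℝ) ≤ p := by exact_mod_cast hp.two_le
  have hp0 : (0 : ℝ) < p := by linarith
  rw [squareTerm]
  split_ifs
  · rw [norm_zero]; positivity
  have hn : ‖(p : ℂ) - 1‖ = p - 1 := by
    rw [show (p : ℂ) - 1 = ((p - 1 : ℝ) : ℂ) by push_cast; rfl, Complex.norm_real,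
      Real.norm_of_nonneg (by linarith)]
  have hsq : (p : ℝ) ^ 2 / 4 ≤ (p - 1) ^ 2 := by nlinarith
  rw [norm_neg, norm_div, norm_pow, norm_pow, hn]
  have h1 : ‖1 - χ (p : ZMod m) * (p : ℂ) ^ (-s)‖ ≤ 2 * (p : ℝ) ^ ((1 - η) / 2) := by
    refine (norm_sub_le _ _).trans ?_
    rw [norm_one, norm_mul, norm_natCast_cpow hp, Complex.neg_re]
    have h2 : (1 : ℝ) ≤ (p : ℝ) ^ ((1 - η) / 2) := Real.one_le_rpow (by linarith) (by linarith)
    have h3 : (p : ℝ) ^ (-s.re) ≤ (p : ℝ) ^ ((1 - η) / 2) :=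
      Real.rpow_le_rpow_of_exponent_le (by linarith) (by linarith)
    have h4 : ‖χ (p : ZMod m)‖ * (p : ℝ) ^ (-s.re) ≤ 1 * (p : ℝ) ^ ((1 - η) / 2) := by
      gcongr
      exact χ.norm_le_one _
    linarith
  calc _ ≤ (2 * (p : ℝ) ^ ((1 - η) / 2)) ^ 2 / ((p : ℝ) ^ 2 / 4) := by gcongr
    _ = 16 * ((p : ℝ) ^ (1 - η) / (p : ℝ) ^ (2 : ℝ)) := by
        rw [mul_pow, ← Real.rpow_natCast (_ ^ _), ← Real.rpow_mul hp0.le]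
        norm_num
        ring
    _ = _ := by
        rw [← Real.rpow_sub hp0]
        ring_nf

lemma summable_squareTerm {s : ℂ} (hs : -(1 / 2) < s.re) :
    Summable fun p : Nat.Primes => ‖squareTerm q χ p s‖ := by
  have hη : 0 < min 1 (2 * s.re + 1) := lt_min one_pos (by linarith)
  refine Summable.of_nonneg_of_le (fun _ => norm_nonneg _) (fun p => norm_squareTerm_le p.2
    (min_le_left _ _) ?_) ((primes_tsum_rpow_le hη).1.mul_left 16)
  linarith [min_le_right 1 (2 * s.re + 1)]

lemma differentiable_squareTerm {p : ℕ} (hp : p.Prime) : Differentiable ℂ (squareTerm q χ p) := by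
  unfold squareTerm
  split_ifs with h
  · exact differentiable_const _
  · have h1 : Differentiable ℂ fun s : ℂ => (p : ℂ) ^ (-s) :=
      differentiable_natCast_cpow hp.ne_zero (by fun_prop)
    fun_prop

variable (q χ)

lemma hasProdLocallyUniformlyOn_squareTerm :
    HasProdLocallyUniformlyOn (fun (p : Nat.Primes) s => 1 + squareTerm q χ p s)
      (fun s => ∏' p : Nat.Primes, (1 + squareTerm q χ p s)) {s : ℂ | -(1 / 2) < s.re} := by
  refine hasProdLocallyUniformlyOn_one_add_of_nhds
    (fun p => (differentiable_squareTerm p.2).differentiableOn) fun z hz => ?_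
  have hz' : -(1 / 2) < z.re := hz
  have hη : 0 < min 1 (z.re + 1 / 2) := lt_min one_pos (by linarith)
  refine ⟨{s | (z.re - 1 / 2) / 2 < s.re}, isOpen_re_gt _, ?_, fun s hs => ?_, _,
    (primes_tsum_rpow_le hη).1.mul_left 16, fun p w hw => norm_squareTerm_le p.2
      (min_le_left _ _) ?_⟩
  · rw [Set.mem_ofPred_eq]; linarith
  · rw [Set.mem_ofPred_eq] at hs ⊢; linarith
  · rw [Set.mem_ofPred_eq] at hw
    linarith [min_le_right 1 (z.re + 1 / 2)]

lemma differentiableOn_regularPart :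
    DifferentiableOn ℂ (regularPart q χ) {s : ℂ | -(1 / 2) < s.re} := by
  refine DifferentiableOn.mul (Differentiable.differentiableOn ?_) ?_
  · refine Differentiable.fun_finsetProd fun p hp => ?_
    have h1 : Differentiable ℂ fun s : ℂ => (p : ℂ) ^ (-(s + 1)) :=
      differentiable_natCast_cpow (Nat.prime_of_mem_primeFactors hp).ne_zero (by fun_prop)
    fun_prop
  · have h := hasProdLocallyUniformlyOn_iff_tendstoLocallyUniformlyOn.mp
      (hasProdLocallyUniformlyOn_squareTerm q χ)
    refine h.differentiableOn (Eventually.of_forall fun S => ?_) (isOpen_re_gt _)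
    exact DifferentiableOn.fun_finsetProd fun p _ =>
      ((differentiable_squareTerm p.2).const_add 1).differentiableOn

lemma hasProd_regularPart (hq : q ≠ 0) {s : ℂ} (hs : -(1 / 2) < s.re) :
    HasProd (fun p : Nat.Primes => (if (p : ℕ) ∣ q then
      1 - χ ((p : ℕ) : ZMod m) * ((p : ℕ) : ℂ) ^ (-(s + 1)) else 1) * (1 + squareTerm q χ p s))
      (regularPart q χ s) :=
  (hasProd_primeFactors hq fun p => 1 - χ (p : ZMod m) * (p : ℂ) ^ (-(s + 1))).mul
    (multipliable_one_add_of_summable (summable_squareTerm hs)).hasProd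

end Euler

end SingularSeries

namespace SingularSeries

section Dirichlet

variable {q : ℕ} {m : ℕ} [NeZero m] {χ : DirichletCharacter ℂ m}

omit [NeZero m] in
lemma sq_apply (n : ℕ) : (χ ^ 2) (n : ZMod m) = χ (n : ZMod m) ^ 2 :=
  MulChar.pow_apply' χ two_ne_zero _

omit [NeZero m] in
lemma cpow_sub_ne_zero {p : ℕ} (hp : p.Prime) {s : ℂ} (hs : -1 < s.re) :
    (p : ℂ) ^ (s + 1) - χ (p : ZMod m) ≠ 0 := by
  intro h
  have h1 := congrArg norm (sub_eq_zero.mp h)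
  rw [norm_natCast_cpow hp, Complex.add_re, Complex.one_re] at h1
  have h2 : (1 : ℝ) < (p : ℝ) ^ (s.re + 1) :=
    Real.one_lt_rpow (by exact_mod_cast hp.one_lt) (by linarith)
  linarith [χ.norm_le_one (p : ZMod m)]

lemma one_sub_inv_sq {P c : ℂ} (hP : P ≠ 0) (_ : P + c ≠ 0) (_ : P - c ≠ 0) :
    (1 - c ^ 2 * P⁻¹ ^ 2)⁻¹ = P ^ 2 / ((P + c) * (P - c)) := by
  rw [show 1 - c ^ 2 * P⁻¹ ^ 2 = (P + c) * (P - c) / P ^ 2 by field_simp; ring, inv_div]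

/-- An identity between the local Euler factors at every prime. It exhibits the denominator
`L(2s+2, χ²)` of `F`, which is needed only for `Re s ≤ -1/2`. -/
lemma badProduct_mul_primeProduct (hq : q ≠ 0) {s : ℂ} (hs : -(1 / 2) < s.re) :
    badProduct q χ s * primeProduct q χ s =
      (χ ^ 2).LFunction (2 * s + 2) * regularPart q χ s := by
  have hre : 1 < (2 * s + 2).re := by simp; linarith
  have hs1 : -1 < s.re := by linarith
  have h1 := (hasProd_primeFactors hq fun p => (1 + χ (p : ZMod m) / (p : ℂ) ^ (s + 1))⁻¹).mul
    (multipliable_one_add_of_summable (f := fun p : Nat.Primes => localTerm q χ p s)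
      (Summable.of_nonneg_of_le (fun p => norm_nonneg _)
        (fun p : Nat.Primes => norm_localTerm_le (q := q) (χ := χ) p.2
          (show 0 < s.re + 1 by linarith) le_rfl)
        (summable_localTerm_bound (by linarith)))).hasProd
  have h2 := (DirichletCharacter.LSeries_eulerProduct_hasProd (χ ^ 2) hre).mul
    (hasProd_regularPart q χ hq hs)
  rw [← DirichletCharacter.LFunction_eq_LSeries _ hre] at h2
  refine h1.unique (h2.congr_fun fun p => ?_)
  have hp0 : ((p : ℕ) : ℂ) ≠ 0 := by exact_mod_cast p.2.ne_zero
  have hp1 : ((p : ℕ) : ℂ) - 1 ≠ 0 := sub_ne_zero.mpr (by exact_mod_cast p.2.one_lt.ne')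
  have hP : ((p : ℕ) : ℂ) ^ (s + 1) ≠ 0 := by simp [Complex.cpow_eq_zero_iff, hp0]
  have ha := cpow_add_ne_zero (χ := χ) p.2 hs1
  have hb := cpow_sub_ne_zero (χ := χ) p.2 hs1
  have e1 : ((p : ℕ) : ℂ) ^ (-(2 * s + 2)) = (((p : ℕ) : ℂ) ^ (s + 1))⁻¹ ^ 2 := by
    rw [Complex.cpow_neg, show 2 * s + 2 = (s + 1) + (s + 1) by ring, Complex.cpow_add _ _ hp0]
    field_simp
  have e2 : ((p : ℕ) : ℂ) ^ (-(s + 1)) = (((p : ℕ) : ℂ) ^ (s + 1))⁻¹ := Complex.cpow_neg _ _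
  have e3 : ((p : ℕ) : ℂ) ^ (-s) = (p : ℕ) * (((p : ℕ) : ℂ) ^ (s + 1))⁻¹ := by
    rw [Complex.cpow_add _ _ hp0, Complex.cpow_neg, Complex.cpow_one]
    field_simp
  rw [sq_apply, e1, e2, one_sub_inv_sq hP ha hb]
  simp only [localTerm, squareTerm]
  rw [e3]
  generalize ((p : ℕ) : ℂ) ^ (s + 1) = P at hP ha hb ⊢
  generalize χ ((p : ℕ) : ZMod m) = c at ha hb ⊢
  split_ifs
  · rw [add_zero, mul_one, mul_one]
    rw [show 1 + c / P = (P + c) / P by field_simp, inv_div]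
    field_simp
  · field_simp
    ring

lemma F_eq_mul_regularPart (hq : q ≠ 0) {s : ℂ} (hs : -(1 / 2) < s.re) :
    F q χ s = χ.LFunction s * χ.LFunction (s + 1) * regularPart q χ s := by
  have hre : 1 < (2 * s + 2).re := by simp; linarith
  have hL : (χ ^ 2).LFunction (2 * s + 2) ≠ 0 :=
    DirichletCharacter.LFunction_ne_zero_of_one_le_re _
      (Or.inr fun h => by rw [h] at hre; simp at hre) hre.le
  rw [F_eq, mul_assoc _ (badProduct q χ s), badProduct_mul_primeProduct hq hs]
  generalize (χ ^ 2).LFunction (2 * s + 2) = l at hL ⊢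
  field_simp

/-- The local factor at `p` of the Dirichlet series with coefficients `χ(h) 𝔖_q({0,h})`, divided
by that of `L(s,χ)`. -/
noncomputable def seriesFactor (q : ℕ) (χ : DirichletCharacter ℂ m) (s : ℂ) (p : ℕ) : ℂ :=
  if p ∣ q then 1
  else 1 - 1 / ((p : ℂ) - 1) ^ 2 +
    (p : ℂ) / ((p : ℂ) - 1) ^ 2 * (χ (p : ZMod m) * ((p : ℂ) ^ s)⁻¹)

lemma hasProd_seriesFactor (hq : q ≠ 0) {s : ℂ} (hs : 0 < s.re) :
    HasProd (fun p : Nat.Primes => seriesFactor q χ s p)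
      (χ.LFunction (s + 1) * regularPart q χ s) := by
  have hre : 1 < (s + 1).re := by simp; linarith
  have h2 := (DirichletCharacter.LSeries_eulerProduct_hasProd χ hre).mul
    (hasProd_regularPart q χ hq (show -(1 / 2) < s.re by linarith))
  rw [← DirichletCharacter.LFunction_eq_LSeries _ hre] at h2
  refine h2.congr_fun fun p => ?_
  have hp0 : ((p : ℕ) : ℂ) ≠ 0 := by exact_mod_cast p.2.ne_zero
  have hp1 : ((p : ℕ) : ℂ) - 1 ≠ 0 := sub_ne_zero.mpr (by exact_mod_cast p.2.one_lt.ne')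
  have hP : ((p : ℕ) : ℂ) ^ s ≠ 0 := by simp [Complex.cpow_eq_zero_iff, hp0]
  have hb := cpow_sub_ne_zero (χ := χ) p.2 (show -1 < s.re by linarith)
  have e0 : ((p : ℕ) : ℂ) ^ (s + 1) = ((p : ℕ) : ℂ) ^ s * (p : ℕ) := by
    rw [Complex.cpow_add _ _ hp0, Complex.cpow_one]
  simp only [seriesFactor, squareTerm]
  rw [Complex.cpow_neg, Complex.cpow_neg, e0]
  rw [e0] at hb
  generalize ((p : ℕ) : ℂ) ^ s = P at hP hb ⊢
  generalize χ ((p : ℕ) : ZMod m) = c at hb ⊢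
  rw [show 1 - c * (P * ((p : ℕ) : ℂ))⁻¹ = (P * (p : ℕ) - c) / (P * (p : ℕ)) by field_simp, inv_div]
  -- the nonvanishing denominator `P p - c` becomes an atom `D` for `field_simp`
  obtain ⟨D, rfl⟩ : ∃ D, c = P * (p : ℕ) - D := ⟨P * (p : ℕ) - c, by ring⟩
  rw [sub_sub_cancel] at hb ⊢
  split_ifs
  · field_simp
    ring
  · field_simp
    ring

lemma pairFactor_mul {h p r : ℕ} (hp : p.Prime) (hr : r.Prime) (hpr : r ≠ p) :
    pairFactor q (p * h) r = pairFactor q h r := by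
  have : r ∣ p * h ↔ r ∣ h := by
    rw [hr.dvd_mul, Nat.prime_dvd_prime_iff_eq hr hp, or_iff_right hpr]
  simp only [pairFactor, this]

/-- The Dirichlet series in which only the primes of `S` enter the singular series. By induction on
`S`: the factor at a new prime `p ∤ q` is a combination of `1` and the indicator of the multiples of
`p`, and restricting the previous series to the multiples of `p` multiplies it by `χ(p) p^{-s}`. -/
lemma hasSum_truncated {s : ℂ} (hs : 1 < s.re) (S : Finset Nat.Primes) :
    LSeriesHasSum (fun h : ℕ => χ (h : ZMod m) * ((∏ p ∈ S, pairFactor q h p : ℝ) : ℂ)) s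
      (χ.LFunction s * ∏ p ∈ S, seriesFactor q χ s p) := by
  classical
  induction S using Finset.induction_on with
  | empty =>
    have := DirichletCharacter.LSeriesSummable_of_one_lt_re χ hs
    simp only [Finset.prod_empty, Complex.ofReal_one, mul_one]
    rw [DirichletCharacter.LFunction_eq_LSeries _ hs]
    exact this.LSeriesHasSum
  | insert p S hpS ih =>
    set g : ℕ → ℂ := LSeries.term
      (fun h : ℕ => χ (h : ZMod m) * ((∏ p ∈ S, pairFactor q h p : ℝ) : ℂ)) s with hg
    have ih' : HasSum g (χ.LFunction s * ∏ p ∈ S, seriesFactor q χ s p) := ih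
    have hp0 : ((p : ℕ) : ℂ) ≠ 0 := by exact_mod_cast p.2.ne_zero
    have hmulti : HasSum (fun h : ℕ => if (p : ℕ) ∣ h then g h else 0)
        (χ ((p : ℕ) : ZMod m) * (((p : ℕ) : ℂ) ^ s)⁻¹ *
          (χ.LFunction s * ∏ p ∈ S, seriesFactor q χ s p)) := by
      have hinj : Function.Injective fun k : ℕ => (p : ℕ) * k :=
        fun a b h => Nat.eq_of_mul_eq_mul_left p.2.pos h
      rw [← hinj.hasSum_iff]
      · refine (ih'.mul_left _).congr_fun fun k => ?_
        simp only [Function.comp_apply, dvd_mul_right, if_true, hg]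
        rcases eq_or_ne k 0 with rfl | hk
        · simp
        rw [LSeries.term_of_ne_zero (mul_ne_zero p.2.ne_zero hk), LSeries.term_of_ne_zero hk]
        have e : ∏ r ∈ S, pairFactor q (p * k) r = ∏ r ∈ S, pairFactor q k r :=
          Finset.prod_congr rfl fun r hr => pairFactor_mul p.2 r.2 fun h =>
            hpS (Subtype.ext h ▸ hr)
        rw [e]
        push_cast
        rw [map_mul, Complex.natCast_mul_natCast_cpow]
        have hP : ((p : ℕ) : ℂ) ^ s ≠ 0 := by simp [Complex.cpow_eq_zero_iff, hp0]
        have hk0 : (k : ℂ) ^ s ≠ 0 := by simp [Complex.cpow_eq_zero_iff, hk]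
        field_simp
      · intro x hx
        exact if_neg fun ⟨k, hk⟩ => hx ⟨k, hk.symm⟩
    rw [Finset.prod_insert hpS]
    by_cases hpq : (p : ℕ) ∣ q
    · simp only [Finset.prod_insert hpS]
      simp only [seriesFactor, pairFactor, if_pos hpq, one_mul]
      exact ih
    · have hsum := (ih'.mul_left (1 - 1 / (((p : ℕ) : ℂ) - 1) ^ 2)).add
        (hmulti.mul_left (((p : ℕ) : ℂ) / (((p : ℕ) : ℂ) - 1) ^ 2))
      have e : LSeries.term (fun h : ℕ => χ (h : ZMod m) *
          ((∏ r ∈ insert p S, pairFactor q h r : ℝ) : ℂ)) s =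
          fun h => (1 - 1 / (((p : ℕ) : ℂ) - 1) ^ 2) * g h +
            ((p : ℕ) : ℂ) / (((p : ℕ) : ℂ) - 1) ^ 2 * if (p : ℕ) ∣ h then g h else 0 := by
        funext h
        rcases eq_or_ne h 0 with rfl | hh
        · simp [hg]
        simp only [hg]
        rw [LSeries.term_of_ne_zero hh, LSeries.term_of_ne_zero hh, Finset.prod_insert hpS,
          pairFactor, if_neg hpq]
        push_cast
        split_ifs <;> push_cast <;> ring
      have e2 : seriesFactor q χ s p = 1 - 1 / (((p : ℕ) : ℂ) - 1) ^ 2 + ((p : ℕ) : ℂ) /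
          (((p : ℕ) : ℂ) - 1) ^ 2 * (χ ((p : ℕ) : ZMod m) * (((p : ℕ) : ℂ) ^ s)⁻¹) := if_neg hpq
      rw [LSeriesHasSum, e, e2]
      refine Eq.subst (motive := fun a => HasSum _ a) ?_ hsum
      ring

/-- The limit of the truncated series, by dominated convergence with the divisor function as
majorant. -/
theorem LSeriesHasSum_F (hq : q ≠ 0) {s : ℂ} (hs : 1 < s.re) :
    LSeriesHasSum (fun h : ℕ => χ (h : ZMod m) * (singularSeries q {0, (h : ℤ)} : ℂ)) s
      (F q χ s) := by
  have hbound : ∀ (c : ℕ → ℝ), (∀ h ≠ 0, 0 ≤ c h ∧ c h ≤ h.divisors.card) → ∀ h : ℕ,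
      ‖LSeries.term (fun h : ℕ => χ (h : ZMod m) * (c h : ℂ)) s h‖ ≤
        h.divisors.card * (h : ℝ) ^ (-s.re) := by
    intro c hc h
    rw [LSeries.norm_term_eq]
    split_ifs with hh
    · subst hh; simp
    · have h1 := hc h hh
      rw [norm_mul, Complex.norm_real, Real.norm_of_nonneg h1.1, Real.rpow_neg (by positivity),
        ← div_eq_mul_inv]
      gcongr
      calc _ ≤ 1 * c h := by gcongr; exacts [h1.1, χ.norm_le_one _]
        _ ≤ _ := by rw [one_mul]; exact h1.2
  have hsum := summable_divisors_rpow hs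
  have hb1 := hbound (fun h => singularSeries q {0, (h : ℤ)})
    fun h hh => singularSeries_pair_nonneg_le q hh
  have hS : Summable (LSeries.term
      (fun h : ℕ => χ (h : ZMod m) * (singularSeries q {0, (h : ℤ)} : ℂ)) s) :=
    Summable.of_norm_bounded hsum hb1
  have hlim := tendsto_tsum_of_dominated_convergence (𝓕 := (atTop : Filter (Finset Nat.Primes)))
    (f := fun S => LSeries.term
      (fun h : ℕ => χ (h : ZMod m) * ((∏ p ∈ S, pairFactor q h p : ℝ) : ℂ)) s)
    (g := LSeries.term (fun h : ℕ => χ (h : ZMod m) * (singularSeries q {0, (h : ℤ)} : ℂ)) s)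
    hsum (fun h => by
      rcases eq_or_ne h 0 with rfl | hh
      · simp
      simp only [LSeries.term_of_ne_zero hh]
      have h1 : Tendsto (fun S : Finset Nat.Primes => ∏ p ∈ S, pairFactor q h p) atTop
          (𝓝 (singularSeries q {0, (h : ℤ)})) := hasProd_pairFactor q hh
      exact ((((Complex.continuous_ofReal.tendsto _).comp h1).const_mul _).div_const _))
    (Eventually.of_forall fun S => hbound _ fun h hh => prod_pairFactor_nonneg_le q hh S)
  have hlim2 : Tendsto (fun S : Finset Nat.Primes => χ.LFunction s *
      ∏ p ∈ S, seriesFactor q χ s p) atTop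
      (𝓝 (χ.LFunction s * (χ.LFunction (s + 1) * regularPart q χ s))) :=
    Tendsto.const_mul _ (hasProd_seriesFactor hq (by linarith))
  have heq : ∑' h, LSeries.term
      (fun h : ℕ => χ (h : ZMod m) * (singularSeries q {0, (h : ℤ)} : ℂ)) s h = F q χ s := by
    rw [F_eq_mul_regularPart hq (by linarith), mul_assoc]
    refine tendsto_nhds_unique hlim (hlim2.congr fun S => ?_)
    exact ((hasSum_truncated hs S).tsum_eq).symm
  exact heq ▸ hS.hasSum

end Dirichlet

end SingularSeries

namespace SingularSeries

/-! ### The Mellin transform of the smoothed series -/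

section Mellin

/-- From the exponential decay of `Γ` in vertical strips. -/
lemma integrable_Gamma_vertical {c : ℝ} (hc : 0 < c) :
    MeasureTheory.Integrable fun t : ℝ => Complex.Gamma (c + t * Complex.I) := by
  refine (integrable_exp_neg_abs_div.const_mul (√2 ^ c * Real.Gamma c)).mono' ?_
    (Eventually.of_forall fun t => ?_)
  · refine Continuous.aestronglyMeasurable (continuous_iff_continuousAt.mpr fun t => ?_)
    have hd : DifferentiableAt ℂ Complex.Gamma (c + t * Complex.I) :=
      Complex.differentiableAt_Gamma _ fun n h => by
        have := congrArg Complex.re h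
        simp at this
        linarith [n.cast_nonneg (α := ℝ)]
    exact ContinuousAt.comp (f := fun t : ℝ => (c + t * Complex.I : ℂ)) (g := Complex.Gamma)
      hd.continuousAt (by fun_prop)
  · have h := norm_Gamma_le (s := c + t * Complex.I) (by simpa using hc)
    rw [line_re, line_im] at h
    refine h.trans ?_
    have h1 : 0 ≤ √2 ^ c * Real.Gamma c := mul_nonneg (by positivity) (Real.Gamma_pos_of_pos hc).le
    refine mul_le_mul_of_nonneg_left (Real.exp_le_exp.mpr ?_) h1
    nlinarith [Real.pi_gt_three, abs_nonneg t]

/-- Mellin inversion for `exp`. -/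
lemma integral_cpow_mul_Gamma {c y : ℝ} (hc : 0 < c) (hy : 0 < y) :
    ∫ t : ℝ, (y : ℂ) ^ (-(c + t * Complex.I : ℂ)) * Complex.Gamma (c + t * Complex.I) =
      2 * Real.pi * (Real.exp (-y) : ℂ) := by
  set f : ℝ → ℂ := fun x => (Real.exp (-x) : ℂ) with hf
  have hmel : ∀ s : ℂ, 0 < s.re → mellin f s = Complex.Gamma s := fun s hs => by
    rw [Complex.Gamma_eq_integral hs, Complex.GammaIntegral_eq_mellin]
  have hΓ : (fun t : ℝ => mellin f (c + t * Complex.I)) =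
      fun t : ℝ => Complex.Gamma (c + t * Complex.I) := by
    funext t
    exact hmel _ (by simpa using hc)
  have hconv : MellinConvergent f (c : ℂ) := by
    have := Complex.GammaIntegral_convergent (s := c) (by simpa using hc)
    refine this.congr_fun (fun x _ => ?_) measurableSet_Ioi
    rw [hf, smul_eq_mul, mul_comm]
  have hvert : Complex.VerticalIntegrable (mellin f) c := by
    unfold Complex.VerticalIntegrable
    rw [hΓ]
    exact integrable_Gamma_vertical hc
  have h := mellinInv_mellin_eq c f hy hconv hvert
    (Continuous.continuousAt (by rw [hf]; fun_prop))
  rw [mellinInv] at h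
  have h2 : (∫ t : ℝ, (y : ℂ) ^ (-(c + t * Complex.I : ℂ)) • mellin f (c + t * Complex.I)) =
      ∫ t : ℝ, (y : ℂ) ^ (-(c + t * Complex.I : ℂ)) * Complex.Gamma (c + t * Complex.I) := by
    refine MeasureTheory.integral_congr_ae (Eventually.of_forall fun t => ?_)
    have := congrFun hΓ t
    simp only at this ⊢
    rw [this, smul_eq_mul]
  rw [h2] at h
  rw [hf] at h
  simp only at h
  rw [← h, Complex.real_smul]
  push_cast
  have hpi : (Real.pi : ℂ) ≠ 0 := by exact_mod_cast Real.pi_ne_zero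
  generalize (∫ t : ℝ, (y : ℂ) ^ (-(c + t * Complex.I : ℂ)) *
    Complex.Gamma (c + t * Complex.I)) = J
  field_simp

variable (q : ℕ) {m : ℕ} [NeZero m] (χ : DirichletCharacter ℂ m)

/-- The smoothed sum twisted by a character is the integral of `F(s) X^s Γ(s)` along
`Re s = 3/2`. -/
lemma hasSum_smoothed (hq : q ≠ 0) {X : ℝ} (hX : 0 < X) :
    HasSum (fun h : ℕ => if h = 0 then 0 else
      χ (h : ZMod m) * (singularSeries q {0, (h : ℤ)} : ℂ) * (Real.exp (-(h : ℝ) / X) : ℂ))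
      ((2 * Real.pi : ℂ)⁻¹ * ∫ t : ℝ, integrand q χ X ((3 / 2 : ℝ) + t * Complex.I)) := by
  set a : ℕ → ℂ := fun h => χ (h : ZMod m) * (singularSeries q {0, (h : ℤ)} : ℂ) with ha
  set c : ℝ := 3 / 2 with hc
  have hXC : (X : ℂ) ≠ 0 := by exact_mod_cast hX.ne'
  set Fn : ℕ → ℝ → ℂ := fun h t => LSeries.term a (c + t * Complex.I) h *
    (X : ℂ) ^ (c + t * Complex.I : ℂ) * Complex.Gamma (c + t * Complex.I) with hFn
  -- for positive `h` the summand is the Mellin inversion integrand at `h / X`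
  have hform : ∀ h : ℕ, h ≠ 0 → ∀ t : ℝ, Fn h t = a h * ((((h : ℝ) / X : ℝ) : ℂ) ^
      (-(c + t * Complex.I : ℂ)) * Complex.Gamma (c + t * Complex.I)) := by
    intro h hh t
    have e : (((h : ℝ) / X : ℝ) : ℂ) ^ (-(c + t * Complex.I : ℂ)) =
        ((h : ℂ) ^ (c + t * Complex.I : ℂ))⁻¹ * (X : ℂ) ^ (c + t * Complex.I : ℂ) := by
      rw [div_eq_mul_inv, Complex.ofReal_mul, Complex.mul_cpow_ofReal_nonneg h.cast_nonneg
        (by positivity), Complex.cpow_neg, Complex.ofReal_inv, Complex.inv_cpow, Complex.cpow_neg,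
        inv_inv, Complex.ofReal_natCast]
      rw [Complex.arg_ofReal_of_nonneg hX.le]
      exact Real.pi_ne_zero.symm
    rw [hFn, e]
    simp only
    rw [LSeries.term_of_ne_zero hh]
    ring
  have hnorm : ∀ (h : ℕ) (t : ℝ), ‖Fn h t‖ = ‖LSeries.term a c h‖ * X ^ c *
      ‖Complex.Gamma (c + t * Complex.I)‖ := by
    intro h t
    rw [hFn]
    simp only
    rw [norm_mul, norm_mul, Complex.norm_cpow_eq_rpow_re_of_pos hX, line_re, LSeries.norm_term_eq,
      LSeries.norm_term_eq, line_re, Complex.ofReal_re]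
  have hΓ := integrable_Gamma_vertical (c := c) (by norm_num [hc])
  have hint : ∀ h, MeasureTheory.Integrable (Fn h) := by
    intro h
    refine (hΓ.norm.const_mul (‖LSeries.term a c h‖ * X ^ c)).mono' ?_
      (Eventually.of_forall fun t => (hnorm h t).le)
    refine MeasureTheory.AEStronglyMeasurable.mul ?_ hΓ.aestronglyMeasurable
    refine Continuous.aestronglyMeasurable (Continuous.mul ?_ ?_)
    · rcases eq_or_ne h 0 with rfl | hh
      · simpa using continuous_const
      · simp_rw [LSeries.term_of_ne_zero hh]
        have hh' : (h : ℂ) ≠ 0 := by exact_mod_cast hh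
        refine Continuous.div continuous_const ?_ fun t => by simp [Complex.cpow_eq_zero_iff, hh]
        exact Continuous.const_cpow (by fun_prop) (Or.inl hh')
    · exact Continuous.const_cpow (by fun_prop) (Or.inl hXC)
  have hL : ∀ t : ℝ, HasSum (LSeries.term a (c + t * Complex.I)) (F q χ (c + t * Complex.I)) :=
    fun t => LSeriesHasSum_F hq (by rw [line_re]; norm_num [hc])
  -- absolute convergence of the Dirichlet series on `Re s = 3/2` allows termwise integration
  have hsum : Summable fun h => ∫ t : ℝ, ‖Fn h t‖ := by
    have h0 : Summable fun h => ‖LSeries.term a c h‖ := by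
      have := (hL 0).summable.norm
      simpa using this
    simp_rw [hnorm, MeasureTheory.integral_const_mul]
    exact (h0.mul_right _).mul_right _
  have key := MeasureTheory.hasSum_integral_of_summable_integral_norm hint hsum
  have e1 : (fun t : ℝ => ∑' h, Fn h t) = fun t : ℝ => integrand q χ X (c + t * Complex.I) := by
    funext t
    rw [integrand, hFn]
    exact (((hL t).mul_right _).mul_right _).tsum_eq
  rw [e1] at key
  have hpi : (2 * Real.pi : ℂ) ≠ 0 := by
    exact_mod_cast mul_ne_zero two_ne_zero Real.pi_ne_zero
  refine (key.mul_left (2 * Real.pi : ℂ)⁻¹).congr_fun fun h => ?_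
  split_ifs with hh
  · subst hh
    simp [hFn]
  · simp_rw [hform h hh]
    have hh0 : (0 : ℝ) < h := by exact_mod_cast Nat.pos_of_ne_zero hh
    rw [MeasureTheory.integral_const_mul, integral_cpow_mul_Gamma (by norm_num [hc])
      (div_pos hh0 hX), neg_div]
    field_simp
    rw [ha]

end Mellin

/-! ### Sums over arithmetic progressions -/

section Progression

/-- Second order expansion of `y e^{-by} / (1 - e^{-y})` at `0`. -/
lemma abs_exp_div_sub_le {b y : ℝ} (hb : 0 ≤ b) (hb1 : b ≤ 1) (hy : 0 < y) (hy1 : y ≤ 1) :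
    |Real.exp (-(b * y)) / (1 - Real.exp (-y)) - 1 / y - (1 / 2 - b)| ≤ 12 * y := by
  have h1 : |Real.exp (-(b * y)) - 1 - -(b * y)| ≤ (-(b * y)) ^ 2 := by
    refine Real.abs_exp_sub_one_sub_id_le ?_
    rw [abs_neg, abs_of_nonneg (by positivity)]
    nlinarith
  have h2 := Real.exp_bound (x := -y) (by rw [abs_neg, abs_of_pos hy]; exact hy1)
    (n := 3) (by norm_num)
  rw [abs_neg, abs_of_pos hy] at h2
  simp [Finset.sum_range_succ, Nat.factorial] at h2
  norm_num at h2
  set D := 1 - Real.exp (-y) with hD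
  set A := Real.exp (-(b * y)) with hA
  have hE2 : |D - (y - y ^ 2 / 2)| ≤ y ^ 3 := by
    have e : D - (y - y ^ 2 / 2) = -(Real.exp (-y) - (1 + -y + y ^ 2 / 2)) := by rw [hD]; ring
    rw [e, abs_neg]
    refine h2.trans ?_
    nlinarith [pow_pos hy 3]
  have hy2 : y ^ 2 ≤ y := by nlinarith
  have hy3 : y ^ 3 ≤ y ^ 2 := by nlinarith [sq_nonneg y]
  -- so the denominator `y * D` below is at least `y² / 4`
  have hD4 : y / 4 ≤ D := by
    have h3 : Real.exp (-y) ≤ 1 - y + y ^ 2 / 2 + y ^ 3 * (2 / 9) := by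
      have := (abs_le.mp h2).2
      linarith
    rw [hD]
    nlinarith
  have hD0 : 0 < D := by linarith
  have hE1 : |A - 1 + b * y| ≤ y ^ 2 := by
    rw [sub_neg_eq_add] at h1
    refine h1.trans ?_
    rw [neg_sq]
    exact pow_le_pow_left₀ (by positivity) (mul_le_of_le_one_left hy.le hb1) 2
  have hE3 : |D - y| ≤ y ^ 2 := by
    have h5 := abs_le.mp hE2
    have h6 : Real.exp (-y) ≥ 1 - y := by linarith [Real.add_one_le_exp (-y)]
    rw [abs_le]
    constructor
    · have := Real.exp_bound (x := -y) (by rw [abs_neg, abs_of_pos hy]; exact hy1)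
        (n := 2) (by norm_num)
      rw [abs_neg, abs_of_pos hy] at this
      simp [Finset.sum_range_succ, Nat.factorial] at this
      have h7 := (abs_le.mp this).2
      rw [hD]
      nlinarith
    · rw [hD]
      nlinarith
  have key : A / D - 1 / y - (1 / 2 - b) =
      (y * (A - 1 + b * y) - (D - (y - y ^ 2 / 2)) - (1 / 2 - b) * y * (D - y)) / (y * D) := by
    field_simp
    ring
  have hnum : |y * (A - 1 + b * y) - (D - (y - y ^ 2 / 2)) - (1 / 2 - b) * y * (D - y)| ≤
      3 * y ^ 3 := by
    have hbb : |1 / 2 - b| ≤ 1 := by rw [abs_le]; constructor <;> linarith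
    calc _ ≤ |y * (A - 1 + b * y)| + |D - (y - y ^ 2 / 2)| + |(1 / 2 - b) * y * (D - y)| :=
          (abs_sub _ _).trans (by gcongr; exact abs_sub _ _)
      _ ≤ y * y ^ 2 + y ^ 3 + 1 * y * y ^ 2 := by
          rw [abs_mul, abs_mul, abs_mul, abs_of_pos hy]
          gcongr
      _ = _ := by ring
  rw [key, abs_div, abs_of_pos (mul_pos hy hD0), div_le_iff₀ (mul_pos hy hD0)]
  refine hnum.trans ?_
  have : y * (y / 4) ≤ y * D := by gcongr
  nlinarith

open Classical in
/-- A geometric series that starts at the least positive residue of `v` modulo `q`. -/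
lemma hasSum_exp_progression {q : ℕ} (hq : 0 < q) (v : ℤ) {H : ℝ} (hH : 0 < H) :
    HasSum (fun h : ℕ => if 0 < h ∧ (h : ℤ) ≡ v [ZMOD q] then Real.exp (-(h : ℝ) / H) else 0)
      (Real.exp (-(((v - 1) % (q : ℤ) + 1 : ℤ) / H)) / (1 - Real.exp (-(q / H)))) := by
  have hqZ : (0 : ℤ) < q := by exact_mod_cast hq
  have hmod0 := Int.emod_nonneg (v - 1) hqZ.ne'
  have hmod1 := Int.emod_lt_of_pos (v - 1) hqZ
  obtain ⟨r, hr⟩ : ∃ r : ℕ, (v - 1) % (q : ℤ) + 1 = r :=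
    ⟨((v - 1) % (q : ℤ) + 1).toNat, by rw [Int.toNat_of_nonneg (by linarith)]⟩
  have hr1 : 1 ≤ r := by have : (1 : ℤ) ≤ r := by rw [← hr]; linarith
                         exact_mod_cast this
  have hrv : (r : ℤ) ≡ v [ZMOD q] := by
    rw [← hr]
    have := (Int.mod_modEq (v - 1) q).add_right 1
    simpa using this
  have hrq : r ≤ q := by have : (r : ℤ) ≤ q := by rw [← hr]; linarith
                         exact_mod_cast this
  have hinj : Function.Injective fun j : ℕ => r + q * j := fun a b h => by
    have : q * a = q * b := by simpa using h
    exact Nat.eq_of_mul_eq_mul_left hq this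
  rw [hr, ← hinj.hasSum_iff]
  · have hgeo := (hasSum_geometric_of_lt_one (Real.exp_pos (-(q / H))).le (by
      rw [← Real.exp_zero]
      have : (0 : ℝ) < q / H := by positivity
      exact Real.exp_lt_exp.mpr (by linarith))).mul_left (Real.exp (-((r : ℤ) / H)))
    rw [← div_eq_mul_inv] at hgeo
    refine hgeo.congr_fun fun j => ?_
    have hc : 0 < r + q * j ∧ ((r + q * j : ℕ) : ℤ) ≡ v [ZMOD q] := by
      refine ⟨by positivity, ?_⟩
      push_cast
      have := hrv.add (Int.modEq_zero_iff_dvd.mpr (dvd_mul_right (q : ℤ) j))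
      simpa using this
    simp only [Function.comp_apply]
    rw [if_pos hc, ← Real.exp_nat_mul, ← Real.exp_add]
    congr 1
    push_cast
    ring
  · intro h hh
    refine if_neg fun ⟨h0, h1⟩ => hh ?_
    have h2 : (r : ℤ) ≡ h [ZMOD q] := hrv.trans h1.symm
    have h3 : r ≡ h [MOD q] := (Int.natCast_modEq_iff).mp h2
    have h4 : r ≤ h := by
      by_contra hlt
      push Not at hlt
      have h5 := (Nat.modEq_iff_dvd' hlt.le).mp h3.symm
      have := Nat.le_of_dvd (by lia) h5
      lia
    obtain ⟨j, hj⟩ := (Nat.modEq_iff_dvd' h4).mp h3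
    exact ⟨j, by simp only; lia⟩

open Classical in
/-- The sum of `e^{-h/H}` over the progression is `H/q + B_q(v) + O(q/H)`. -/
lemma abs_tsum_exp_progression_sub_le {q : ℕ} (hq : 0 < q) (v : ℤ) {H : ℝ} (hH : (q : ℝ) ≤ H) :
    |(∑' h : ℕ, if 0 < h ∧ (h : ℤ) ≡ v [ZMOD q] then Real.exp (-(h : ℝ) / H) else 0) -
      (H / q + sawtooth q v)| ≤ 12 * (q / H) := by
  have hq0 : (0 : ℝ) < q := by exact_mod_cast hq
  have hH0 : 0 < H := by linarith
  rw [(hasSum_exp_progression hq v hH0).tsum_eq, sawtooth]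
  have hqZ : (0 : ℤ) < q := by exact_mod_cast hq
  have hmod0 := Int.emod_nonneg (v - 1) hqZ.ne'
  have hmod1 := Int.emod_lt_of_pos (v - 1) hqZ
  set r : ℤ := (v - 1) % (q : ℤ) + 1 with hr
  have hr0 : (0 : ℝ) ≤ r := by exact_mod_cast (by linarith : 0 ≤ r)
  have hrq : (r : ℝ) ≤ q := by exact_mod_cast (by linarith : r ≤ q)
  have h := abs_exp_div_sub_le (b := r / q) (y := q / H) (by positivity)
    (by rw [div_le_one hq0]; exact hrq) (by positivity) (by rw [div_le_one hH0]; exact hH)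
  have e : (r : ℝ) / q * (q / H) = r / H := by field_simp
  rw [e, one_div_div] at h
  rw [sub_add_eq_sub_sub]
  exact h

end Progression

end SingularSeries

namespace SingularSeries

/-! ### Orthogonality of characters -/

section Orthogonality

/-- The primes `p ∤ q`, the only ones in the product, cannot distinguish `k` from `d k`. -/
lemma singularSeries_pair_mul {q d k : ℕ} (hdq : d ∣ q) (hd : d ≠ 0) (hk : k ≠ 0) :
    singularSeries q {0, ((d * k : ℕ) : ℤ)} = singularSeries q {0, (k : ℤ)} := by
  rw [singularSeries_pair q hk, singularSeries_pair q (mul_ne_zero hd hk)]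
  refine tprod_congr fun p => ?_
  simp only [pairFactor]
  split_ifs with h1 h2 h3 h3
  · rfl
  · rfl
  · exact absurd ((p.2.dvd_mul.mp h2).resolve_left fun h => h1 (h.trans hdq)) h3
  · exact absurd (h3.mul_left d) h2
  · rfl

variable (q : ℕ) [NeZero q] (v : ℤ)

omit [NeZero q] in
lemma gcd_dvd_modulus : Int.gcd v q ∣ q := by
  exact_mod_cast Int.gcd_dvd_right v (q : ℤ)

lemma gcd_modulus_pos : 0 < Int.gcd v q :=
  Nat.pos_of_dvd_of_pos (gcd_dvd_modulus q v) (Nat.pos_of_ne_zero (NeZero.ne q))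

omit [NeZero q] in
lemma gcd_mul_cofactor : Int.gcd v q * cofactor q v = q :=
  Nat.mul_div_cancel' (gcd_dvd_modulus q v)

lemma isUnit_reducedClass : IsUnit (reducedClass q v) := by
  rw [reducedClass, ZMod.coe_int_isUnit_iff_isCoprime, Int.isCoprime_iff_gcd_eq_one, cofactor,
    Int.natCast_div, Int.gcd_comm]
  exact Int.gcd_div_gcd_div_gcd (gcd_modulus_pos q v)

variable {q v}

omit [NeZero q] in
lemma gcd_dvd_of_modEq {h : ℕ} (hh : (h : ℤ) ≡ v [ZMOD q]) : Int.gcd v q ∣ h := by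
  have h1 : (Int.gcd v q : ℤ) ∣ v := Int.gcd_dvd_left v q
  have h2 : (Int.gcd v q : ℤ) ∣ q := Int.gcd_dvd_right v q
  have h3 := (Int.modEq_iff_dvd.mp (hh.of_dvd h2))
  have h4 := (dvd_sub_right h1).mp h3
  exact_mod_cast h4

lemma gcd_mul_modEq_iff (k : ℕ) :
    ((Int.gcd v q * k : ℕ) : ℤ) ≡ v [ZMOD q] ↔ (k : ZMod (cofactor q v)) = reducedClass q v := by
  have h1 : (Int.gcd v q : ℤ) ∣ v := Int.gcd_dvd_left v q
  have h0 : (Int.gcd v q : ℤ) ≠ 0 := by exact_mod_cast (gcd_modulus_pos q v).ne'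
  rw [reducedClass, ← Int.cast_natCast (k : ℕ), ZMod.intCast_eq_intCast_iff, Int.modEq_iff_dvd,
    Int.modEq_iff_dvd]
  have h2 : (q : ℤ) = Int.gcd v q * cofactor q v := by exact_mod_cast (gcd_mul_cofactor q v).symm
  have h3 : v - ((Int.gcd v q * k : ℕ) : ℤ) = Int.gcd v q * (v / (Int.gcd v q : ℤ) - k) := by
    rw [mul_sub, Int.mul_ediv_cancel' h1]
    push_cast
    rfl
  rw [h3, ← mul_dvd_mul_iff_left h0 (b := (cofactor q v : ℤ)), ← h2]

open Classical in
/-- Detection of the class `v` modulo `q` by the characters modulo `q / (v,q)`. -/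
lemma hasSum_progression {H : ℝ} (hH : 0 < H) :
    HasSum (fun h : ℕ => if 0 < h ∧ (h : ℤ) ≡ v [ZMOD q] then
        (singularSeries q {0, (h : ℤ)} : ℂ) * (Real.exp (-(h : ℝ) / H) : ℂ) else 0)
      (1 / ((cofactor q v).totient : ℂ) * ∑ χ : DirichletCharacter ℂ (cofactor q v),
        (starRingEnd ℂ) (χ (reducedClass q v)) * ((2 * Real.pi : ℂ)⁻¹ *
          ∫ t : ℝ, integrand q χ (H / (Int.gcd v q : ℝ)) ((3 / 2 : ℝ) + t * Complex.I))) := by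
  set d := Int.gcd v q with hd
  have hd0 : 0 < d := gcd_modulus_pos q v
  have hdR : (0 : ℝ) < d := by exact_mod_cast hd0
  have hinj : Function.Injective fun k : ℕ => d * k :=
    fun a b h => Nat.eq_of_mul_eq_mul_left hd0 h
  rw [← hinj.hasSum_iff]
  -- the class consists of multiples `h = d k` of `d`, with `k` in a reduced class
  · refine ((hasSum_sum fun χ _ => (hasSum_smoothed q χ (NeZero.ne q)
      (div_pos hH hdR)).mul_left _).mul_left _).congr_fun fun k => ?_
    simp only [Function.comp_apply]
    rcases eq_or_ne k 0 with rfl | hk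
    · simp
    simp only [if_neg hk]
    have h1 : 0 < d * k := Nat.mul_pos hd0 (Nat.pos_of_ne_zero hk)
    simp only [hd, gcd_mul_modEq_iff]
    rw [← hd, singularSeries_pair_mul (gcd_dvd_modulus q v) hd0.ne' hk]
    have h2 : -((d * k : ℕ) : ℝ) / H = -(k : ℝ) / (H / d) := by
      push_cast
      field_simp
    rw [h2]
    have h3 := DirichletCharacter.sum_char_inv_mul_char_eq ℂ (isUnit_reducedClass q v)
      (k : ZMod (cofactor q v))
    have h4 : ∀ χ : DirichletCharacter ℂ (cofactor q v),
        (starRingEnd ℂ) (χ (reducedClass q v)) = χ (reducedClass q v)⁻¹ := fun χ => by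
      have hu := isUnit_reducedClass q v
      have e1 : χ (reducedClass q v)⁻¹ * χ (reducedClass q v) = 1 := by
        rw [← map_mul, ZMod.inv_mul_of_unit _ hu, map_one]
      have e2 : χ⁻¹ (reducedClass q v) * χ (reducedClass q v) = 1 := by
        rw [← MulChar.mul_apply, inv_mul_cancel, MulChar.one_apply hu]
      have e3 := MulChar.star_apply' χ (reducedClass q v)
      exact e3.trans (mul_right_cancel₀ (right_ne_zero_of_mul_eq_one e1) (e2.trans e1.symm))
    have h5 : ((cofactor q v).totient : ℂ) ≠ 0 := by
      exact_mod_cast (Nat.totient_pos.mpr (Nat.pos_of_ne_zero (NeZero.ne _))).ne'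
    simp_rw [h4, mul_assoc]
    simp_rw [← mul_assoc (DFunLike.coe _ (reducedClass q v)⁻¹)]
    rw [← Finset.sum_mul, h3]
    by_cases h6 : (k : ZMod (cofactor q v)) = reducedClass q v
    · rw [if_pos ⟨h1, h6⟩, if_pos h6.symm]
      field_simp
    · rw [if_neg fun h => h6 h.2, if_neg (Ne.symm h6)]
      simp
  · intro h hh
    refine if_neg fun ⟨_, h1⟩ => hh ?_
    obtain ⟨k, hk⟩ := gcd_dvd_of_modEq h1
    exact ⟨k, hk.symm⟩

open Classical in
/-- Since `𝔖_{q,0}({0,h}) = 𝔖_q({0,h}) - 1`, the sum of `e^{-h/H}` over the class is subtracted. -/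
lemma hasSum_smoothedTerm {H : ℝ} (hH : 0 < H) :
    HasSum (fun h : ℕ => (smoothedTerm q v H h : ℂ))
      (1 / ((cofactor q v).totient : ℂ) * ∑ χ : DirichletCharacter ℂ (cofactor q v),
        (starRingEnd ℂ) (χ (reducedClass q v)) * ((2 * Real.pi : ℂ)⁻¹ *
          ∫ t : ℝ, integrand q χ (H / (Int.gcd v q : ℝ)) ((3 / 2 : ℝ) + t * Complex.I)) -
        ((∑' h : ℕ, if 0 < h ∧ (h : ℤ) ≡ v [ZMOD q] then Real.exp (-(h : ℝ) / H) else 0 : ℝ) :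
          ℂ)) := by
  have hq : 0 < q := Nat.pos_of_ne_zero (NeZero.ne q)
  refine ((hasSum_progression hH).sub (Complex.hasSum_ofReal.mpr
    (hasSum_exp_progression hq v hH).summable.hasSum)).congr_fun fun h => ?_
  rw [smoothedTerm]
  split_ifs with h1
  · rw [modifiedSingularSeries_pair q h1.1.ne']
    push_cast
    ring
  · simp

lemma summable_smoothedTerm {H : ℝ} (hH : 0 < H) : Summable (smoothedTerm q v H) :=
  Complex.summable_ofReal.mp (hasSum_smoothedTerm hH).summable

end Orthogonality

end SingularSeries

namespace SingularSeries

/-! ### Residues at the real poles -/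

section PrincipalFactors

/-- The factor by which the `L`-function of the principal character modulo `n` differs from
`riemannZeta`. -/
noncomputable def trivFactor (n : ℕ) (s : ℂ) : ℂ := ∏ p ∈ n.primeFactors, (1 - (p : ℂ) ^ (-s))

lemma hasDerivAt_one_sub_cpow_neg {p : ℕ} (hp : p ≠ 0) (s : ℂ) :
    HasDerivAt (fun s : ℂ => 1 - (p : ℂ) ^ (-s)) ((p : ℂ) ^ (-s) * Complex.log p) s := by
  have h := ((hasDerivAt_neg s).const_cpow (c := (p : ℂ))
    (Or.inl (by exact_mod_cast hp))).const_sub 1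
  refine h.congr_deriv ?_
  ring

lemma hasDerivAt_trivFactor (n : ℕ) (s : ℂ) :
    HasDerivAt (trivFactor n) (∑ p ∈ n.primeFactors,
      (∏ r ∈ n.primeFactors.erase p, (1 - (r : ℂ) ^ (-s))) *
        ((p : ℂ) ^ (-s) * Complex.log p)) s := by
  have h := HasDerivAt.fun_finsetProd (u := n.primeFactors) (fun p hp =>
    hasDerivAt_one_sub_cpow_neg (Nat.prime_of_mem_primeFactors hp).ne_zero s)
  simp only [smul_eq_mul] at h
  exact h

lemma differentiable_trivFactor (n : ℕ) : Differentiable ℂ (trivFactor n) :=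
  fun s => (hasDerivAt_trivFactor n s).differentiableAt

lemma trivFactor_one {n : ℕ} (hn : n ≠ 0) : trivFactor n 1 = (n.totient : ℂ) / n := by
  have hn' : (n : ℂ) ≠ 0 := by exact_mod_cast hn
  have h := congrArg (Rat.cast : ℚ → ℂ) (Nat.totient_eq_mul_prod_factors n)
  push_cast at h
  rw [h, mul_div_cancel_left₀ _ hn', trivFactor]
  simp [Complex.cpow_neg_one]

lemma hasDerivAt_trivFactor_one {n : ℕ} (hn : n ≠ 0) :
    HasDerivAt (trivFactor n) ((n.totient : ℂ) / n *
      ((∑ p ∈ n.primeFactors, Real.log p / ((p : ℝ) - 1) : ℝ) : ℂ)) 1 := by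
  refine (hasDerivAt_trivFactor n 1).congr_deriv ?_
  rw [← trivFactor_one hn, Complex.ofReal_sum, Finset.mul_sum]
  refine Finset.sum_congr rfl fun p hp => ?_
  have hpp := Nat.prime_of_mem_primeFactors hp
  have hp0 : (p : ℂ) ≠ 0 := by exact_mod_cast hpp.ne_zero
  have hp1 : (p : ℂ) - 1 ≠ 0 := sub_ne_zero.mpr (by exact_mod_cast hpp.one_lt.ne')
  rw [trivFactor, ← Finset.mul_prod_erase _ _ hp, Complex.cpow_neg_one, ← Complex.natCast_log]
  push_cast
  field_simp

/-- The derivative at `0` vanishes if two primes divide `n`. -/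
lemma hasDerivAt_trivFactor_zero {n : ℕ} (hn : 1 < n) :
    HasDerivAt (trivFactor n) ((ArithmeticFunction.vonMangoldt n : ℝ) : ℂ) 0 := by
  refine (hasDerivAt_trivFactor n 0).congr_deriv ?_
  by_cases hpow : IsPrimePow n
  · obtain ⟨p, hp⟩ := Finset.card_eq_one.mp (isPrimePow_iff_card_primeFactors_eq_one.mp hpow)
    have hmin : n.minFac = p := by
      have : n.minFac ∈ n.primeFactors :=
        Nat.mem_primeFactors.mpr ⟨Nat.minFac_prime hn.ne', Nat.minFac_dvd n, by lia⟩
      rw [hp] at this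
      exact Finset.mem_singleton.mp this
    rw [ArithmeticFunction.vonMangoldt_apply, if_pos hpow, hp, hmin]
    simp
  · rw [ArithmeticFunction.vonMangoldt_eq_zero_iff.mpr hpow, Complex.ofReal_zero]
    refine Finset.sum_eq_zero fun p hp => ?_
    have hcard : n.primeFactors.card ≠ 1 :=
      fun h => hpow (isPrimePow_iff_card_primeFactors_eq_one.mpr h)
    have h2 : (n.primeFactors.erase p).Nonempty := by
      rw [← Finset.card_pos, Finset.card_erase_of_mem hp]
      have := Finset.card_pos.mpr ⟨p, hp⟩
      lia
    obtain ⟨r, hr⟩ := h2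
    rw [Finset.prod_eq_zero hr (by simp), zero_mul]

lemma trivFactor_zero {n : ℕ} (hn : 1 < n) : trivFactor n 0 = 0 := by
  refine Finset.prod_eq_zero (i := n.minFac)
    (Nat.mem_primeFactors.mpr ⟨Nat.minFac_prime hn.ne', Nat.minFac_dvd n, by lia⟩) ?_
  simp

variable {q m : ℕ} [NeZero m]

lemma LFunction_principal {s : ℂ} (hs : s ≠ 1) :
    (1 : DirichletCharacter ℂ m).LFunction s = trivFactor m s * riemannZeta s :=
  DirichletCharacter.LFunctionTrivChar_eq_mul_riemannZeta hs

omit [NeZero m] in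
lemma principal_apply {p : ℕ} (hp : p.Prime) :
    (1 : DirichletCharacter ℂ m) (p : ZMod m) = if p ∣ m then 0 else 1 := by
  split_ifs with h
  · refine MulChar.map_nonunit _ fun hu => ?_
    exact hp.coprime_iff_not_dvd.mp ((ZMod.isUnit_iff_coprime p m).mp hu) h
  · exact MulChar.one_apply ((ZMod.isUnit_iff_coprime p m).mpr (hp.coprime_iff_not_dvd.mpr h))

omit [NeZero m] in
lemma trivFactor_mul_prod (hq : q ≠ 0) (hm : m ∣ q) (s : ℂ) :
    trivFactor m s * ∏ p ∈ q.primeFactors,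
      (1 - (1 : DirichletCharacter ℂ m) (p : ZMod m) * (p : ℂ) ^ (-s)) = trivFactor q s := by
  have hsub := Nat.primeFactors_mono hm hq
  rw [trivFactor, trivFactor, Finset.prod_subset_one_on_sdiff hsub (g := fun p : ℕ =>
    if p ∣ m then 1 - (p : ℂ) ^ (-s) else 1) (f := fun p : ℕ => 1 - (p : ℂ) ^ (-s)) ?_ ?_,
    ← Finset.prod_mul_distrib]
  · refine Finset.prod_congr rfl fun p hp => ?_
    rw [principal_apply (Nat.prime_of_mem_primeFactors hp)]
    split_ifs <;> simp
  · intro p hp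
    rw [Finset.mem_sdiff] at hp
    refine if_neg fun h => hp.2 ?_
    exact Nat.mem_primeFactors.mpr ⟨Nat.prime_of_mem_primeFactors hp.1, h, fun h0 => by
      rw [h0] at hm
      exact hq (zero_dvd_iff.mp hm)⟩
  · intro p hp
    exact (if_pos (Nat.dvd_of_mem_primeFactors hp)).symm

omit [NeZero m] in
lemma squareTerm_principal_zero (hm : m ∣ q) (p : Nat.Primes) :
    squareTerm q (1 : DirichletCharacter ℂ m) p 0 = 0 := by
  rw [squareTerm]
  split_ifs with h
  · rfl
  · rw [principal_apply p.2, if_neg fun h' => h (h'.trans hm)]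
    simp

omit [NeZero m] in
lemma hasDerivAt_squareTerm_principal (hm : m ∣ q) (p : Nat.Primes) :
    HasDerivAt (squareTerm q (1 : DirichletCharacter ℂ m) p) 0 0 := by
  unfold squareTerm
  split_ifs with h
  · exact hasDerivAt_const _ _
  · rw [principal_apply p.2, if_neg fun h' => h (h'.trans hm)]
    have h1 := ((hasDerivAt_one_sub_cpow_neg p.2.ne_zero 0).pow 2).div_const
      ((((p : ℕ) : ℂ) - 1) ^ 2) |>.neg
    simp only [one_mul]
    refine h1.congr_deriv ?_
    simp

omit [NeZero m] in
/-- For the principal character the factors at `p ∤ q` deviate from `1` only to second order. -/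
lemma hasDerivAt_tprod_squareTerm_principal (hm : m ∣ q) :
    HasDerivAt (fun s => ∏' p : Nat.Primes, (1 + squareTerm q (1 : DirichletCharacter ℂ m) p s))
      0 0 := by
  set χ : DirichletCharacter ℂ m := 1
  have hU : IsOpen {s : ℂ | -(1 / 2) < s.re} := isOpen_re_gt _
  have h0 : (0 : ℂ) ∈ {s : ℂ | -(1 / 2) < s.re} := by
    rw [Set.mem_ofPred_eq]
    norm_num
  have h := hasProdLocallyUniformlyOn_squareTerm q χ
  have hd : ∀ p : Nat.Primes, HasDerivAt (fun s => 1 + squareTerm q χ p s) 0 0 := fun p => by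
    simpa using (hasDerivAt_squareTerm_principal hm p).const_add 1
  have hT := hasProdLocallyUniformlyOn_iff_tendstoLocallyUniformlyOn.mp h
  have hdiff : ∀ᶠ S : Finset Nat.Primes in atTop, DifferentiableOn ℂ
      (fun s => ∏ p ∈ S, (1 + squareTerm q χ p s)) {s : ℂ | -(1 / 2) < s.re} :=
    Eventually.of_forall fun S => DifferentiableOn.fun_finsetProd fun p _ =>
      ((differentiable_squareTerm p.2).const_add 1).differentiableOn
  -- locally uniform convergence carries over to derivatives, and the partial products have
  -- derivative `0` at `0`
  have hT2 := (hT.deriv hdiff hU).tendsto_at h0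
  have hz : ∀ S : Finset Nat.Primes,
      deriv (fun s => ∏ p ∈ S, (1 + squareTerm q χ p s)) 0 = 0 := fun S => by
    rw [(HasDerivAt.fun_finsetProd (u := S) fun p _ => hd p).deriv]
    simp
  have hderiv := tendsto_nhds_unique (hT2.congr hz) tendsto_const_nhds
  have hDT := (hT.differentiableOn hdiff hU).differentiableAt (hU.mem_nhds h0)
  exact hDT.hasDerivAt.congr_deriv hderiv

end PrincipalFactors

end SingularSeries

namespace SingularSeries

section Residues

variable {q m : ℕ} [NeZero m]

omit [NeZero m] in
lemma analyticAt_regularPart (χ : DirichletCharacter ℂ m) {s : ℂ} (hs : -(1 / 2) < s.re) :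
    AnalyticAt ℂ (regularPart q χ) s :=
  (differentiableOn_regularPart q χ).analyticAt ((isOpen_re_gt _).mem_nhds hs)

lemma analyticAt_const_cpow {X : ℝ} (hX : 0 < X) (s : ℂ) :
    AnalyticAt ℂ (fun s : ℂ => (X : ℂ) ^ s) s :=
  Differentiable.analyticAt (differentiable_id.const_cpow (Or.inl (by exact_mod_cast hX.ne'))) s

lemma analyticAt_Gamma {s : ℂ} (hs : 0 < s.re) : AnalyticAt ℂ Complex.Gamma s := by
  have h : DifferentiableOn ℂ Complex.Gamma {s | 0 < s.re} := fun z hz =>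
    (Complex.differentiableAt_Gamma z fun n h => by
      have hz' : 0 < z.re := hz
      rw [h] at hz'
      simp at hz'
      linarith [n.cast_nonneg (α := ℝ)]).differentiableWithinAt
  exact h.analyticAt ((isOpen_re_gt 0).mem_nhds hs)

lemma AnalyticAt.shift {f : ℂ → ℂ} {s : ℂ} (hf : AnalyticAt ℂ f (s + 1)) :
    AnalyticAt ℂ (fun z => f (z + 1)) s :=
  AnalyticAt.fun_comp (g := f) (f := fun z : ℂ => z + 1) hf (by fun_prop)

lemma eventually_re_gt {a : ℝ} {s : ℂ} (hs : a < s.re) : ∀ᶠ z : ℂ in 𝓝[≠] s, a < z.re :=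
  nhdsWithin_le_nhds ((isOpen_re_gt a).mem_nhds hs)

/-- `F` has a removable singularity at `-1/2`, where `Γ` is analytic. -/
lemma residue_integrand_neg_half (χ : DirichletCharacter ℂ m) {X : ℝ} (hX : 0 < X) :
    residue (integrand q χ X) (-1 / 2) = 0 := by
  obtain ⟨G, hG, hFG⟩ := exists_analyticAt_F_neg_half q χ
  -- `Γ(s) = Γ(s+1) / s` reduces analyticity to the right half-plane
  have hΓ : AnalyticAt ℂ (fun s => Complex.Gamma (s + 1) / s) (-1 / 2) :=
    (AnalyticAt.shift (analyticAt_Gamma (by norm_num))).div analyticAt_id (by norm_num)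
  refine (hasResidueAt_of_analyticAt ((hG.mul (analyticAt_const_cpow hX _)).mul hΓ) ?_).residue_eq
  filter_upwards [hFG, eventually_ne_nhdsNE 0 _] with s hs hs0
  simp only [Pi.mul_apply, integrand]
  rw [hs, Complex.Gamma_add_one s hs0, mul_div_cancel_left₀ _ hs0]

/-- There is no pole at `1` unless `χ` is principal. -/
lemma residue_integrand_one_of_ne (hq : q ≠ 0) {χ : DirichletCharacter ℂ m} (hχ : χ ≠ 1) {X : ℝ}
    (hX : 0 < X) : residue (integrand q χ X) 1 = 0 := by
  have hL := DirichletCharacter.differentiable_LFunction hχ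
  refine (hasResidueAt_of_analyticAt ((((hL.analyticAt 1).mul (AnalyticAt.shift
    (hL.analyticAt (1 + 1)))).mul (analyticAt_regularPart (q := q) χ (by norm_num))).mul
    (analyticAt_const_cpow hX 1) |>.mul (analyticAt_Gamma (by norm_num))) ?_).residue_eq
  filter_upwards [eventually_re_gt (a := -(1 / 2)) (s := 1) (by norm_num)] with s hs
  simp only [Pi.mul_apply, integrand]
  rw [F_eq_mul_regularPart hq hs]

/-- For nonprincipal `χ` the only pole at `0` is that of `Γ`. -/
lemma residue_integrand_zero_of_ne (hq : q ≠ 0) {χ : DirichletCharacter ℂ m} (hχ : χ ≠ 1) {X : ℝ}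
    (hX : 0 < X) : residue (integrand q χ X) 0 =
      χ.LFunction 0 * χ.LFunction 1 * eulerConstant q χ := by
  have hL := DirichletCharacter.differentiable_LFunction hχ
  have h := (hasResidueAt_simple_pole (f := integrand q χ X) ((((hL.analyticAt 0).mul
    (AnalyticAt.shift (hL.analyticAt (0 + 1)))).mul
    (analyticAt_regularPart (q := q) χ (by norm_num))).mul (analyticAt_const_cpow hX 0) |>.mul
    (AnalyticAt.shift (analyticAt_Gamma (s := 0 + 1) (by norm_num)))) ?_).residue_eq
  · rw [h]
    simp only [Pi.mul_apply, zero_add, Complex.cpow_zero, Complex.Gamma_one, mul_one,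
      regularPart_zero]
  · filter_upwards [eventually_re_gt (a := -(1 / 2)) (s := 0) (by norm_num),
      eventually_ne_nhdsNE 0 _] with s hs hs0
    simp only [Pi.mul_apply, integrand]
    rw [F_eq_mul_regularPart hq hs, Complex.Gamma_add_one s hs0, sub_zero]
    generalize χ.LFunction s = a
    generalize χ.LFunction (s + 1) = b
    field_simp

/-- At `s = 1` all local factors of `L(s+1,χ₀)` times the regular part are equal to `1`. -/
lemma LFunction_mul_regularPart_principal (hq : q ≠ 0) (hm : m ∣ q) :
    (1 : DirichletCharacter ℂ m).LFunction (1 + 1) *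
      regularPart q (1 : DirichletCharacter ℂ m) 1 = 1 := by
  have h := hasProd_seriesFactor (χ := (1 : DirichletCharacter ℂ m)) hq (s := 1) (by norm_num)
  refine h.unique (Eq.subst (motive := fun f => HasProd f (1 : ℂ)) ?_ hasProd_one)
  funext p
  rw [seriesFactor]
  split_ifs with hp
  · rfl
  · rw [principal_apply p.2, if_neg fun h' => hp (h'.trans hm), Complex.cpow_one]
    have hp0 : ((p : ℕ) : ℂ) ≠ 0 := by exact_mod_cast p.2.ne_zero
    have hp1 : ((p : ℕ) : ℂ) - 1 ≠ 0 := sub_ne_zero.mpr (by exact_mod_cast p.2.one_lt.ne')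
    field_simp
    ring

lemma residue_integrand_one_principal (hq : q ≠ 0) (hm : m ∣ q) {X : ℝ} (hX : 0 < X) :
    residue (integrand q (1 : DirichletCharacter ℂ m) X) 1 = (m.totient : ℂ) / m * X := by
  have hL : AnalyticAt ℂ (1 : DirichletCharacter ℂ m).LFunction (1 + 1) := by
    have hd : DifferentiableOn ℂ (1 : DirichletCharacter ℂ m).LFunction {s | 1 < s.re} :=
      fun s hs => (DirichletCharacter.differentiableAt_LFunction _ s (Or.inl fun h => by
        have hs' : 1 < s.re := hs
        rw [h] at hs'
        simp at hs')).differentiableWithinAt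
    exact hd.analyticAt ((isOpen_re_gt 1).mem_nhds (by rw [Set.mem_ofPred_eq]; norm_num))
  have h := (hasResidueAt_simple_pole (f := integrand q (1 : DirichletCharacter ℂ m) X)
    (((((differentiable_trivFactor m).analyticAt 1).mul
    (differentiable_riemannZeta₁.analyticAt 1)).mul ((AnalyticAt.shift hL).mul
    (analyticAt_regularPart (q := q) (1 : DirichletCharacter ℂ m) (by norm_num)))).mul
    (analyticAt_const_cpow hX 1) |>.mul (analyticAt_Gamma (by norm_num))) ?_).residue_eq
  · rw [h]
    simp only [Pi.mul_apply, LFunction_mul_regularPart_principal hq hm, Complex.cpow_one,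
      Complex.Gamma_one, mul_one, riemannZeta₁_one, trivFactor_one (NeZero.ne m)]
  · filter_upwards [eventually_re_gt (a := -(1 / 2)) (s := 1) (by norm_num),
      eventually_ne_nhdsNE 1 _] with s hs hs1
    simp only [Pi.mul_apply, integrand]
    rw [F_eq_mul_regularPart hq hs, LFunction_principal hs1, riemannZeta_eq_inv_sub_mul hs1]
    generalize (1 : DirichletCharacter ℂ m).LFunction (s + 1) = b
    rw [div_eq_mul_inv]
    ring

/-- The functions `F(s) X^s Γ(s)` attached to the principal characters modulo divisors `m` of `q`
have a common factor `s⁻² K(s)`, the quotient being `∏_{p ∣ m} (1 - p^{-s})`. -/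
noncomputable def principalCore (q m : ℕ) (X : ℝ) (s : ℂ) : ℂ :=
  riemannZeta s * trivFactor q (s + 1) * riemannZeta₁ (s + 1) *
    (∏' p : Nat.Primes, (1 + squareTerm q (1 : DirichletCharacter ℂ m) p s)) * (X : ℂ) ^ s *
    Complex.Gamma (s + 1)

lemma integrand_principal_eq (hq : q ≠ 0) (hm : m ∣ q) {X : ℝ} {s : ℂ} (hs : -(1 / 2) < s.re)
    (hs0 : s ≠ 0) (hs1 : s ≠ 1) : integrand q (1 : DirichletCharacter ℂ m) X s =
      trivFactor m s * principalCore q m X s / (s - 0) ^ 2 := by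
  have hs2 : s + 1 ≠ 1 := by simpa using hs0
  rw [integrand, F_eq_mul_regularPart hq hs, LFunction_principal hs1, LFunction_principal hs2,
    riemannZeta_eq_inv_sub_mul hs2, regularPart, principalCore, ← trivFactor_mul_prod hq hm (s + 1),
    Complex.Gamma_add_one s hs0, add_sub_cancel_right, sub_zero]
  field_simp

variable (m) in
omit [NeZero m] in
/-- The Euler constants from `(s-1) ζ(s)` and `Γ` at `1` cancel, and `log 2π` comes from the
derivative of `ζ` at `0`. -/
lemma hasDerivAt_principalCore (hq : q ≠ 0) (hm : m ∣ q) {X : ℝ} (hX : 0 < X) :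
    HasDerivAt (principalCore q m X) ((-((q.totient : ℝ) / (2 * q)) * (Real.log (2 * Real.pi) +
      (∑ p ∈ q.primeFactors, Real.log p / ((p : ℝ) - 1)) + Real.log X) : ℝ) : ℂ) 0 := by
  have hqC : (q : ℂ) ≠ 0 := by exact_mod_cast hq
  have hζ : HasDerivAt riemannZeta (-(Real.log (2 * Real.pi) : ℂ) / 2) 0 := by
    have h := (differentiableAt_riemannZeta (s := 0) (by norm_num)).hasDerivAt
    rw [deriv_riemannZeta_zero] at h
    rw [Complex.ofReal_log (by positivity)]
    push_cast
    exact h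
  have hA := HasDerivAt.comp_add_const (0 : ℂ) 1
    ((zero_add (1 : ℂ)).symm ▸ hasDerivAt_trivFactor_one hq)
  have hz : HasDerivAt (fun s => riemannZeta₁ (s + 1)) (Real.eulerMascheroniConstant : ℂ) 0 := by
    have h := (differentiable_riemannZeta₁ (0 + 1)).hasDerivAt.comp_add_const (0 : ℂ) 1
    rwa [zero_add, deriv_riemannZeta₁_one] at h
  have hT := hasDerivAt_tprod_squareTerm_principal hm
  have hXd : HasDerivAt (fun s : ℂ => (X : ℂ) ^ s) (Real.log X : ℂ) 0 := by
    have h := (hasDerivAt_id (0 : ℂ)).const_cpow (c := (X : ℂ))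
      (Or.inl (by exact_mod_cast hX.ne'))
    simpa [Complex.ofReal_log hX.le] using h
  have hG : HasDerivAt (fun s => Complex.Gamma (s + 1))
      (-(Real.eulerMascheroniConstant : ℂ)) 0 := by
    refine HasDerivAt.comp_add_const (0 : ℂ) 1 ?_
    rw [zero_add]
    exact Complex.hasDerivAt_Gamma_one
  have hT0 : ∏' p : Nat.Primes, (1 + squareTerm q (1 : DirichletCharacter ℂ m) p 0) = 1 := by
    simp_rw [squareTerm_principal_zero hm, add_zero, tprod_one]
  have h := ((((hζ.mul hA).mul hz).mul hT).mul hXd).mul hG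
  refine h.congr_deriv ?_
  simp only [Pi.mul_apply, hT0, zero_add, Complex.cpow_zero, riemannZeta₁_one, Complex.Gamma_one,
    trivFactor_one hq, riemannZeta_zero]
  push_cast
  field_simp
  ring

variable (m) in
omit [NeZero m] in
lemma principalCore_zero (hq : q ≠ 0) (hm : m ∣ q) (X : ℝ) :
    principalCore q m X 0 = -((q.totient : ℂ) / (2 * q)) := by
  have hT0 : ∏' p : Nat.Primes, (1 + squareTerm q (1 : DirichletCharacter ℂ m) p 0) = 1 := by
    simp_rw [squareTerm_principal_zero hm, add_zero, tprod_one]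
  simp only [principalCore, hT0, zero_add, Complex.cpow_zero, riemannZeta₁_one, Complex.Gamma_one,
    trivFactor_one hq, riemannZeta_zero]
  ring

variable (m) in
omit [NeZero m] in
lemma analyticAt_principalCore {X : ℝ} (hX : 0 < X) : AnalyticAt ℂ (principalCore q m X) 0 := by
  have hζ : AnalyticAt ℂ riemannZeta 0 := by
    have hd : DifferentiableOn ℂ riemannZeta {1}ᶜ := fun s hs =>
      (differentiableAt_riemannZeta hs).differentiableWithinAt
    exact hd.analyticAt (isOpen_compl_singleton.mem_nhds (by simp))
  have hT : AnalyticAt ℂ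
      (fun s => ∏' p : Nat.Primes, (1 + squareTerm q (1 : DirichletCharacter ℂ m) p s)) 0 := by
    have h := hasProdLocallyUniformlyOn_iff_tendstoLocallyUniformlyOn.mp
      (hasProdLocallyUniformlyOn_squareTerm q (1 : DirichletCharacter ℂ m))
    refine (h.differentiableOn (Eventually.of_forall fun S => ?_) (isOpen_re_gt _)).analyticAt
      ((isOpen_re_gt (-(1 / 2))).mem_nhds (by rw [Set.mem_ofPred_eq]; norm_num))
    exact DifferentiableOn.fun_finsetProd fun p _ =>
      ((differentiable_squareTerm p.2).const_add 1).differentiableOn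
  exact ((((hζ.mul (AnalyticAt.shift ((differentiable_trivFactor q).analyticAt (0 + 1)))).mul
    (AnalyticAt.shift (differentiable_riemannZeta₁.analyticAt (0 + 1)))).mul hT).mul
    (analyticAt_const_cpow hX 0)).mul (AnalyticAt.shift (analyticAt_Gamma (by norm_num)))

/-- The poles of `ζ(s+1)` and `Γ(s)` form a double pole. -/
lemma residue_integrand_zero_principal (hq : q ≠ 0) (hm : m ∣ q) {X : ℝ} (hX : 0 < X) :
    residue (integrand q (1 : DirichletCharacter ℂ m) X) 0 =
      deriv (fun s => trivFactor m s * principalCore q m X s) 0 := by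
  refine (hasResidueAt_double_pole (((differentiable_trivFactor m).analyticAt 0).mul
    (analyticAt_principalCore m hX)) ?_).residue_eq
  filter_upwards [eventually_re_gt (a := -(1 / 2)) (s := 0) (by norm_num),
    eventually_ne_nhdsNE 0 _, eventually_ne_nhdsNE 1 _] with s hs hs0 hs1
  exact integrand_principal_eq hq hm hs hs0 hs1

/-- Since `∏_{p ∣ m} (1 - p^{-s})` vanishes at `0`, the double pole loses its logarithmic term and
leaves the derivative `Λ(m)` of this product. -/
lemma residue_integrand_zero_of_one_lt (hq : q ≠ 0) (hm : m ∣ q) (hm1 : 1 < m) {X : ℝ}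
    (hX : 0 < X) : residue (integrand q (1 : DirichletCharacter ℂ m) X) 0 =
      -((q.totient : ℂ) / (2 * q)) * (ArithmeticFunction.vonMangoldt m : ℝ) := by
  rw [residue_integrand_zero_principal hq hm hX]
  have h := (hasDerivAt_trivFactor_zero hm1).mul (hasDerivAt_principalCore m hq hm hX)
  rw [trivFactor_zero hm1, principalCore_zero m hq hm, zero_mul, add_zero] at h
  exact h.deriv.trans (mul_comm _ _)

/-- The `log H` of the asymptotics comes from this double pole. -/
lemma residue_integrand_zero_of_eq_one (hq : q ≠ 0) (hm1 : m = 1) {X : ℝ}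
    (hX : 0 < X) : residue (integrand q (1 : DirichletCharacter ℂ m) X) 0 =
      ((-((q.totient : ℝ) / (2 * q)) * (Real.log (2 * Real.pi) +
      (∑ p ∈ q.primeFactors, Real.log p / ((p : ℝ) - 1)) + Real.log X) : ℝ) : ℂ) := by
  have hm : m ∣ q := by rw [hm1]; exact one_dvd q
  rw [residue_integrand_zero_principal hq hm hX]
  have e : (fun s => trivFactor m s * principalCore q m X s) = principalCore q m X := by
    funext s
    rw [trivFactor, hm1, Nat.primeFactors_one, Finset.prod_empty, one_mul]
  rw [e]
  exact (hasDerivAt_principalCore m hq hm hX).deriv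

end Residues

end SingularSeries

namespace SingularSeries

/-! ### Asymptotics -/

section Asymptotics

lemma rpow_le_add_rpow {X ε u : ℝ} (hX : 0 < X) (hu : u ∈ Set.Icc (-1 : ℝ) (-1 + ε)) :
    X ^ u ≤ X ^ (-1 : ℝ) + X ^ (-1 + ε) := by
  have h1 : 0 < X ^ (-1 : ℝ) := by positivity
  have h2 : 0 < X ^ (-1 + ε) := by positivity
  rcases le_total 1 X with h | h
  · linarith [Real.rpow_le_rpow_of_exponent_le h hu.2]
  · linarith [Real.rpow_le_rpow_of_exponent_ge hX h hu.1]

lemma isBigO_rpow_comp_div {f : ℝ → ℂ} {a d : ℝ} (hd : 0 < d)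
    (hf : f =O[atTop] fun X : ℝ => X ^ a) :
    (fun H => f (H / d)) =O[atTop] fun H : ℝ => H ^ a := by
  have h := hf.comp_tendsto (tendsto_id.atTop_div_const hd)
  refine h.trans (IsBigO.of_bound (‖(d ^ a)⁻¹‖) ?_)
  filter_upwards [eventually_gt_atTop 0] with H hH
  simp only [Function.comp_apply, id_eq]
  rw [Real.div_rpow hH.le hd.le, div_eq_inv_mul, norm_mul]

lemma isBigO_rpow_rpow {a b : ℝ} (hab : a ≤ b) :
    (fun H : ℝ => H ^ a) =O[atTop] fun H : ℝ => H ^ b := by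
  refine IsBigO.of_bound 1 ?_
  filter_upwards [eventually_ge_atTop 1] with H hH
  have hH0 : 0 < H := by linarith
  rw [Real.norm_of_nonneg (by positivity), Real.norm_of_nonneg (by positivity), one_mul]
  exact Real.rpow_le_rpow_of_exponent_le hH hab

variable (q : ℕ) {m : ℕ} [NeZero m] (χ : DirichletCharacter ℂ m)

/-- The poles of `F(s) X^s Γ(s)` with `Re s ≥ -1/2`, apart from those attached to zeros. -/
noncomputable def realPoles : Finset ℂ := {1, 0, -1 / 2}

lemma realPoles_bounds : ∀ z ∈ realPoles, z.im = 0 ∧ -(1 / 2) ≤ z.re ∧ z.re < (3 / 2 : ℝ) := by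
  intro z hz
  simp only [realPoles, Finset.mem_insert, Finset.mem_singleton] at hz
  rcases hz with rfl | rfl | rfl <;> norm_num

lemma mem_realPoles : ∀ z : ℂ, z = 1 ∨ z = 0 ∨ z = -1 / 2 → z ∈ realPoles ∨ (3 / 2 : ℝ) < z.re :=
  fun z hz => Or.inl (by simpa [realPoles] using hz)

/-- The limit that defines `zeroSumChar` exists. -/
lemma tendsto_zeroSumChar {X : ℝ} (hX : 0 < X) :
    Tendsto (fun T => partialZeroSum q χ X T) (heights (χ ^ 2)) (𝓝 (zeroSumChar q χ X)) := by
  obtain ⟨C, -, h⟩ := exists_tendsto_partialZeroSum q χ one_pos (c := 3 / 2) (by norm_num)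
    (by norm_num) (by norm_num) (by norm_num) realPoles_bounds mem_realPoles
  obtain ⟨Z, hZ, -⟩ := h X _ hX fun u hu => rpow_le_add_rpow hX hu
  have := heights_neBot (χ ^ 2)
  rw [zeroSumChar, hZ.limUnder_eq]
  exact hZ

/-- The contour shift for large `X`, when `X^u` is largest at the right end of the range of `u`. -/
lemma contour_isBigO {ε c : ℝ} (hε : 0 < ε)
    (hc : -(1 / 2) < c) (hc2 : c ≤ 2) (hc0 : c ≠ 0) (hc1 : c ≠ 1) {P : Finset ℂ}
    (hP1 : ∀ z ∈ P, z.im = 0 ∧ -(1 / 2) ≤ z.re ∧ z.re < c)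
    (hP2 : ∀ z : ℂ, z = 1 ∨ z = 0 ∨ z = -1 / 2 → z ∈ P ∨ c < z.re) :
    (fun X : ℝ => (2 * Real.pi : ℂ)⁻¹ * (∫ t : ℝ, integrand q χ X (c + t * Complex.I)) -
      (zeroSumChar q χ X + ∑ z ∈ P, residue (integrand q χ X) z))
      =O[atTop] fun X : ℝ => X ^ (-1 + ε) := by
  obtain ⟨C, hC, h⟩ := exists_tendsto_partialZeroSum q χ hε hc hc2 hc0 hc1 hP1 hP2
  refine IsBigO.of_bound ((2 * Real.pi)⁻¹ * C) ?_
  filter_upwards [eventually_ge_atTop 1] with X hX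
  have hX0 : 0 < X := by linarith
  obtain ⟨Z, hZ, hb⟩ := h X (X ^ (-1 + ε)) hX0 fun u hu =>
    Real.rpow_le_rpow_of_exponent_le hX hu.2
  have := heights_neBot (χ ^ 2)
  rw [← tendsto_nhds_unique (tendsto_zeroSumChar q χ hX0) hZ] at hb
  rw [Real.norm_of_nonneg (by positivity)]
  generalize (∫ t : ℝ, integrand q χ X (c + t * Complex.I)) = J at hb ⊢
  generalize zeroSumChar q χ X + ∑ z ∈ P, residue (integrand q χ X) z = W at hb ⊢
  have hpi : (Real.pi : ℂ) ≠ 0 := by exact_mod_cast Real.pi_ne_zero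
  have e : (2 * Real.pi : ℂ)⁻¹ * J - W = (2 * Real.pi * Complex.I)⁻¹ *
      (Complex.I * J - 2 * Real.pi * Complex.I * W) := by
    have := Complex.I_ne_zero
    field_simp
  have hn : ‖(2 * Real.pi * Complex.I : ℂ)⁻¹‖ = (2 * Real.pi)⁻¹ := by
    rw [norm_inv, norm_mul, norm_mul, Complex.norm_I, Complex.norm_real,
      Real.norm_of_nonneg Real.pi_pos.le]
    simp
  rw [e, norm_mul, hn, mul_assoc (2 * Real.pi)⁻¹]
  exact mul_le_mul_of_nonneg_left hb (by positivity)

/-- The sum over zeros is the difference of the integrals along `Re s = -1/2 + δ` and along the left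
edges, since the pole at `-1/2` has residue `0`. -/
lemma zeroSumChar_isBigO {ε : ℝ} (hε : 0 < ε) :
    (fun X : ℝ => zeroSumChar q χ X) =O[atTop] fun X : ℝ => X ^ (-(1 / 2 : ℝ) + ε) := by
  set δ : ℝ := min ε (1 / 4) with hδ
  have hδ0 : 0 < δ := lt_min hε (by norm_num)
  have hδ4 : δ ≤ 1 / 4 := min_le_right _ _
  set c : ℝ := -(1 / 2) + δ with hc
  have h := contour_isBigO q χ (ε := 1 / 2 + δ) (c := c) (P := {-1 / 2}) (by linarith)
    (by linarith) (by linarith) (by linarith) (by linarith)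
    (fun z hz => by
      rw [Finset.mem_singleton] at hz
      subst hz
      norm_num [hc, hδ0])
    (fun z hz => by
      rcases hz with rfl | rfl | rfl
      · right
        rw [Complex.one_re]
        linarith
      · right
        rw [Complex.zero_re]
        linarith
      · exact Or.inl (Finset.mem_singleton_self _))
  obtain ⟨C, hC, hint⟩ := exists_integrable_vertical q χ (c := c) (by linarith) (by linarith)
    (by linarith) (by linarith)
  have h2 : (fun X : ℝ => (2 * Real.pi : ℂ)⁻¹ * (∫ t : ℝ, integrand q χ X (c + t * Complex.I)))
      =O[atTop] fun X : ℝ => X ^ c := by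
    refine IsBigO.const_mul_left (IsBigO.of_bound C ?_) _
    filter_upwards [eventually_gt_atTop 0] with X hX
    rw [Real.norm_of_nonneg (by positivity)]
    exact (hint X hX).2
  rw [show -1 + (1 / 2 + δ) = c by rw [hc]; ring] at h
  have h3 : (fun X : ℝ => zeroSumChar q χ X) =O[atTop] fun X : ℝ => X ^ c := by
    refine (h2.sub h).congr' ?_ EventuallyEq.rfl
    filter_upwards [eventually_gt_atTop 0] with X hX
    rw [Finset.sum_singleton, residue_integrand_neg_half χ hX]
    ring
  exact h3.trans (isBigO_rpow_rpow (by linarith [min_le_left ε (1 / 4)]))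

lemma sum_realPoles (f : ℂ → ℂ) : ∑ z ∈ realPoles, f z = f 1 + f 0 + f (-1 / 2) := by
  rw [realPoles, Finset.sum_insert (by norm_num [Complex.ext_iff]),
    Finset.sum_insert (by norm_num [Complex.ext_iff]), Finset.sum_singleton]
  ring

open Classical in
/-- The contour shift from `Re s = 3/2`, with the residues at `1` and `-1/2` evaluated. -/
lemma smoothed_isBigO {q : ℕ} (hq : q ≠ 0) (hm : m ∣ q) {ε : ℝ} (hε : 0 < ε) :
    (fun X : ℝ => (2 * Real.pi : ℂ)⁻¹ *
        (∫ t : ℝ, integrand q χ X ((3 / 2 : ℝ) + t * Complex.I)) -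
      (zeroSumChar q χ X + residue (integrand q χ X) 0 +
        if χ = 1 then (m.totient : ℂ) / m * X else 0))
      =O[atTop] fun X : ℝ => X ^ (-1 + ε) := by
  refine (contour_isBigO q χ hε (c := 3 / 2) (by norm_num) (by norm_num) (by norm_num)
    (by norm_num) realPoles_bounds mem_realPoles).congr' ?_ EventuallyEq.rfl
  filter_upwards [eventually_gt_atTop 0] with X hX
  rw [sum_realPoles, residue_integrand_neg_half χ hX]
  congr 1
  split_ifs with h
  · subst h
    rw [residue_integrand_one_principal hq hm hX]
    ring
  · rw [residue_integrand_one_of_ne hq h hX]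
    ring

end Asymptotics

section Total

variable (q : ℕ) [NeZero q] (v : ℤ)

lemma zeroSum_isBigO {ε : ℝ} (hε : 0 < ε) :
    (fun H : ℝ => zeroSum q v H) =O[atTop] fun H : ℝ => H ^ (-(1 / 2 : ℝ) + ε) := by
  have hd : (0 : ℝ) < Int.gcd v q := by exact_mod_cast gcd_modulus_pos q v
  refine IsBigO.const_mul_left (IsBigO.fun_sum fun χ _ => IsBigO.const_mul_left ?_ _) _
  exact isBigO_rpow_comp_div hd (zeroSumChar_isBigO q χ hε)

open Classical in
lemma progression_isBigO {ε : ℝ} (hε : 0 < ε) :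
    (fun H : ℝ => (((∑' h : ℕ, if 0 < h ∧ (h : ℤ) ≡ v [ZMOD q] then Real.exp (-(h : ℝ) / H)
      else 0) - (H / q + sawtooth q v) : ℝ) : ℂ)) =O[atTop] fun H : ℝ => H ^ (-1 + ε) := by
  have hq : 0 < q := Nat.pos_of_ne_zero (NeZero.ne q)
  refine IsBigO.trans (IsBigO.of_bound (12 * q : ℝ) ?_)
    (isBigO_rpow_rpow (a := -1) (by linarith))
  filter_upwards [eventually_ge_atTop (q : ℝ)] with H hH
  have hH0 : 0 < H := lt_of_lt_of_le (by exact_mod_cast hq) hH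
  rw [Complex.norm_real, Real.norm_eq_abs, Real.norm_of_nonneg (by positivity), Real.rpow_neg_one,
    mul_assoc, ← div_eq_mul_inv]
  exact abs_tsum_exp_progression_sub_le hq v hH

open Classical in
/-- The poles at `s = 1` cancel the main term of the sum of `e^{-h/H}` over the progression. -/
lemma smoothedSum_isBigO {ε : ℝ} (hε : 0 < ε) :
    (fun H : ℝ => (smoothedSum q v H : ℂ) -
      (1 / ((cofactor q v).totient : ℂ) * ∑ χ : DirichletCharacter ℂ (cofactor q v),
        (starRingEnd ℂ) (χ (reducedClass q v)) * residue (integrand q χ (H / (Int.gcd v q : ℝ))) 0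
        - (sawtooth q v : ℂ) + zeroSum q v H)) =O[atTop] fun H : ℝ => H ^ (-1 + ε) := by
  have hd : (0 : ℝ) < Int.gcd v q := by exact_mod_cast gcd_modulus_pos q v
  have hm : cofactor q v ∣ q := ⟨_, ((mul_comm _ _).trans (gcd_mul_cofactor q v)).symm⟩
  have h1 : ∀ χ : DirichletCharacter ℂ (cofactor q v), _ := fun χ =>
    isBigO_rpow_comp_div hd (smoothed_isBigO χ (NeZero.ne q) hm hε)
  have h2 := ((IsBigO.fun_sum (s := Finset.univ) fun χ _ => (h1 χ).const_mul_left
    ((starRingEnd ℂ) (χ (reducedClass q v)))).const_mul_left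
    (1 / ((cofactor q v).totient : ℂ))).sub (progression_isBigO q v hε)
  refine h2.congr' ?_ EventuallyEq.rfl
  filter_upwards [eventually_gt_atTop 0] with H hH
  have h3 : (smoothedSum q v H : ℂ) = _ :=
    (Complex.ofReal_tsum _).trans (hasSum_smoothedTerm (q := q) (v := v) hH).tsum_eq
  rw [h3, zeroSum]
  obtain ⟨J, hJ⟩ : ∃ J : DirichletCharacter ℂ (cofactor q v) → ℂ, ∀ χ, J χ =
      (2 * Real.pi : ℂ)⁻¹ * ∫ t : ℝ, integrand q χ (H / (Int.gcd v q : ℝ))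
        ((3 / 2 : ℝ) + t * Complex.I) := ⟨_, fun _ => rfl⟩
  simp only [← hJ]
  generalize (∑' h : ℕ, if 0 < h ∧ (h : ℤ) ≡ v [ZMOD q] then Real.exp (-(h : ℝ) / H) else 0) = E
  have h5 : ((cofactor q v).totient : ℂ) ≠ 0 := by
    exact_mod_cast (Nat.totient_pos.mpr (Nat.pos_of_ne_zero (NeZero.ne _))).ne'
  have h6 : ((cofactor q v : ℕ) : ℂ) ≠ 0 := by exact_mod_cast NeZero.ne _
  have h7 : ((Int.gcd v q : ℕ) : ℂ) ≠ 0 := by exact_mod_cast (gcd_modulus_pos q v).ne'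
  have h8 : (q : ℂ) = (Int.gcd v q : ℕ) * (cofactor q v : ℕ) := by
    exact_mod_cast (gcd_mul_cofactor q v).symm
  have h4 : ∑ χ : DirichletCharacter ℂ (cofactor q v), (starRingEnd ℂ) (χ (reducedClass q v)) *
      (if χ = 1 then ((cofactor q v).totient : ℂ) / (cofactor q v : ℕ) *
        ((H / (Int.gcd v q : ℝ) : ℝ) : ℂ) else 0) = ((cofactor q v).totient : ℂ) * (H / q) := by
    rw [Finset.sum_eq_single 1]
    · rw [MulChar.one_apply (isUnit_reducedClass q v), map_one, if_pos rfl, h8]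
      push_cast
      field_simp
    · intro χ _ hχ
      rw [if_neg hχ, mul_zero]
    · intro h
      exact absurd (Finset.mem_univ _) h
  simp only [mul_sub, mul_add, Finset.sum_sub_distrib, Finset.sum_add_distrib]
  rw [h4]
  push_cast
  field_simp
  ring

end Total

end SingularSeries

namespace SingularSeries

section Classes

variable (q : ℕ) [NeZero q] {v : ℤ}

omit [NeZero q] in
lemma gcd_eq_of_dvd (hv : (q : ℤ) ∣ v) : Int.gcd v q = q := by
  rw [Int.gcd_eq_natAbs_right hv, Int.natAbs_natCast]

lemma sawtooth_of_dvd (hv : (q : ℤ) ∣ v) : sawtooth q v = -1 / 2 := by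
  have hq : (0 : ℤ) < q := by exact_mod_cast Nat.pos_of_ne_zero (NeZero.ne q)
  have hqR : (q : ℝ) ≠ 0 := by exact_mod_cast NeZero.ne q
  have h : (v - 1) % (q : ℤ) = q - 1 := by
    obtain ⟨k, rfl⟩ := hv
    rw [show (q : ℤ) * k - 1 = (q - 1) + q * (k - 1) by ring, Int.add_mul_emod_self_left]
    exact Int.emod_eq_of_lt (by linarith) (by linarith)
  rw [sawtooth, h]
  push_cast
  rw [sub_add_cancel, div_self hqR]
  norm_num

/-- Only the character modulo `1` occurs; the double pole at `0` gives the logarithm. -/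
lemma smoothedSum_sub_isBigO_of_dvd (hv : (q : ℤ) ∣ v) {ε : ℝ} (hε : 0 < ε) :
    (fun H : ℝ => (smoothedSum q v H : ℂ) -
        ((-((q.totient : ℝ) / (2 * q)) * Real.log H + constantZero q : ℝ) + zeroSum q v H))
      =O[atTop] fun H : ℝ => H ^ (-1 + ε) := by
  have hq : 0 < q := Nat.pos_of_ne_zero (NeZero.ne q)
  have hqR : (0 : ℝ) < q := by exact_mod_cast hq
  have hcof : cofactor q v = 1 := by rw [cofactor, gcd_eq_of_dvd q hv, Nat.div_self hq]
  refine (smoothedSum_isBigO q v hε).congr' ?_ EventuallyEq.rfl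
  filter_upwards [eventually_gt_atTop 0] with H hH
  congr 2
  have hall : ∀ χ : DirichletCharacter ℂ (cofactor q v), χ = 1 := fun χ =>
    DirichletCharacter.level_one' χ hcof
  rw [Finset.sum_eq_single 1 (fun χ _ h => absurd (hall χ) h)
    (fun h => absurd (Finset.mem_univ _) h), MulChar.one_apply (isUnit_reducedClass q v), map_one,
    residue_integrand_zero_of_eq_one hq.ne' hcof (by rw [gcd_eq_of_dvd q hv]; positivity),
    sawtooth_of_dvd q hv, gcd_eq_of_dvd q hv, hcof, Nat.totient_one, constantZero,
    Real.log_div hH.ne' hqR.ne', Real.log_div hqR.ne' (by positivity)]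
  push_cast
  ring

/-- The residue of the principal character gives the term with `Λ`. -/
lemma smoothedSum_sub_isBigO_of_lt (hv : Int.gcd v q < q) {ε : ℝ} (hε : 0 < ε) :
    (fun H : ℝ => (smoothedSum q v H : ℂ) - (constantNonzero q v + zeroSum q v H))
      =O[atTop] fun H : ℝ => H ^ (-1 + ε) := by
  classical
  have hq : q ≠ 0 := NeZero.ne q
  have hd : (0 : ℝ) < Int.gcd v q := by exact_mod_cast gcd_modulus_pos q v
  have hm : cofactor q v ∣ q := ⟨_, ((mul_comm _ _).trans (gcd_mul_cofactor q v)).symm⟩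
  have hcof : 1 < cofactor q v := by
    have h1 := gcd_mul_cofactor q v
    have h2 := NeZero.ne (cofactor q v)
    by_contra h3
    have h4 : cofactor q v = 1 := by lia
    rw [h4, mul_one] at h1
    exact hv.ne h1
  refine (smoothedSum_isBigO q v hε).congr' ?_ EventuallyEq.rfl
  filter_upwards [eventually_gt_atTop 0] with H hH
  congr 2
  have e : ∀ χ : DirichletCharacter ℂ (cofactor q v), (starRingEnd ℂ) (χ (reducedClass q v)) *
      residue (integrand q χ (H / (Int.gcd v q : ℝ))) 0 =
      (if χ = 1 then -((q.totient : ℂ) / (2 * q)) *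
        (ArithmeticFunction.vonMangoldt (cofactor q v) : ℝ) else 0) +
      if χ = 1 then 0 else (starRingEnd ℂ) (χ (reducedClass q v)) * χ.LFunction 0 *
        χ.LFunction 1 * eulerConstant q χ := by
    intro χ
    split_ifs with h
    · subst h
      rw [MulChar.one_apply (isUnit_reducedClass q v), map_one,
        residue_integrand_zero_of_one_lt hq hm hcof (div_pos hH hd), one_mul, add_zero]
    · rw [residue_integrand_zero_of_ne hq h (div_pos hH hd)]
      ring
  simp_rw [e]
  rw [Finset.sum_add_distrib, Finset.sum_ite_eq' Finset.univ, if_pos (Finset.mem_univ _),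
    constantNonzero]
  ring_nf

end Classes

end SingularSeries

open SingularSeries in
theorem proposition2p1 (q : ℕ) [NeZero q] (hq : 2 ≤ q) (v : ℤ) :
    -- the series defining `S_0(q,v;H)` converges
    (∀ H : ℝ, 0 < H → Summable (smoothedTerm q v H)) ∧
    -- for every character `χ` modulo `q/d`, the function `F_{q,χ}` is the meromorphic continuation
    -- to `Re s > -1` of its Dirichlet series, and the sum over zeros `Z_{q,χ}(H)` converges
    (∀ χ : DirichletCharacter ℂ (cofactor q v),
      MeromorphicOn (F q χ) {s : ℂ | -1 < s.re} ∧
      (∀ s : ℂ, 1 < s.re →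
        LSeriesHasSum
          (fun h : ℕ => χ (h : ZMod (cofactor q v)) * (singularSeries q {0, (h : ℤ)} : ℂ))
          s (F q χ s)) ∧
      (heights (χ ^ 2)).NeBot ∧
      ∀ H : ℝ, 0 < H →
        Tendsto (fun T : ℝ => partialZeroSum q χ H T) (heights (χ ^ 2))
          (𝓝 (zeroSumChar q χ H))) ∧
    -- the bound for `Z_{q,v}(H)`
    (∀ ε : ℝ, 0 < ε →
      (fun H : ℝ => zeroSum q v H) =O[atTop] fun H : ℝ => H ^ (-(1 / 2 : ℝ) + ε)) ∧
    -- the class `v ≡ 0`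
    ((q : ℤ) ∣ v → ∀ ε : ℝ, 0 < ε →
      (fun H : ℝ => (smoothedSum q v H : ℂ) -
          ((-((q.totient : ℝ) / (2 * q)) * Real.log H + constantZero q : ℝ) + zeroSum q v H))
        =O[atTop] fun H : ℝ => H ^ (-1 + ε)) ∧
    -- the classes with `(v,q) < q`
    (Int.gcd v q < q → ∀ ε : ℝ, 0 < ε →
      (fun H : ℝ => (smoothedSum q v H : ℂ) - (constantNonzero q v + zeroSum q v H))
        =O[atTop] fun H : ℝ => H ^ (-1 + ε)) := by
  exact ⟨fun H hH => summable_smoothedTerm hH, fun χ => ⟨meromorphicOn_F q χ,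
    fun s hs => LSeriesHasSum_F (by lia) hs, heights_neBot (χ ^ 2),
    fun H hH => tendsto_zeroSumChar q χ hH⟩, fun ε hε => zeroSum_isBigO q v hε,
    fun hv ε hε => smoothedSum_sub_isBigO_of_dvd q hv hε,
    fun hv ε hε => smoothedSum_sub_isBigO_of_lt q hv hε⟩
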